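/- **Definitions.** A partition is strict if its nonzero parts are distinct, and odd if its nonzero parts are odd. For a strict partition $\lambda$ of $n$ and an odd partition $\rho$ of $n$, the rational number $X^\lambda_\rho$ is the coefficient of Schur's $P$-function $P_\lambda$ in the expansion $p_\rho=\sum_{\lambda} X^\lambda_\rho P_\lambda$ (sum over strict partitions of $n$) of the power-sum symmetric function $p_\rho=p_{\rho_1}p_{\rho_2}\cdots$, and $g^\lambda=X^\lambda_{(1^n)}$. For an integer $k\ge 1$ and a strict partition $\lambda$ of $n$, the spin character is $$\mathfrak{p}_{2k-1}(\lambda)=n(n-1)\cdots(n-2k+2)\,\frac{X^\lambda_{(2k-1,\,1^{n-2k+1})}}{g^\lambda}\quad (2k-1\le n),\qquad \mathfrak{p}_{2k-1}(\lambda)=0\quad (2k-1>n).$$ For a Young diagram $Y$ drawn in Russian style, let $x_1<y_1<\cdots<y_{r-1}<x_r$ be the alternating local minima and maxima of its profile; the transition measure $\mathfrak{m}_Y$ is the probability measure on $\{x_1,\dots,x_r\}$ with Cauchy transform $\prod_{i=1}^{r-1}(z-y_i)/\prod_{i=1}^{r}(z-x_i)$, and $R_j(Y)$ is its $j$-th free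 cumulant. The double $D(\lambda)$ of a strict partition $\lambda=(\lambda_1>\cdots>\lambda_l>0)$ is the Young diagram with modified Frobenius notation $[\lambda_1+\frac12,\dots,\lambda_l+\frac12\,|\,\lambda_1-\frac12,\dots,\lambda_l-\frac12]$, that is, for $1\le i\le l$ its $i$-th row has length $\lambda_i+i$ and its $i$-th column has length $\lambda_i+i-1$, and it has exactly $l$ boxes on the diagonal. Put $\mathfrak{R}_{2k}(\lambda)=\frac12 R_{2k}(D(\lambda))$. **Statement.** For each $k\in\{1,2,3,4,5\}$ there is exactly one polynomial $K^{\mathrm{spin}}_{2k-1}$ in $k$ variables with rational coefficients (the spin Kerov polynomial) such that $$\mathfrak{p}_{2k-1}(\lambda)=K^{\mathrm{spin}}_{2k-1}(\mathfrak{R}_2(\lambda),\mathfrak{R}_4(\lambda),\dots,\mathfrak{R}_{2k}(\lambda))\quad\text{for all strict partitions }\lambda,$$ and, with $\mathfrak{R}_2,\mathfrak{R}_4,\dots$ denoting the variables, these polynomials are \begin{align*} K_1^{\mathrm{spin}}&= \mathfrak{R}_2, \\ K_3^{\mathrm{spin}}&= \mathfrak{R}_4+\mathfrak{R}_2, \\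 K_5^{\mathrm{spin}}&= \mathfrak{R}_6+ 15\mathfrak{R}_4 + 10 \mathfrak{R}_2^2 +8 \mathfrak{R}_2, \\ K_7^{\mathrm{spin}}&= \mathfrak{R}_8+70\mathfrak{R}_6+ 168\mathfrak{R}_4 \mathfrak{R}_2+ 56 \mathfrak{R}_2^3+ 469 \mathfrak{R}_4 +560 \mathfrak{R}_2^2 +180 \mathfrak{R}_2, \\ K_9^{\mathrm{spin}}&= \mathfrak{R}_{10} +210 \mathfrak{R}_{8}+600 \mathfrak{R}_{6} \mathfrak{R}_{2} + 540 \mathfrak{R}_{4}^2+1080 \mathfrak{R}_{4} \mathfrak{R}_{2}^2 +240 \mathfrak{R}_{2}^4 +5985 \mathfrak{R}_{6} \\ &\quad +23016 \mathfrak{R}_{4} \mathfrak{R}_{2}+9120 \mathfrak{R}_{2}^3+26060 \mathfrak{R}_{4} + 41628\mathfrak{R}_{2}^2 + 8064 \mathfrak{R}_{2}. \end{align*} -/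

import Mathlib

open MeasureTheory

noncomputable section

namespace SpinKerov

/-! ### Strict partitions and their doubles -/

/-- Strict partitions of `n`: the (positive) parts are pairwise distinct. -/
abbrev StrictPartition (n : ℕ) : Type := {μ : n.Partition // μ.parts.Nodup}

/-- The list `λ₁ > λ₂ > ⋯ > λ_l > 0` of parts, in decreasing order. -/
def StrictPartition.rows {n : ℕ} (μ : StrictPartition n) : List ℕ :=
  μ.1.parts.sort (fun a b => b ≤ a)

/-- The length `l = ℓ(λ)`. -/
def StrictPartition.len {n : ℕ} (μ : StrictPartition n) : ℕ := μ.rows.length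

/-- The `i`-th part, indexed from `0`. -/
def StrictPartition.part {n : ℕ} (μ : StrictPartition n) (i : ℕ) : ℕ := μ.rows.getD i 0

theorem StrictPartition.part_lt {n : ℕ} (μ : StrictPartition n) {i j : ℕ} (hij : i < j)
    (hj : j < μ.len) : μ.part j < μ.part i := by
  have hs : μ.rows.Pairwise (fun a b => b ≤ a) := Multiset.pairwise_sort _ _
  have hn : μ.rows.Nodup := by
    rw [← Multiset.coe_nodup, StrictPartition.rows, Multiset.sort_eq]
    exact μ.2
  have hj' : j < μ.rows.length := hj
  have hi' : i < μ.rows.length := hij.trans hj'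
  have h1 := List.pairwise_iff_getElem.1 hs i j hi' hj' hij
  have h2 := List.pairwise_iff_getElem.1 hn i j hi' hj' hij
  simp only [StrictPartition.part, List.getD_eq_getElem _ _ hi', List.getD_eq_getElem _ _ hj']
  omega

theorem StrictPartition.part_add_le {n : ℕ} (μ : StrictPartition n) {i : ℕ} (d : ℕ)
    (hj : i + d < μ.len) : μ.part (i + d) + d ≤ μ.part i := by
  induction d with
  | zero => simp
  | succ d ih =>
    have h1 := ih (by omega)
    have h2 := μ.part_lt (i := i + d) (j := i + (d + 1)) (by omega) hj
    omega

/-- The cells of the double diagram: a cell `(i, j)` (row `i`, column `j`, from `0`) weakly to the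
right of the diagonal belongs to the `i`-th diagonal hook, whose arm has `λᵢ` cells; a cell below
the diagonal belongs to the `j`-th diagonal hook, whose leg has `λⱼ - 1` cells. -/
def StrictPartition.doubleCells {n : ℕ} (μ : StrictPartition n) : Finset (ℕ × ℕ) :=
  (Finset.range μ.len).biUnion fun i =>
    (Finset.range (μ.part i + 1)).image (fun s => (i, i + s)) ∪
      (Finset.range (μ.part i)).image (fun t => (i + t, i))

theorem StrictPartition.mem_doubleCells {n : ℕ} (μ : StrictPartition n) (i j : ℕ) :
    (i, j) ∈ μ.doubleCells ↔
      (i ≤ j ∧ i < μ.len ∧ j ≤ i + μ.part i) ∨ (j ≤ i ∧ j < μ.len ∧ i < j + μ.part j) := by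
  simp only [StrictPartition.doubleCells, Finset.mem_biUnion, Finset.mem_union, Finset.mem_image,
    Finset.mem_range, Prod.mk.injEq]
  constructor
  · rintro ⟨a, ha, ⟨s, hs, rfl, rfl⟩ | ⟨t, ht, rfl, rfl⟩⟩
    · left; omega
    · right; omega
  · rintro (⟨h1, h2, h3⟩ | ⟨h1, h2, h3⟩)
    · exact ⟨i, h2, Or.inl ⟨j - i, by omega, rfl, by omega⟩⟩
    · exact ⟨j, h2, Or.inr ⟨i - j, by omega, by omega, rfl⟩⟩

/-- The double `D(λ)`, the Young diagram with modified Frobenius notation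
`[λ₁ + 1/2, …, λ_l + 1/2 | λ₁ - 1/2, …, λ_l - 1/2]`. -/
def StrictPartition.double {n : ℕ} (μ : StrictPartition n) : YoungDiagram where
  cells := μ.doubleCells
  isLowerSet := by
    rintro ⟨i, j⟩ ⟨i', j'⟩ ⟨hi, hj⟩ h
    simp only at hi hj
    rw [Finset.mem_coe, StrictPartition.mem_doubleCells] at h ⊢
    rcases h with ⟨h1, h2, h3⟩ | ⟨h1, h2, h3⟩
    · rcases le_total i' j' with h4 | h4
      · left
        have := μ.part_add_le (i := i') (i - i') (by omega)
        rw [show i' + (i - i') = i by omega] at this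
        omega
      · right
        have := μ.part_add_le (i := j') (i - j') (by omega)
        rw [show j' + (i - j') = i by omega] at this
        have h5 : 0 < μ.part i := by
          have : μ.part i ∈ μ.rows := by
            have h2' : i < μ.rows.length := h2
            simp only [StrictPartition.part, List.getD_eq_getElem _ _ h2']
            exact List.getElem_mem h2'
          rw [StrictPartition.rows, Multiset.mem_sort] at this
          exact μ.1.parts_pos this
        omega
    · rcases le_total i' j' with h4 | h4
      · left
        have := μ.part_add_le (i := i') (j - i') (by omega)
        rw [show i' + (j - i') = j by omega] at this
        omega
      · right
        have := μ.part_add_le (i := j') (j - j') (by omega)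
        rw [show j' + (j - j') = j by omega] at this
        omega

/-! ### Transition measure and free cumulants -/

/-- The profile of a Young diagram in Russian style at an integer point `k`: the boundary of the
empty diagram is `|u|`, and the boxes of content `k` (column minus row) are stacked above `k`, each
of height `2`.  Between consecutive integers the profile is linear. -/
def profile (Y : YoungDiagram) (k : ℤ) : ℤ :=
  |k| + 2 * ((Y.cells.filter fun c => (c.2 : ℤ) - (c.1 : ℤ) = k).card : ℤ)

/-- The local minima `x₁ < ⋯ < x_r` of the profile (they all lie in `[-|Y|, |Y|]`). -/
def minima (Y : YoungDiagram) : Finset ℤ :=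
  (Finset.Icc (-(Y.card : ℤ)) (Y.card : ℤ)).filter fun k =>
    profile Y k < profile Y (k - 1) ∧ profile Y k < profile Y (k + 1)

/-- The local maxima `y₁ < ⋯ < y_{r-1}` of the profile (they all lie in `[-|Y|, |Y|]`). -/
def maxima (Y : YoungDiagram) : Finset ℤ :=
  (Finset.Icc (-(Y.card : ℤ)) (Y.card : ℤ)).filter fun k =>
    profile Y (k - 1) < profile Y k ∧ profile Y (k + 1) < profile Y k

/-- Kerov's transition measure: the measure on `{x₁, …, x_r}` whose Cauchy transform is
`∏ (z - yⱼ) / ∏ (z - xᵢ)`; its mass at `xᵢ` is the residue of this function at `xᵢ`. -/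
def transitionMeasure (Y : YoungDiagram) : Measure ℝ :=
  ∑ x ∈ minima Y,
    ENNReal.ofReal ((∏ y ∈ maxima Y, ((x : ℝ) - (y : ℝ))) /
      ∏ x' ∈ (minima Y).erase x, ((x : ℝ) - (x' : ℝ))) • Measure.dirac (x : ℝ)

/-- The moment series `M(z) = ∑ₖ Mₖ zᵏ` with `Mₖ = ∫ xᵏ dm`. -/
def momentSeries (m : Measure ℝ) : PowerSeries ℝ := PowerSeries.mk fun k => ∫ x, x ^ k ∂m

/-- Free cumulants `Rₙ` of a probability measure with compact support, by the free
moment-cumulant formula `M(z) = 1 + ∑_{s ≥ 1} R_s z^s M(z)^s`, that is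
`Mₙ = ∑_{s = 1}^{n} R_s [z^{n-s}] M(z)^s` for `n ≥ 1`, solved recursively for `Rₙ`. -/
def freeCumulant (m : Measure ℝ) (n : ℕ) : ℝ :=
  (∫ x, x ^ n ∂m) -
    ∑ s ∈ (Finset.Ico 1 n).attach,
      freeCumulant m s.1 * PowerSeries.coeff (n - s.1) (momentSeries m ^ s.1)
termination_by n
decreasing_by exact (Finset.mem_Ico.1 s.2).2

/-- The spin free cumulant of even index `j = 2k`: half of the free cumulant `R_j(D(λ))`. -/
def spinFreeCumulant (j : ℕ) {n : ℕ} (μ : StrictPartition n) : ℝ :=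
  freeCumulant (transitionMeasure μ.double) j / 2

/-! ### Schur `P`-functions and spin characters -/

/-- The Schur `P`-polynomial `P_λ(x₁, …, x_N)`, the Hall-Littlewood polynomial at `t = -1`:
`∑_{w ∈ S_N / S_{N-l}} w (x₁^λ₁ ⋯ x_l^λ_l ∏_{i ≤ l, i < j ≤ N} (xᵢ + xⱼ) / (xᵢ - xⱼ))`.
A coset `w S_{N-l}` is the injection `f` that sends `i ≤ l` to `w(i)`; for `i ≤ l`, the `w(j)` with
`j > i` are the indices different from `f 1, …, f i`.  The sum is empty (zero) when `N < l`. -/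
def schurP (N : ℕ) {n : ℕ} (μ : StrictPartition n) : FractionRing (MvPolynomial (Fin N) ℚ) :=
  let x : Fin N → FractionRing (MvPolynomial (Fin N) ℚ) := fun a =>
    algebraMap (MvPolynomial (Fin N) ℚ) _ (MvPolynomial.X a)
  ∑ f : Fin μ.len ↪ Fin N, ∏ i : Fin μ.len,
    (x (f i) ^ μ.part i *
      ∏ a ∈ Finset.univ.filter (fun a => ∀ i' ≤ i, a ≠ f i'),
        (x (f i) + x a) / (x (f i) - x a))

/-- `c` is the family of coefficients in `p_ρ = ∑_λ c_λ P_λ`, an identity of symmetric functions,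
that is, one that holds in `N` variables for every `N`. -/
def IsSchurPExpansion {n : ℕ} (ρ : n.Partition) (c : StrictPartition n → ℚ) : Prop :=
  ∀ N : ℕ, algebraMap (MvPolynomial (Fin N) ℚ) (FractionRing (MvPolynomial (Fin N) ℚ))
      (MvPolynomial.psumPart (Fin N) ℚ ρ) = ∑ μ : StrictPartition n, c μ • schurP N μ

open scoped Classical in
/-- The spin character value `X^λ_ρ`, the coefficient of `P_λ` in the expansion of `p_ρ`
(for odd partitions `ρ`). -/
def spinX {n : ℕ} (μ : StrictPartition n) (ρ : n.Partition) : ℚ :=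
  if h : ∃! c : StrictPartition n → ℚ, IsSchurPExpansion ρ c then h.choose μ else 0

/-- The partition `ρ ∪ (1^{n-k})` of `n`, for a partition `ρ` of `k ≤ n`. -/
def addOnes {k n : ℕ} (ρ : k.Partition) (h : k ≤ n) : n.Partition where
  parts := ρ.parts + Multiset.replicate (n - k) 1
  parts_pos := by
    intro i hi
    rcases Multiset.mem_add.1 hi with hi | hi
    · exact ρ.parts_pos hi
    · rw [Multiset.eq_of_mem_replicate hi]; exact one_pos
  parts_sum := by
    rw [Multiset.sum_add, ρ.parts_sum, Multiset.sum_replicate]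
    simp only [smul_eq_mul, mul_one]
    omega

/-- The normalized spin character
`𝔭_ρ(λ) = n (n - 1) ⋯ (n - k + 1) X^λ_{ρ ∪ (1^{n-k})} / g^λ` with `g^λ = X^λ_{(1^n)}`, for `ρ ⊢ k`
odd and `λ ⊢ n` strict; it is `0` when `k > n`. -/
def spinCharacter {k n : ℕ} (ρ : k.Partition) (μ : StrictPartition n) : ℚ :=
  if h : k ≤ n then
    (n.descFactorial k : ℚ) * spinX μ (addOnes ρ h) /
      spinX μ (addOnes (Nat.Partition.indiscrete 0) (Nat.zero_le n))
  else 0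

/-- `K` is a spin Kerov polynomial for `𝔭_{2k-1}` (`k ≥ 1`), the variable `X i` of `K` standing for
the spin free cumulant of index `2 (i + 1)`. -/
def IsSpinKerovPolynomial (k : ℕ) (K : MvPolynomial (Fin k) ℚ) : Prop :=
  ∀ (n : ℕ) (μ : StrictPartition n),
    (spinCharacter (Nat.Partition.indiscrete (2 * k - 1)) μ : ℝ) =
      MvPolynomial.aeval (fun i : Fin k => spinFreeCumulant (2 * ((i : ℕ) + 1)) μ) K

end SpinKerov

end

/-! Both sides are polynomials in the odd power sums p₁, p₃, …, p₉ of the parts of λ; once these are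
known, the stated formulas are ring identities.

Characters. The Pieri rule says that p₁ P_μ is the sum of the P_λ with λ obtained from μ by adding a
box (`sum_mul_schurPSet`). Hence X^λ at (r, 1^{d+1}) is the sum of X^μ at (r, 1^d) over the μ
obtained from λ by removing a box. Let w(λ) = g^λ / n!, an explicit product (`schurWeight`). If f
satisfies ∑_μ w(μ) f(μ) = (n - r) w(λ) f(λ) (`IsLowering`) and w f gives the coefficients of p_r in
degree r, then X^λ = (n - r)! w(λ) f(λ) in every degree n ≥ r, so 𝔭_r = f. The start of the
induction is p_r = P_(r) + 2 ∑ (-1)^b P_(r-b, b) for odd r (`odd_psum_eq`). For the lowering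
identity, let the removed box lower the part m. The ratio w(μ)/w(λ) is, up to the factor -1/2, a
residue at u = m(m - 1) of a rational function whose numerator and denominator have roots b(b + 1)
and b(b - 1). Its moments in u are therefore polynomials in odd power sums (`sum_lowerWeight_eq`),
while f(μ) is a polynomial in u; the identity becomes one between polynomials (`sum_lowerPart_eq`).

Cumulants. The diagonal hooks of D(λ) determine its profile, and the Cauchy transform of its
transition measure is z⁻¹ ∏ (z - b)(z - 1 + b) / ((z - b - 1)(z + b)) over the parts b
(`prod_minima_mul`). So the moment series has an explicit logarithmic derivative, and the free
cumulants follow (`freeCumulant_double`).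

Uniqueness. A polynomial in p₁, …, p₉ that vanishes on all strict partitions is zero
(`eq_zero_of_eval_oddPowerSums`), and the spin free cumulants are triangular in these power sums,
hence algebraically independent. -/

noncomputable section

namespace SpinKerov

/-! ### Partial fractions -/

section PartialFractions

open Polynomial

variable {K ι : Type*} [Field K]

theorem prod_inv_sub {s : Finset ι} (u : ι → K) {t : K} (ht : t ≠ 0) :
    ∏ b ∈ s, (t⁻¹ - u b) = (t ^ s.card)⁻¹ * ∏ b ∈ s, (1 - u b * t) := by
  rw [← inv_pow, ← Finset.prod_const, ← Finset.prod_mul_distrib]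
  refine Finset.prod_congr rfl fun b _ => ?_
  field_simp

theorem coe_one_sub_mul_mk (a : K) :
    ((1 - C a * X : K[X]) : PowerSeries K) * PowerSeries.mk (fun k => a ^ k) = 1 := by
  ext k
  rw [coe_sub, coe_mul, coe_C, coe_X, coe_one, sub_mul, one_mul, mul_assoc]
  rcases k with _ | k
  · simp
  · rw [map_sub, PowerSeries.coeff_C_mul, PowerSeries.coeff_succ_X_mul]
    simp [PowerSeries.coeff_one, pow_succ']

variable [DecidableEq ι]

theorem eval_eq_sum_prod_erase {s : Finset ι} {u : ι → K} (hu : Set.InjOn u s) {Q : K[X]}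
    (hQ : Q.degree < s.card) (z : K) :
    Q.eval z = ∑ b ∈ s, Q.eval (u b) / (∏ c ∈ s.erase b, (u b - u c)) *
      ∏ c ∈ s.erase b, (z - u c) := by
  conv_lhs => rw [Lagrange.eq_interpolate hu hQ]
  rw [Lagrange.interpolate_apply, eval_finsetSum]
  refine Finset.sum_congr rfl fun b _ => ?_
  simp only [Lagrange.basis, Lagrange.basisDivisor, eval_mul, eval_C, eval_prod, eval_sub, eval_X,
    Finset.prod_mul_distrib, Finset.prod_inv_distrib]
  ring

/-- Two monic polynomials of equal degree differ by one of degree below the number of nodes.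
Lagrange interpolation recovers this difference from its values at the nodes `u b`, where the second
product vanishes. -/
theorem prod_sub_eq_add_sum {s : Finset ι} {u : ι → K} (hu : Set.InjOn u s) (v : ι → K) (z : K) :
    ∏ b ∈ s, (z - v b) = ∏ b ∈ s, (z - u b) + ∑ b ∈ s,
      (∏ c ∈ s, (u b - v c)) / (∏ c ∈ s.erase b, (u b - u c)) * ∏ c ∈ s.erase b, (z - u c) := by
  have hdeg : (Lagrange.nodal s v - Lagrange.nodal s u).degree < s.card := by
    have := degree_sub_lt_left (p := Lagrange.nodal s v) (q := Lagrange.nodal s u)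
      (by rw [Lagrange.degree_nodal, Lagrange.degree_nodal]) Lagrange.nodal_ne_zero
      (by rw [Lagrange.nodal_monic.leadingCoeff, Lagrange.nodal_monic.leadingCoeff])
    rwa [Lagrange.degree_nodal] at this
  have h := eval_eq_sum_prod_erase hu hdeg z
  rw [eval_sub, Lagrange.eval_nodal, Lagrange.eval_nodal, sub_eq_iff_eq_add'] at h
  rw [h]
  congr 1
  refine Finset.sum_congr rfl fun b hb => ?_
  rw [eval_sub, Lagrange.eval_nodal, Lagrange.eval_nodal_at_node hb, sub_zero]

theorem prod_div_eq_one_add_sum {s : Finset ι} {u : ι → K} (hu : Set.InjOn u s) (v : ι → K) {z : K}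
    (hz : ∀ b ∈ s, z - u b ≠ 0) :
    ∏ b ∈ s, (z - v b) / (z - u b) = 1 + ∑ b ∈ s,
      (∏ c ∈ s, (u b - v c)) / (∏ c ∈ s.erase b, (u b - u c)) / (z - u b) := by
  have h0 : ∏ b ∈ s, (z - u b) ≠ 0 := Finset.prod_ne_zero_iff.2 hz
  rw [Finset.prod_div_distrib, div_eq_iff h0, prod_sub_eq_add_sum hu, add_mul, one_mul,
    Finset.sum_mul]
  congr 1
  refine Finset.sum_congr rfl fun b hb => ?_
  rw [← Finset.mul_prod_erase s (fun c => z - u c) hb]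
  field_simp [hz b hb]

theorem coe_prod_erase_mul_prod_mk (s : Finset ι) (u : ι → K) {b : ι} (hb : b ∈ s) :
    ((∏ c ∈ s.erase b, (1 - C (u c) * X) : K[X]) : PowerSeries K) *
      ∏ c ∈ s, PowerSeries.mk (fun k => u c ^ k) = PowerSeries.mk (fun k => u b ^ k) := by
  rw [← Finset.mul_prod_erase s _ hb, mul_left_comm, ← coeToPowerSeries.ringHom_apply, map_prod,
    ← Finset.prod_mul_distrib]
  simp only [coeToPowerSeries.ringHom_apply]
  rw [Finset.prod_eq_one, mul_one]
  exact fun c _ => coe_one_sub_mul_mk (u c)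

variable [Infinite K]

theorem polynomial_eq_of_eval_ne_zero {p q : K[X]} (h : ∀ t ≠ 0, p.eval t = q.eval t) : p = q :=
  eq_of_infinite_eval_eq p q <|
    ((Set.finite_singleton (0 : K)).infinite_compl).mono fun t ht => h t ht

/-- This is `prod_sub_eq_add_sum` at z = 1/t, multiplied by a power of t; agreement at all t ≠ 0 is
enough over an infinite field. -/
theorem prod_one_sub_eq {s : Finset ι} {u : ι → K} (hu : Set.InjOn u s) (v : ι → K) :
    ∏ b ∈ s, (1 - C (v b) * X) = ∏ b ∈ s, (1 - C (u b) * X) + X * ∑ b ∈ s,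
      C ((∏ c ∈ s, (u b - v c)) / (∏ c ∈ s.erase b, (u b - u c))) *
        ∏ c ∈ s.erase b, (1 - C (u c) * X) := by
  refine polynomial_eq_of_eval_ne_zero fun t ht => ?_
  have h := prod_sub_eq_add_sum hu v t⁻¹
  rw [prod_inv_sub _ ht, prod_inv_sub _ ht] at h
  simp only [eval_prod, eval_sub, eval_one, eval_mul, eval_C, eval_X, eval_add, eval_finsetSum]
  have h2 := congrArg (fun y => t ^ s.card * y) h
  simp only [mul_add] at h2
  rw [mul_inv_cancel_left₀ (pow_ne_zero _ ht), mul_inv_cancel_left₀ (pow_ne_zero _ ht)] at h2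
  rw [h2, Finset.mul_sum, Finset.mul_sum]
  congr 1
  refine Finset.sum_congr rfl fun b hb => ?_
  rw [prod_inv_sub _ ht]
  have h3 : t ^ s.card = t * t ^ (s.erase b).card := by
    rw [← pow_succ', Finset.card_erase_add_one hb]
  rw [h3]
  field_simp

/-- With one zero fewer than poles the partial fraction expansion has no constant term; this is the
shape of a Cauchy transform. -/
theorem prod_one_sub_eq_of_card {κ : Type*} {s : Finset ι} {u : ι → K} (hu : Set.InjOn u s)
    (v : κ → K) (r : Finset κ) (hr : r.card + 1 = s.card) :
    ∏ b ∈ r, (1 - C (v b) * X) = ∑ b ∈ s,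
      C ((∏ c ∈ r, (u b - v c)) / (∏ c ∈ s.erase b, (u b - u c))) *
        ∏ c ∈ s.erase b, (1 - C (u c) * X) := by
  classical
  refine polynomial_eq_of_eval_ne_zero fun t ht => ?_
  have h := eval_eq_sum_prod_erase hu (Q := Lagrange.nodal r v) (by
    rw [Lagrange.degree_nodal]; exact_mod_cast (by omega)) t⁻¹
  simp only [Lagrange.eval_nodal] at h
  rw [prod_inv_sub _ ht] at h
  simp only [eval_prod, eval_sub, eval_one, eval_mul, eval_C, eval_X, eval_finsetSum]
  have h2 := congrArg (fun y => t ^ r.card * y) h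
  rw [mul_inv_cancel_left₀ (pow_ne_zero _ ht)] at h2
  rw [h2, Finset.mul_sum]
  refine Finset.sum_congr rfl fun b hb => ?_
  rw [prod_inv_sub _ ht]
  have h3 : (s.erase b).card = r.card := by
    have := Finset.card_erase_add_one hb
    omega
  rw [h3]
  field_simp
  simp only [mul_comm t]

/-- Generating function for the moments of the residues: ∏ (1 - v t)/(1 - u t) is expanded in
partial fractions, then in geometric series. -/
theorem coeff_succ_prod_one_sub_mul_mk {s : Finset ι} {u : ι → K} (hu : Set.InjOn u s) (v : ι → K)
    (k : ℕ) :
    PowerSeries.coeff (k + 1) (∏ b ∈ s, (((1 - C (v b) * X : K[X]) : PowerSeries K) *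
      PowerSeries.mk (fun k => u b ^ k))) =
    ∑ b ∈ s, (∏ c ∈ s, (u b - v c)) / (∏ c ∈ s.erase b, (u b - u c)) * u b ^ k := by
  have h := congrArg (fun p : K[X] => (p : PowerSeries K) *
    ∏ c ∈ s, PowerSeries.mk (fun k => u c ^ k)) (prod_one_sub_eq hu v)
  simp only [coe_add, coe_mul, coe_X, add_mul, mul_assoc] at h
  rw [← coeToPowerSeries.ringHom_apply (φ := ∑ b ∈ s, _), map_sum, Finset.sum_mul] at h
  simp only [map_mul, coeToPowerSeries.ringHom_apply, coe_C] at h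
  rw [Finset.sum_congr rfl fun b hb => by rw [mul_assoc, coe_prod_erase_mul_prod_mk s u hb],
    ← coeToPowerSeries.ringHom_apply, ← coeToPowerSeries.ringHom_apply, map_prod, map_prod,
    ← Finset.prod_mul_distrib, ← Finset.prod_mul_distrib] at h
  simp only [coeToPowerSeries.ringHom_apply, coe_one_sub_mul_mk, Finset.prod_const_one] at h
  rw [h, map_add, PowerSeries.coeff_succ_X_mul, map_sum, PowerSeries.coeff_one,
    if_neg (Nat.succ_ne_zero k), zero_add]
  refine Finset.sum_congr rfl fun b _ => ?_
  rw [PowerSeries.coeff_C_mul, PowerSeries.coeff_mk]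

/-- Applied to local maxima and minima, this gives the moment series of a transition measure. -/
theorem prod_one_sub_mul_prod_mk_of_card {κ : Type*} {s : Finset ι} {u : ι → K}
    (hu : Set.InjOn u s) (v : κ → K) (r : Finset κ) (hr : r.card + 1 = s.card) (k : ℕ) :
    PowerSeries.coeff k (((∏ b ∈ r, (1 - C (v b) * X) : K[X]) : PowerSeries K) *
      ∏ b ∈ s, PowerSeries.mk (fun k => u b ^ k)) =
    ∑ b ∈ s, (∏ c ∈ r, (u b - v c)) / (∏ c ∈ s.erase b, (u b - u c)) * u b ^ k := by
  have h := congrArg (fun p : K[X] => (p : PowerSeries K) *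
    ∏ c ∈ s, PowerSeries.mk (fun k => u c ^ k)) (prod_one_sub_eq_of_card hu v r hr)
  rw [← coeToPowerSeries.ringHom_apply (φ := ∑ b ∈ s, _), map_sum, Finset.sum_mul] at h
  simp only [map_mul, coeToPowerSeries.ringHom_apply, coe_C] at h
  rw [Finset.sum_congr rfl fun b hb => by rw [mul_assoc, coe_prod_erase_mul_prod_mk s u hb]] at h
  rw [h, map_sum]
  refine Finset.sum_congr rfl fun b _ => ?_
  rw [PowerSeries.coeff_C_mul, PowerSeries.coeff_mk]

end PartialFractions

/-! ### Logarithmic derivatives of power series -/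

section LogDeriv

variable {K : Type*} [Field K]

/-- `E` has the logarithmic derivative `X E' = E ∑ sₖ Xᵏ`. -/
def HasLogDeriv (E : PowerSeries K) (s : ℕ → K) : Prop :=
  PowerSeries.X * PowerSeries.derivative K E = E * PowerSeries.mk s

theorem HasLogDeriv.mul {E F : PowerSeries K} {s t : ℕ → K} (hE : HasLogDeriv E s)
    (hF : HasLogDeriv F t) : HasLogDeriv (E * F) (fun k => s k + t k) := by
  have h : (PowerSeries.mk fun k => s k + t k) = PowerSeries.mk s + PowerSeries.mk t := by
    ext; simp
  unfold HasLogDeriv at *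
  rw [Derivation.leibniz, h, smul_eq_mul, smul_eq_mul]
  linear_combination E * hF + F * hE

theorem HasLogDeriv.prod {ι : Type*} (r : Finset ι) {E : ι → PowerSeries K} {s : ι → ℕ → K}
    (h : ∀ i, HasLogDeriv (E i) (s i)) :
    HasLogDeriv (∏ i ∈ r, E i) (fun k => ∑ i ∈ r, s i k) := by
  classical
  induction r using Finset.induction_on with
  | empty =>
    have : (PowerSeries.mk fun _ => (0 : K)) = 0 := by ext; simp
    simp [HasLogDeriv, this]
  | insert a r ha ih =>
    simp only [Finset.prod_insert ha, Finset.sum_insert ha]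
    exact (h a).mul ih

theorem hasLogDeriv_mk_pow (a : K) :
    HasLogDeriv (PowerSeries.mk fun k => a ^ k) (fun k => if k = 0 then 0 else a ^ k) := by
  ext k
  rcases k with _ | k
  · simp
  · rw [PowerSeries.coeff_succ_X_mul, PowerSeries.coeff_derivative, PowerSeries.coeff_mul,
      Finset.Nat.sum_antidiagonal_succ', Finset.sum_congr rfl (g := fun _ => a ^ (k + 1))]
    · simp [mul_comm]
    · rintro ⟨i, j⟩ hij
      rw [Finset.HasAntidiagonal.mem_antidiagonal] at hij
      simp only at hij
      simp [← hij, pow_add, mul_assoc]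

/-- The linear factor is the inverse of the geometric series, so its logarithmic derivative is the
opposite one. -/
theorem hasLogDeriv_one_sub (a : K) :
    HasLogDeriv ((1 - Polynomial.C a * Polynomial.X : Polynomial K) : PowerSeries K)
      (fun k => if k = 0 then 0 else -a ^ k) := by
  have h1 := coe_one_sub_mul_mk a
  have h2 := hasLogDeriv_mk_pow a
  have h3 : (PowerSeries.mk fun k => if k = 0 then (0 : K) else -a ^ k) =
      -PowerSeries.mk (fun k => if k = 0 then (0 : K) else a ^ k) := by
    ext k; rcases k with _ | k <;> simp
  have h4 := congrArg (PowerSeries.derivative K) h1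
  rw [Derivation.leibniz, Derivation.map_one_eq_zero, smul_eq_mul, smul_eq_mul] at h4
  unfold HasLogDeriv at *
  rw [h3]
  set P : PowerSeries K := ((1 - Polynomial.C a * Polynomial.X : Polynomial K) : PowerSeries K)
  set T : PowerSeries K := PowerSeries.mk fun k => if k = 0 then (0 : K) else a ^ k
  linear_combination (-(PowerSeries.X * PowerSeries.derivative K P + P * T)) * h1 + P * PowerSeries.X * h4 -
    P ^ 2 * h2

/-- Newton's recursion, which computes the coefficients from the power sums `s`. -/
theorem HasLogDeriv.natCast_mul_coeff {E : PowerSeries K} {s : ℕ → K} (h : HasLogDeriv E s)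
    (k : ℕ) : (k : K) * PowerSeries.coeff k E =
      ∑ ij ∈ Finset.HasAntidiagonal.antidiagonal k, PowerSeries.coeff ij.1 E * s ij.2 := by
  have h1 := congrArg (PowerSeries.coeff k) h
  rw [PowerSeries.coeff_mul k E] at h1
  simp only [PowerSeries.coeff_mk] at h1
  rw [← h1]
  rcases k with _ | k
  · simp
  · rw [PowerSeries.coeff_succ_X_mul, PowerSeries.coeff_derivative]
    push_cast
    ring

end LogDeriv

theorem hasLogDeriv_prod_one_sub_mul_mk {K ι : Type*} [Field K] (s : Finset ι) (u v : ι → K) :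
    HasLogDeriv (∏ b ∈ s, (((1 - Polynomial.C (v b) * Polynomial.X : Polynomial K) :
      PowerSeries K) * PowerSeries.mk (fun k => u b ^ k)))
      (fun k => ∑ b ∈ s, ((if k = 0 then 0 else -v b ^ k) + if k = 0 then 0 else u b ^ k)) :=
  HasLogDeriv.prod s fun b => (hasLogDeriv_one_sub (v b)).mul (hasLogDeriv_mk_pow (u b))

theorem coeff_zero_prod_one_sub_mul_mk {K ι : Type*} [Field K] (s : Finset ι) (u v : ι → K) :
    PowerSeries.coeff 0 (∏ b ∈ s, (((1 - Polynomial.C (v b) * Polynomial.X : Polynomial K) :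
      PowerSeries K) * PowerSeries.mk (fun k => u b ^ k))) = 1 := by
  rw [PowerSeries.coeff_zero_eq_constantCoeff_apply, map_prod]
  refine Finset.prod_eq_one fun b _ => ?_
  rw [map_mul, ← PowerSeries.coeff_zero_eq_constantCoeff_apply,
    ← PowerSeries.coeff_zero_eq_constantCoeff_apply]
  simp

/-! ### Schur `P`-polynomials evaluated in a field -/

section SchurPEval

open Finset

variable {K ι : Type*} [Field K]

/-- `∏_{i < j} (yⱼ + yᵢ) / (yⱼ - yᵢ)`. -/
def pairFactor {l : ℕ} (y : Fin l → K) : K := ∏ i, ∏ j ∈ Ioi i, (y j + y i) / (y j - y i)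

/-- Each factor is (yⱼ² - yᵢ²)/(yⱼ - yᵢ)². If yᵢ = yⱼ both sides are 0 by the convention for
division by 0. The determinants make the behaviour under permutations visible. -/
theorem pairFactor_eq {l : ℕ} (y : Fin l → K) :
    pairFactor y = (Matrix.vandermonde fun i => y i ^ 2).det / (Matrix.vandermonde y).det ^ 2 := by
  rw [Matrix.det_vandermonde, Matrix.det_vandermonde, ← prod_pow, ← prod_div_distrib]
  refine prod_congr rfl fun i _ => ?_
  rw [← prod_pow, ← prod_div_distrib]
  refine prod_congr rfl fun j _ => ?_
  rcases eq_or_ne (y j - y i) 0 with h | h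
  · simp [h]
  · field_simp
    ring

/-- In `pairFactor_eq` the numerator contributes one sign and the squared denominator none. -/
theorem pairFactor_comp_perm {l : ℕ} (y : Fin l → K) (σ : Equiv.Perm (Fin l)) :
    pairFactor (y ∘ σ) = (Equiv.Perm.sign σ : ℤ) * pairFactor y := by
  have h (w : Fin l → K) : (Matrix.vandermonde (w ∘ σ)).det =
      (Equiv.Perm.sign σ : ℤ) * (Matrix.vandermonde w).det := by
    rw [← Matrix.det_permute]
    rfl
  have h1 : ((Equiv.Perm.sign σ : ℤ) : K) ^ 2 = 1 := by
    rcases Int.units_eq_one_or (Equiv.Perm.sign σ) with h | h <;> simp [h]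
  rw [pairFactor_eq, pairFactor_eq, h y, show (fun i => (y ∘ σ) i ^ 2) = (fun i => y i ^ 2) ∘ σ
    from rfl, h, mul_pow, h1, one_mul, mul_div_assoc]

theorem pairFactor_cons {l : ℕ} (a : K) (y : Fin l → K) :
    pairFactor (Fin.cons a y : Fin (l + 1) → K) =
      (∏ i, (y i + a) / (y i - a)) * pairFactor y := by
  simp only [pairFactor, Fin.prod_univ_succ, Fin.prod_Ioi_zero, Fin.prod_Ioi_succ, Fin.cons_zero,
    Fin.cons_succ]

theorem pairFactor_ne_zero {l : ℕ} {y : Fin l → K} (h : ∀ i j, y i + y j ≠ 0)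
    (hy : Function.Injective y) : pairFactor y ≠ 0 := by
  refine prod_ne_zero_iff.2 fun i _ => prod_ne_zero_iff.2 fun j hj => ?_
  exact div_ne_zero (h _ _) (sub_ne_zero.2 (hy.ne (mem_Ioi.1 hj).ne'))

/-- The case P_(1) = p₁. The coefficient of t in ∏ (1 + x_b t)/(1 - x_b t) is computed once by
residues and once by the logarithmic derivative; both give twice the respective side. -/
theorem sum_mul_prod_erase_eq_sum [CharZero K] [DecidableEq ι] {x : ι → K} (hx : Function.Injective x) (s : Finset ι) :
    ∑ a ∈ s, x a * ∏ b ∈ s.erase a, (x a + x b) / (x a - x b) = ∑ a ∈ s, x a := by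
  have : Infinite K := CharZero.infinite K
  have h1 := coeff_succ_prod_one_sub_mul_mk (s := s) hx.injOn (fun b => -x b) 0
  have h2 := (hasLogDeriv_prod_one_sub_mul_mk s x (fun b => -x b)).natCast_mul_coeff 1
  rw [show HasAntidiagonal.antidiagonal 1 = {(0, 1), (1, 0)} from rfl, sum_pair (by decide),
    coeff_zero_prod_one_sub_mul_mk, h1] at h2
  simp only [sub_neg_eq_add, pow_zero, mul_one, Nat.cast_one, one_mul, one_ne_zero, if_false,
    pow_one, neg_neg, if_true, add_zero, sum_const_zero, mul_zero] at h2
  have h3 : ∀ a ∈ s, (∏ c ∈ s, (x a + x c)) / ∏ c ∈ s.erase a, (x a - x c) =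
      2 * (x a * ∏ b ∈ s.erase a, (x a + x b) / (x a - x b)) := by
    intro a ha
    rw [← mul_prod_erase s _ ha, prod_div_distrib]
    ring
  rw [sum_congr rfl h3, ← mul_sum, sum_add_distrib, ← two_mul] at h2
  exact mul_left_cancel₀ two_ne_zero h2

variable [Fintype ι] [DecidableEq ι] (x : ι → K)

/-- The product of `(xₐ + x_b) / (xₐ - x_b)` over the values `a` of `f` and all `b` that are either
not a value of `f` or a value at a smaller argument. -/
def schurKernel {l : ℕ} (f : Fin l → ι) : K :=
  (∏ i, ∏ b ∈ (univ.image f)ᶜ, (x (f i) + x b) / (x (f i) - x b)) * pairFactor (x ∘ f)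

/-- The Schur `P`-polynomial at `x` whose parts, in increasing order, are the values of `β`. -/
def schurPEval {l : ℕ} (β : Fin l → ℕ) : K :=
  ∑ f : Fin l ↪ ι, (∏ i, x (f i) ^ β i) * schurKernel x f

/-- Reindexing the injections by σ moves the permutation from the exponents to the kernel, where
only `pairFactor` is not symmetric. -/
theorem schurPEval_comp_perm {l : ℕ} (β : Fin l → ℕ) (σ : Equiv.Perm (Fin l)) :
    schurPEval x (β ∘ σ) = (Equiv.Perm.sign σ : ℤ) * schurPEval x β := by
  rw [schurPEval, schurPEval, mul_sum]
  refine Fintype.sum_equiv (Equiv.embeddingCongr σ (Equiv.refl ι)) _ _ fun f => ?_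
  have hf : (f : Fin l → ι) = ((Equiv.embeddingCongr σ (Equiv.refl ι)) f : Fin l → ι) ∘ σ := by
    ext i
    simp
  set g := (Equiv.embeddingCongr σ (Equiv.refl ι)) f
  have h1 : schurKernel x f = (Equiv.Perm.sign σ : ℤ) * schurKernel x g := by
    have h2 : univ.image ((g : Fin l → ι) ∘ σ) = univ.image g := by
      rw [← image_image, image_univ_equiv]
    rw [schurKernel, schurKernel, hf, h2, ← Function.comp_assoc, pairFactor_comp_perm,
      mul_left_comm]
    congr 2
    exact Equiv.prod_comp σ fun i => ∏ b ∈ (univ.image g)ᶜ, (x (g i) + x b) / (x (g i) - x b)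
  rw [h1, mul_left_comm]
  congr 2
  rw [hf]
  exact Equiv.prod_comp σ fun i => x (g i) ^ β i

theorem schurPEval_eq_zero_of_eq [CharZero K] {l : ℕ} {β : Fin l → ℕ} {i j : Fin l} (hij : i ≠ j)
    (h : β i = β j) : schurPEval x β = 0 := by
  have h1 := schurPEval_comp_perm x β (Equiv.swap i j)
  have h2 : β ∘ Equiv.swap i j = β := by
    ext k
    simp only [Function.comp_apply, Equiv.swap_apply_def]
    split_ifs with h3 h4
    · rw [h3, h]
    · rw [h4, h]
    · rfl
  rw [h2, Equiv.Perm.sign_swap hij] at h1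
  push_cast at h1
  exact self_eq_neg.1 (by simpa using h1)

theorem sum_embedding_succ {M : Type*} [AddCommMonoid M] {l : ℕ} (F : (Fin (l + 1) → ι) → M) :
    ∑ f : Fin (l + 1) ↪ ι, F f =
      ∑ e : Fin l ↪ ι, ∑ a ∈ (univ.image e)ᶜ, F (Fin.cons a e) := by
  rw [Fintype.sum_equiv (Equiv.embeddingFinSucc l ι) (fun f => F f)
    (fun p => F (Fin.cons p.2.1 p.1)), Fintype.sum_sigma]
  · refine sum_congr rfl fun e _ => ?_
    rw [← Finset.sum_subtype (univ.image e)ᶜ (p := fun i => i ∉ Set.range e) (by simp)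
      (fun a => F (Fin.cons a e))]
  · intro f
    congr 1
    ext i
    exact Fin.cases rfl (fun j => rfl) i

theorem schurKernel_cons {l : ℕ} (e : Fin l ↪ ι) {a : ι} (ha : a ∈ (univ.image e)ᶜ) :
    schurKernel x (Fin.cons a e : Fin (l + 1) → ι) = schurKernel x e *
      ∏ b ∈ (univ.image e)ᶜ.erase a, (x a + x b) / (x a - x b) := by
  have h1 : (univ.image (Fin.cons a e : Fin (l + 1) → ι))ᶜ = (univ.image e)ᶜ.erase a := by
    ext b
    simp [Fin.exists_fin_succ, eq_comm]
  have h2 : x ∘ (Fin.cons a e : Fin (l + 1) → ι) = Fin.cons (x a) (x ∘ e) := by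
    ext i
    exact Fin.cases rfl (fun j => rfl) i
  rw [schurKernel, schurKernel, h1, h2, pairFactor_cons, Fin.prod_univ_succ]
  simp only [Fin.cons_zero, Fin.cons_succ, Function.comp_apply]
  have h3 : ∏ i, ∏ b ∈ (univ.image e)ᶜ, (x (e i) + x b) / (x (e i) - x b) =
      (∏ i, (x (e i) + x a) / (x (e i) - x a)) *
        ∏ i, ∏ b ∈ (univ.image e)ᶜ.erase a, (x (e i) + x b) / (x (e i) - x b) := by
    rw [← prod_mul_distrib]
    exact prod_congr rfl fun i _ => (mul_prod_erase _ _ ha).symm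
  rw [h3]
  ring

/-- The variable of the new part is summed last: the inner sum is the one-part polynomial P_(c) in
the variables that `e` does not use. -/
theorem schurPEval_cons {l : ℕ} (c : ℕ) (β : Fin l → ℕ) :
    schurPEval x (Fin.cons c β : Fin (l + 1) → ℕ) =
      ∑ e : Fin l ↪ ι, (∏ i, x (e i) ^ β i) * schurKernel x e * ∑ a ∈ (univ.image e)ᶜ,
        x a ^ c * ∏ b ∈ (univ.image e)ᶜ.erase a, (x a + x b) / (x a - x b) := by
  rw [schurPEval, sum_embedding_succ (fun f => (∏ i, x (f i) ^ (Fin.cons c β : Fin (l + 1) → ℕ) i) *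
    schurKernel x f)]
  refine sum_congr rfl fun e _ => ?_
  rw [mul_sum]
  refine sum_congr rfl fun a ha => ?_
  rw [schurKernel_cons x e ha, Fin.prod_univ_succ]
  simp only [Fin.cons_zero, Fin.cons_succ]
  ring

variable {x}

/-- The Pieri rule before straightening. For each injection, ∑ xₐ splits into the used variables,
which raise an exponent, and the unused ones, which by `sum_mul_prod_erase_eq_sum` create a new part
1. -/
theorem sum_mul_schurPEval [CharZero K] (hx : Function.Injective x) {l : ℕ} (β : Fin l → ℕ) :
    (∑ a, x a) * schurPEval x β =
      ∑ i, schurPEval x (β + Pi.single i 1) + schurPEval x (Fin.cons 1 β : Fin (l + 1) → ℕ) := by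
  have h (i : Fin l) (f : Fin l ↪ ι) : ∏ j, x (f j) ^ (β + Pi.single i 1 : Fin l → ℕ) j =
      x (f i) * ∏ j, x (f j) ^ β j := by
    simp only [Pi.add_apply, pow_add, prod_mul_distrib]
    rw [mul_comm]
    congr 1
    rw [prod_eq_single i]
    · simp
    · intro j _ hj
      simp [Pi.single_eq_of_ne hj]
    · simp
  rw [schurPEval_cons]
  simp only [schurPEval, h]
  rw [sum_comm, ← sum_add_distrib, mul_sum]
  refine sum_congr rfl fun e _ => ?_
  simp only [pow_one]
  rw [sum_mul_prod_erase_eq_sum hx, ← sum_add_sum_compl (univ.image e), sum_image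
    (by exact e.injective.injOn), add_mul, sum_mul]
  congr 1
  · exact sum_congr rfl fun i _ => by ring
  · ring

end SchurPEval

/-! ### The expansion of an odd power sum -/

section PowerSum

open Finset

variable {K ι : Type*} [Field K] [Fintype ι] [DecidableEq ι] {x : ι → K}

theorem schurPEval_one_part (r : ℕ) : schurPEval x ![r] =
    ∑ a, x a ^ r * ∏ b ∈ univ.erase a, (x a + x b) / (x a - x b) := by
  have h := schurPEval_cons x r ![]
  rw [Fintype.sum_unique] at h
  simpa [schurKernel, pairFactor] using h

theorem schurPEval_two_parts (hx : Function.Injective x) (hs : ∀ a b, x a + x b ≠ 0) (b c : ℕ) :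
    schurPEval x ![b, c] = ∑ i, ∑ j, x i ^ c * x j ^ b *
      ((∏ a ∈ univ.erase i, (x i + x a) / (x i - x a)) *
        (∏ a ∈ univ.erase j, (x j + x a) / (x j - x a)) * ((x j - x i) / (x j + x i))) := by
  have h := schurPEval_cons x b ![c]
  have h2 : (Fin.cons b ![c] : Fin 2 → ℕ) = ![b, c] := rfl
  rw [h2] at h
  rw [h, sum_embedding_succ (fun e : Fin 1 → ι => (∏ i, x (e i) ^ (![c] : Fin 1 → ℕ) i) *
    schurKernel x e * ∑ a ∈ (univ.image e)ᶜ,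
        x a ^ b * ∏ b ∈ (univ.image e)ᶜ.erase a, (x a + x b) / (x a - x b)), Fintype.sum_unique]
  have h3 : (univ.image (default : Fin 0 ↪ ι))ᶜ = univ := by ext; simp
  rw [h3]
  refine sum_congr rfl fun i _ => ?_
  have h4 : (univ.image (Fin.cons i (default : Fin 0 ↪ ι) : Fin 1 → ι))ᶜ = univ.erase i := by
    ext a
    simp [eq_comm]
  have h5 := schurKernel_cons x (default : Fin 0 ↪ ι) (a := i) (by simp)
  rw [h3] at h5
  rw [h4, h5, mul_sum]
  -- The diagonal j = i may be included, since the factor x j - x i kills it.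
  refine (sum_congr rfl fun j hj => ?_).trans (sum_erase (a := i) univ (by simp))
  have hji : j ≠ i := ne_of_mem_erase hj
  have h6 : i ∈ univ.erase j := mem_erase.2 ⟨hji.symm, mem_univ _⟩
  have h7 := sub_ne_zero.2 (hx.ne hji)
  have h8 := hs j i
  rw [← mul_prod_erase (univ.erase j) _ h6, erase_right_comm]
  simp [schurKernel, pairFactor]
  field_simp

/-- Partial fractions of ∏ (z + xₐ)/(z - xₐ), evaluated at its zero z = -xᵢ. -/
theorem sum_div_add_eq_one [CharZero K] (hx : Function.Injective x) (hs : ∀ a b, x a + x b ≠ 0)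
    (i : ι) : ∑ j, x j * (∏ a ∈ univ.erase j, (x j + x a) / (x j - x a)) / (x j + x i) = 1 / 2 := by
  have h := prod_div_eq_one_add_sum (s := univ) hx.injOn (fun a => -x a) (z := -x i)
    (fun b _ => by have := hs i b; contrapose! this; linear_combination -this)
  rw [prod_eq_zero (mem_univ i) (by simp)] at h
  have h2 : ∀ j, (∏ c, (x j - -x c)) / (∏ c ∈ univ.erase j, (x j - x c)) / (-x i - x j) =
      -2 * (x j * (∏ a ∈ univ.erase j, (x j + x a) / (x j - x a)) / (x j + x i)) := by
    intro j
    rw [← mul_prod_erase univ _ (mem_univ j), prod_div_distrib,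
      show -x i - x j = -(x j + x i) by ring, div_neg]
    simp only [sub_neg_eq_add]
    ring
  simp only [h2, ← mul_sum] at h
  linear_combination (1 / 2 : K) * h

/-- The polynomial ∏_{a ≠ i} (z + xₐ) is interpolated at all the xⱼ and evaluated at z = -xᵢ. The
missing factor xⱼ + xᵢ produces the square in the denominator. -/
theorem sum_div_add_sq_eq [CharZero K] (hx : Function.Injective x) (hs : ∀ a b, x a + x b ≠ 0)
    (i : ι) : ∑ j, x j * (∏ a ∈ univ.erase j, (x j + x a) / (x j - x a)) / (x j + x i) ^ 2 =
      1 / (4 * x i * ∏ a ∈ univ.erase i, (x i + x a) / (x i - x a)) := by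
  have hd : (Lagrange.nodal (univ.erase i) fun a => -x a).degree < (univ : Finset ι).card := by
    rw [Lagrange.degree_nodal, card_erase_of_mem (mem_univ i)]
    exact_mod_cast Nat.sub_lt (card_pos.2 ⟨i, mem_univ i⟩) one_pos
  have h := eval_eq_sum_prod_erase (s := univ) hx.injOn hd (-x i)
  simp only [Lagrange.eval_nodal, sub_neg_eq_add] at h
  have h0 : ∀ a b, -x a - x b ≠ 0 := fun a b => by
    have := hs a b; contrapose! this; linear_combination -this
  have hi : 2 * x i ≠ 0 := by rw [two_mul]; exact hs i i
  have hP : ∏ c, (-x i - x c) ≠ 0 := prod_ne_zero_iff.2 fun c _ => h0 i c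
  have h2 : ∀ j, (∏ a ∈ univ.erase i, (x j + x a)) / (∏ c ∈ univ.erase j, (x j - x c)) *
      ∏ c ∈ univ.erase j, (-x i - x c) = (∏ c, (-x i - x c)) *
      (-2 * (x j * (∏ a ∈ univ.erase j, (x j + x a) / (x j - x a)) / (x j + x i) ^ 2)) := by
    intro j
    have e1 : ∏ a ∈ univ.erase i, (x j + x a) = 2 * x j * (∏ a ∈ univ.erase j, (x j + x a)) /
        (x j + x i) := by
      rw [eq_div_iff (hs j i), mul_comm, mul_prod_erase univ (fun a => x j + x a) (mem_univ i),
        ← mul_prod_erase univ (fun a => x j + x a) (mem_univ j), two_mul]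
    have e2 : ∏ c ∈ univ.erase j, (-x i - x c) = (∏ c, (-x i - x c)) / (-(x j + x i)) := by
      rw [eq_div_iff (neg_ne_zero.2 (hs j i)), ← mul_prod_erase univ (fun c => -x i - x c)
        (mem_univ j)]
      ring
    rw [e1, e2, prod_div_distrib]
    have := hs j i
    field_simp
  simp only [h2, ← mul_sum] at h
  have e3 : ∏ a ∈ univ.erase i, (-x i + x a) = (∏ c, (-x i - x c)) *
      (-1 / (2 * x i * ∏ a ∈ univ.erase i, (x i + x a) / (x i - x a))) := by
    rw [← mul_prod_erase univ (fun c => -x i - x c) (mem_univ i), prod_div_distrib]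
    have e4 : ∏ a ∈ univ.erase i, (-x i + x a) =
        (-1) ^ (univ.erase i).card * ∏ a ∈ univ.erase i, (x i - x a) := by
      rw [← prod_const, ← prod_mul_distrib]; exact prod_congr rfl fun _ _ => by ring
    have e5 : ∏ a ∈ univ.erase i, (-x i - x a) =
        (-1) ^ (univ.erase i).card * ∏ a ∈ univ.erase i, (x i + x a) := by
      rw [← prod_const, ← prod_mul_distrib]; exact prod_congr rfl fun _ _ => by ring
    have n1 : ∏ a ∈ univ.erase i, (x i - x a) ≠ 0 := prod_ne_zero_iff.2 fun a ha =>
      sub_ne_zero.2 (hx.ne (ne_of_mem_erase ha).symm)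
    have n2 : ∏ a ∈ univ.erase i, (x i + x a) ≠ 0 := prod_ne_zero_iff.2 fun a _ => hs i a
    have n3 : x i ≠ 0 := right_ne_zero_of_mul hi
    rw [e4, e5]
    field_simp
    ring
  rw [e3] at h
  have h3 := mul_left_cancel₀ hP h
  have n3 : x i ≠ 0 := right_ne_zero_of_mul hi
  have n4 : ∏ a ∈ univ.erase i, (x i + x a) / (x i - x a) ≠ 0 := prod_ne_zero_iff.2 fun a ha =>
    div_ne_zero (hs i a) (sub_ne_zero.2 (hx.ne (ne_of_mem_erase ha).symm))
  rw [← mul_right_inj' (by norm_num : (-2 : K) ≠ 0), ← h3]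
  field_simp
  norm_num

theorem add_mul_sum_alternating (y z : K) (h m : ℕ) :
    (y + z) * ∑ b ∈ range (h + 1), (-1) ^ b * (y ^ (m + h - b) * z ^ b) =
      y ^ (m + h + 1) + (-1) ^ h * (y ^ m * z ^ (h + 1)) := by
  induction h generalizing m with
  | zero => simp; ring
  | succ h ih =>
    rw [sum_range_succ, mul_add, sum_congr rfl (fun b _ => by
      rw [show m + (h + 1) - b = (m + 1) + h - b by omega]), ih (m + 1),
      show m + (h + 1) - (h + 1) = m by omega]
    ring

/-- The two-part polynomials are double sums against an antisymmetric kernel, so their numerators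
matter only modulo symmetric functions. A suitable representative lets the sum over j be evaluated
in closed form. -/
theorem odd_psum_eq [CharZero K] (hx : Function.Injective x) (hs : ∀ a b, x a + x b ≠ 0) (h : ℕ) :
    ∑ i, x i ^ (2 * h + 1) = schurPEval x ![2 * h + 1] +
      ∑ b ∈ range h, 2 * (-1) ^ (b + 1) * schurPEval x ![b + 1, 2 * h - b] := by
  set A : ι → K := fun i => ∏ a ∈ univ.erase i, (x i + x a) / (x i - x a) with hA
  set k : ι → ι → K := fun i j => A i * A j * ((x j - x i) / (x j + x i)) with hk
  have hk' : ∀ i j, k j i = -k i j := fun i j => by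
    simp only [hk]
    rw [add_comm (x i), ← neg_sub (x j)]
    ring
  set g : K → K → K := fun y z => ∑ b ∈ range h, (-1) ^ (b + 1) * (y ^ (2 * h - b) * z ^ (b + 1))
    with hg
  -- Consequently g(y, z) and y^(2h+2)/(y + z) - y^(2h+1) differ by a symmetric function.
  have hg1 (y z : K) : (y + z) * (y ^ (2 * h + 1) + g y z) =
      y ^ (2 * h + 2) + (-1) ^ h * (y ^ (h + 1) * z ^ (h + 1)) := by
    have := add_mul_sum_alternating y z h (h + 1)
    rw [sum_range_succ', show h + 1 + h + 1 = 2 * h + 2 by ring] at this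
    rw [← this]
    congr 1
    rw [add_comm]
    congr 1
    · refine sum_congr rfl fun b hb => ?_
      rw [show h + 1 + h - (b + 1) = 2 * h - b by omega]
    · rw [show h + 1 + h - 0 = 2 * h + 1 by omega]; simp
  have h1 : ∑ b ∈ range h, 2 * (-1) ^ (b + 1) * schurPEval x ![b + 1, 2 * h - b] =
      2 * ∑ i, ∑ j, g (x i) (x j) * k i j := by
    simp only [schurPEval_two_parts hx hs, hg, mul_sum, sum_mul]
    rw [sum_comm]
    refine sum_congr rfl fun i _ => ?_
    rw [sum_comm]
    refine sum_congr rfl fun j _ => sum_congr rfl fun b _ => ?_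
    simp only [hk, hA]
    ring
  -- A double sum against the antisymmetric k sees only the antisymmetric part of F.
  have hsw (F : ι → ι → K) : 2 * ∑ i, ∑ j, F i j * k i j = ∑ i, ∑ j, (F i j - F j i) * k i j := by
    simp only [sub_mul, sum_sub_distrib]
    rw [two_mul, sub_eq_add_neg]
    congr 1
    rw [sum_comm, ← sum_neg_distrib]
    refine sum_congr rfl fun i _ => ?_
    rw [← sum_neg_distrib]
    refine sum_congr rfl fun j _ => ?_
    rw [hk' i j]; ring
  have h2 : 2 * ∑ i, ∑ j, g (x i) (x j) * k i j =
      2 * ∑ i, ∑ j, (x i ^ (2 * h + 2) / (x i + x j) - x i ^ (2 * h + 1)) * k i j := by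
    rw [hsw, hsw]
    refine sum_congr rfl fun i _ => sum_congr rfl fun j _ => ?_
    congr 1
    have n1 := hs i j
    have n2 := hs j i
    have e1 := hg1 (x i) (x j)
    have e2 := hg1 (x j) (x i)
    rw [add_comm (x j) (x i)]
    field_simp
    rw [add_comm (x j) (x i)] at e2
    linear_combination e1 - e2
  rw [h1, h2, schurPEval_one_part, mul_sum, ← sum_add_distrib]
  refine sum_congr rfl fun i _ => ?_
  have n3 : x i ≠ 0 := by have := hs i i; rw [← two_mul] at this; exact right_ne_zero_of_mul this
  have n4 : A i ≠ 0 := prod_ne_zero_iff.2 fun a ha =>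
    div_ne_zero (hs i a) (sub_ne_zero.2 (hx.ne (ne_of_mem_erase ha).symm))
  have e1 := sum_div_add_eq_one hx hs i
  have e2 := sum_div_add_sq_eq hx hs i
  -- The bracket is -xᵢ^(2h+1) xⱼ/(xᵢ + xⱼ), and (xⱼ - xᵢ)/(xⱼ + xᵢ) = 1 - 2xᵢ/(xⱼ + xᵢ).
  have e3 : ∑ j, (x i ^ (2 * h + 2) / (x i + x j) - x i ^ (2 * h + 1)) * k i j =
      x i ^ (2 * h + 1) * A i * (-∑ j, x j * A j / (x j + x i) +
        2 * x i * ∑ j, x j * A j / (x j + x i) ^ 2) := by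
    rw [← sum_neg_distrib, mul_sum, ← sum_add_distrib, mul_sum]
    refine sum_congr rfl fun j _ => ?_
    have n1 := hs j i
    simp only [hk]
    rw [add_comm (x i) (x j)]
    field_simp
    ring
  rw [e3, e1, e2]
  change _ = x i ^ (2 * h + 1) * A i + 2 * (x i ^ (2 * h + 1) * A i *
    (-(1 / 2) + 2 * x i * (1 / (4 * x i * A i))))
  field_simp
  ring

end PowerSum

/-! ### Strict partitions as finite sets and the Pieri rule -/

section Pieri

open Finset

/-- The finite sets of positive integers with sum `n`. -/
def strictSets (n : ℕ) : Finset (Finset ℕ) := (Icc 1 n).powerset.filter fun S => ∑ m ∈ S, m = n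

theorem mem_strictSets {n : ℕ} {S : Finset ℕ} : S ∈ strictSets n ↔ 0 ∉ S ∧ ∑ m ∈ S, m = n := by
  simp only [strictSets, mem_filter, mem_powerset, and_congr_left_iff]
  intro h
  constructor
  · intro h1 h2
    simpa using h1 h2
  · intro h1 m hm
    refine mem_Icc.2 ⟨Nat.one_le_iff_ne_zero.2 fun h2 => h1 (h2 ▸ hm), ?_⟩
    rw [← h]
    exact single_le_sum (f := fun m => m) (fun _ _ => Nat.zero_le _) hm

/-- The parts after the part `m` has been lowered by one. -/
def lowerPart (S : Finset ℕ) (m : ℕ) : Finset ℕ := (insert (m - 1) (S.erase m)).erase 0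

/-- The parts after the part `m` (a new part if `m = 0`) has been raised by one. -/
def raisePart (T : Finset ℕ) (m : ℕ) : Finset ℕ := insert (m + 1) (T.erase m)

theorem raisePart_lowerPart {S : Finset ℕ} {m : ℕ} (h0 : 0 ∉ S) (hm : m ∈ S) (hm' : m - 1 ∉ S) :
    raisePart (lowerPart S m) (m - 1) = S := by
  have h1 : m ≠ 0 := fun h => h0 (h ▸ hm)
  ext a
  simp only [raisePart, lowerPart, mem_insert, mem_erase]
  by_cases h2 : a = m
  · subst h2; simp [hm]; omega
  · by_cases h3 : a = m - 1
    · subst h3; simp [hm']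
    · by_cases h4 : a = 0
      · subst h4; simp [h0]
      · simp [h2, h3, h4]; omega

theorem lowerPart_raisePart {T : Finset ℕ} {m : ℕ} (h0 : 0 ∉ T) (hm : m ∈ insert 0 T)
    (hm' : m + 1 ∉ T) : lowerPart (raisePart T m) (m + 1) = T := by
  ext a
  simp only [raisePart, lowerPart, mem_insert, mem_erase, Nat.add_sub_cancel] at hm ⊢
  by_cases h2 : a = m + 1
  · subst h2; simp [hm']
  · by_cases h3 : a = 0
    · subst h3; simp [h0]
    · by_cases h4 : a = m
      · subst h4; simp [h3]; simpa [h3] using hm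
      · simp [h2, h3, h4]

/-- The condition F 0 = 0 accounts for a part 1, which disappears when it is lowered. -/
theorem sum_lowerPart {M : Type*} [AddCommMonoid M] {S : Finset ℕ} {m : ℕ}
    (hm : m ∈ S) (hm' : m - 1 ∉ S) {F : ℕ → M} (hF : F 0 = 0) :
    ∑ a ∈ lowerPart S m, F a + F m = ∑ a ∈ S, F a + F (m - 1) := by
  rw [lowerPart, sum_erase _ hF, sum_insert (fun h => hm' (mem_of_mem_erase h)),
    ← add_sum_erase S F hm]
  abel

theorem sum_raisePart {T : Finset ℕ} {m : ℕ} (h0 : 0 ∉ T) (hm : m ∈ insert 0 T)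
    (hm' : m + 1 ∉ T) : ∑ a ∈ raisePart T m, a = ∑ a ∈ T, a + 1 := by
  rw [raisePart, sum_insert (fun h => hm' (mem_of_mem_erase h))]
  rcases mem_insert.1 hm with h | h
  · subst h
    rw [erase_eq_of_notMem h0]; omega
  · have := add_sum_erase T (fun a => a) h
    omega

variable {K ι : Type*} [Field K] [Fintype ι] [DecidableEq ι] (x : ι → K)

/-- The Schur `P`-polynomial at `x` of the strict partition with set of parts `S`. -/
def schurPSet (S : Finset ℕ) : K := schurPEval x (S.orderEmbOfFin rfl)

theorem schurPSet_image {l : ℕ} {γ : Fin l → ℕ} (hγ : StrictMono γ) {S : Finset ℕ}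
    (hS : univ.image γ = S) : schurPSet x S = schurPEval x γ := by
  have hc : S.card = l := by
    rw [← hS, card_image_of_injective _ hγ.injective, card_univ, Fintype.card_fin]
  subst hc
  rw [schurPSet]
  congr 1
  exact (orderEmbOfFin_unique rfl (fun i => hS ▸ mem_image_of_mem γ (mem_univ i)) hγ).symm

variable {x}

/-- The Pieri rule. In `sum_mul_schurPEval`, a raised exponent that meets another part gives 0 by
antisymmetry; otherwise the exponents are still strictly increasing. The index m = 0 stands for the
new part. -/
theorem sum_mul_schurPSet [CharZero K] (hx : Function.Injective x) {T : Finset ℕ} (h0 : 0 ∉ T) :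
    (∑ a, x a) * schurPSet x T =
      ∑ m ∈ (insert 0 T).filter (fun m => m + 1 ∉ T), schurPSet x (raisePart T m) := by
  set β : Fin T.card → ℕ := ⇑(T.orderEmbOfFin rfl) with hβ
  have hmono : StrictMono β := (T.orderEmbOfFin rfl).strictMono
  have hmem : ∀ i, β i ∈ T := fun i => T.orderEmbOfFin_mem rfl i
  have himg : univ.image β = T := by
    rw [← coe_inj, coe_image, coe_univ, Set.image_univ, hβ, range_orderEmbOfFin]
  have hex : ∀ m ∈ T, ∃ i, β i = m := fun m hm => by
    rw [← himg] at hm; simpa using hm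
  rw [schurPSet, sum_mul_schurPEval hx, sum_filter, sum_insert h0, add_comm]
  congr 1
  · split_ifs with h
    swap
    · refine (schurPSet_image x (γ := Fin.cons 1 β) ?_ ?_).symm
      · intro a b hab
        induction a using Fin.cases with
        | zero =>
          induction b using Fin.cases with
          | zero => exact absurd hab (lt_irrefl _)
          | succ b =>
            rw [Fin.cons_zero, Fin.cons_succ]
            have h1 : β b ≠ 0 := fun h2 => h0 (h2 ▸ hmem b)
            have h2 : β b ≠ 1 := fun h2 => h (by simpa [h2] using hmem b)
            omega
        | succ a =>
          induction b using Fin.cases with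
          | zero => exact absurd hab (Fin.not_lt_zero _)
          | succ b =>
            rw [Fin.cons_succ, Fin.cons_succ]
            exact hmono (Fin.succ_lt_succ_iff.1 hab)
      · rw [raisePart, erase_eq_of_notMem h0]
        ext a
        rw [mem_insert, show a ∈ T ↔ ∃ i, β i = a from ⟨hex a, fun ⟨i, hi⟩ => hi ▸ hmem i⟩]
        simp [Fin.exists_fin_succ, eq_comm]
    · obtain ⟨i, hi⟩ := hex 1 (by simpa using h)
      exact schurPEval_eq_zero_of_eq x (β := (Fin.cons 1 β : Fin (T.card + 1) → ℕ)) (i := 0) (j := i.succ) (Fin.succ_ne_zero i).symm (by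
        rw [Fin.cons_zero, Fin.cons_succ]; exact hi.symm)
  · conv_rhs => rw [← himg]
    rw [sum_image hmono.injective.injOn]
    refine sum_congr rfl fun i _ => ?_
    rw [himg]
    split_ifs with h
    swap
    · refine (schurPSet_image x (γ := β + Pi.single i 1) ?_ ?_).symm
      · intro a b hab
        have h1 := hmono hab
        have h2 : β b ≠ β i + 1 := fun h2 => h (h2 ▸ hmem b)
        simp only [Pi.add_apply, Pi.single_apply]
        split_ifs with h3 h4 h4
        · rw [h3, h4] at hab; exact absurd hab (lt_irrefl _)
        · rw [h3] at h1 ⊢; omega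
        · omega
        · omega
      · ext a
        simp only [raisePart, mem_image, mem_univ, true_and, mem_insert, mem_erase, Pi.add_apply,
          Pi.single_apply]
        constructor
        · rintro ⟨j, rfl⟩
          by_cases h1 : j = i
          · left; simp [h1]
          · right; simpa [h1, hmem j] using hmono.injective.ne h1
        · rintro (rfl | ⟨h1, h2⟩)
          · exact ⟨i, by simp⟩
          · obtain ⟨j, rfl⟩ := hex a h2
            exact ⟨j, by simp [show j ≠ i from fun h3 => h1 (h3 ▸ rfl)]⟩
    · obtain ⟨j, hj⟩ := hex (β i + 1) (by simpa using h)
      have hji : j ≠ i := fun h1 => by rw [h1] at hj; omega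
      exact schurPEval_eq_zero_of_eq x (β := β + Pi.single i 1) hji.symm (by
        simp [Pi.single_eq_of_ne hji, hj])

/-- The Pieri rule transposed: raising m in T and lowering m + 1 in S are inverse to each other, so
coefficients of the product are sums over removable boxes. -/
theorem sum_mul_sum_schurPSet [CharZero K] (hx : Function.Injective x) (c : Finset ℕ → K) (n : ℕ) :
    (∑ a, x a) * ∑ T ∈ strictSets n, c T * schurPSet x T =
      ∑ S ∈ strictSets (n + 1), (∑ m ∈ S.filter (fun m => m - 1 ∉ S), c (lowerPart S m)) *
        schurPSet x S := by
  have h1 : (∑ a, x a) * ∑ T ∈ strictSets n, c T * schurPSet x T = ∑ T ∈ strictSets n,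
      ∑ m ∈ (insert 0 T).filter (fun m => m + 1 ∉ T), c T * schurPSet x (raisePart T m) := by
    rw [mul_sum]
    refine sum_congr rfl fun T hT => ?_
    rw [mul_left_comm, sum_mul_schurPSet hx (mem_strictSets.1 hT).1, mul_sum]
  simp only [h1, sum_mul]
  rw [sum_sigma', sum_sigma']
  refine sum_bij' (fun p _ => ⟨raisePart p.1 p.2, p.2 + 1⟩) (fun p _ => ⟨lowerPart p.1 p.2, p.2 - 1⟩)
    ?_ ?_ ?_ ?_ ?_
  · rintro ⟨T, m⟩ h
    rw [mem_sigma, mem_strictSets, mem_filter] at h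
    obtain ⟨⟨h2, h3⟩, h4, h5⟩ := h
    simp only at h2 h3 h4 h5
    rw [mem_sigma, mem_strictSets, mem_filter]
    refine ⟨⟨?_, ?_⟩, ?_, ?_⟩
    · simp only [raisePart, mem_insert, mem_erase]; rintro (h | h)
      · omega
      · exact h2 h.2
    · simp only; rw [sum_raisePart h2 h4 h5, h3]
    · exact mem_insert_self _ _
    · simp [raisePart]
  · rintro ⟨S, m⟩ h
    rw [mem_sigma, mem_strictSets, mem_filter] at h
    obtain ⟨⟨h2, h3⟩, h4, h5⟩ := h
    simp only at h2 h3 h4 h5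
    have h6 : m ≠ 0 := fun h => h2 (h ▸ h4)
    rw [mem_sigma, mem_strictSets, mem_filter]
    refine ⟨⟨?_, ?_⟩, ?_, ?_⟩
    · simp [lowerPart]
    · have := sum_lowerPart h4 h5 (F := fun a => a) rfl
      simp only at this ⊢
      omega
    · simp only [lowerPart, mem_insert, mem_erase]; tauto
    · simp only [lowerPart, mem_insert, mem_erase]; intro h; omega
  · rintro ⟨T, m⟩ h
    rw [mem_sigma, mem_strictSets, mem_filter] at h
    obtain ⟨⟨h2, h3⟩, h4, h5⟩ := h
    simp only at h2 h3 h4 h5 ⊢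
    rw [lowerPart_raisePart h2 h4 h5, Nat.add_sub_cancel]
  · rintro ⟨S, m⟩ h
    rw [mem_sigma, mem_strictSets, mem_filter] at h
    obtain ⟨⟨h2, h3⟩, h4, h5⟩ := h
    simp only at h2 h3 h4 h5 ⊢
    have h6 : m ≠ 0 := fun h => h2 (h ▸ h4)
    rw [raisePart_lowerPart h2 h4 h5, Nat.sub_add_cancel (Nat.one_le_iff_ne_zero.2 h6)]
  · rintro ⟨T, m⟩ h
    rw [mem_sigma, mem_strictSets, mem_filter] at h
    obtain ⟨⟨h2, h3⟩, h4, h5⟩ := h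
    simp only at h2 h3 h4 h5 ⊢
    rw [lowerPart_raisePart h2 h4 h5]

end Pieri

/-! ### Schur `P`-polynomials of strict partitions -/

section SchurP

open Finset

/-- The set of parts of a strict partition. -/
def StrictPartition.partSet {n : ℕ} (μ : StrictPartition n) : Finset ℕ := μ.1.parts.toFinset

theorem StrictPartition.partSet_mem {n : ℕ} (μ : StrictPartition n) :
    μ.partSet ∈ strictSets n := by
  refine mem_strictSets.2 ⟨fun h => ?_, ?_⟩
  · exact lt_irrefl 0 (μ.1.parts_pos (Multiset.mem_toFinset.1 h))
  · have h := μ.1.parts_sum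
    rwa [StrictPartition.partSet, Finset.sum_eq_multiset_sum, Multiset.toFinset_val, μ.2.dedup,
      Multiset.map_id']

theorem sum_partSet {M : Type*} [AddCommMonoid M] {n : ℕ} (F : Finset ℕ → M) :
    ∑ μ : StrictPartition n, F μ.partSet = ∑ S ∈ strictSets n, F S := by
  refine sum_bij (fun μ _ => μ.partSet) (fun μ _ => μ.partSet_mem) ?_ ?_ (fun _ _ => rfl)
  · intro μ _ ν _ h
    have h1 := congrArg Finset.val h
    simp only [StrictPartition.partSet, Multiset.toFinset_val, μ.2.dedup, ν.2.dedup] at h1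
    exact Subtype.ext (Nat.Partition.ext h1)
  · intro S hS
    obtain ⟨h0, h1⟩ := mem_strictSets.1 hS
    refine ⟨⟨⟨S.val, fun {i} hi => Nat.pos_of_ne_zero fun h => h0 (h ▸ hi), ?_⟩, S.nodup⟩,
      mem_univ _, ?_⟩
    · rw [← h1, Finset.sum_eq_multiset_sum, Multiset.map_id']
    · simp [StrictPartition.partSet]

theorem StrictPartition.part_strictMono {n : ℕ} (μ : StrictPartition n) :
    StrictMono fun i : Fin μ.len => μ.part (i.rev : Fin μ.len) := by
  intro i j hij
  exact μ.part_lt (Fin.rev_lt_rev.2 hij) (Fin.is_lt _)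

theorem StrictPartition.image_part {n : ℕ} (μ : StrictPartition n) :
    univ.image (fun i : Fin μ.len => μ.part (i.rev : Fin μ.len)) = μ.partSet := by
  ext a
  have h1 : a ∈ μ.partSet ↔ a ∈ μ.rows := by
    rw [StrictPartition.partSet, Multiset.mem_toFinset, StrictPartition.rows, Multiset.mem_sort]
  rw [h1, List.mem_iff_getElem, mem_image]
  constructor
  · rintro ⟨i, -, rfl⟩
    exact ⟨i.rev, (i.rev : Fin μ.len).2, (List.getD_eq_getElem _ _ (i.rev : Fin μ.len).2).symm⟩
  · rintro ⟨i, hi, rfl⟩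
    refine ⟨Fin.rev ⟨i, hi⟩, mem_univ _, ?_⟩
    rw [Fin.rev_rev, StrictPartition.part, List.getD_eq_getElem]

theorem pairFactor_rev {K : Type*} [Field K] {l : ℕ} (y : Fin l → K) :
    pairFactor (y ∘ Fin.rev) = ∏ i, ∏ j ∈ Ioi i, (y i + y j) / (y i - y j) := by
  have h (z : Fin l → Fin l → K) : ∏ i, ∏ j ∈ Ioi i, z i j = ∏ i, ∏ j, if i < j then z i j else 1 := by
    refine prod_congr rfl fun i _ => ?_
    rw [← prod_filter]
    congr 1
    ext; simp
  rw [pairFactor, h, h, ← Equiv.prod_comp Fin.revPerm, prod_comm]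
  rw [← Equiv.prod_comp Fin.revPerm]
  refine prod_congr rfl fun i _ => prod_congr rfl fun j _ => ?_
  simp [Fin.rev_lt_rev]

/-- The variables, as elements of the field of rational functions. -/
def fracX (N : ℕ) (a : Fin N) : FractionRing (MvPolynomial (Fin N) ℚ) :=
  algebraMap (MvPolynomial (Fin N) ℚ) _ (MvPolynomial.X a)

/-- The definition lists the parts in decreasing order and `schurPEval` in increasing order; the two
sums correspond under reversal of the indices. -/
theorem schurP_eq {n : ℕ} (μ : StrictPartition n) (N : ℕ) :
    schurP N μ = schurPSet (fracX N) μ.partSet := by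
  rw [schurPSet_image (fracX N) μ.part_strictMono μ.image_part, schurPEval, schurP]
  refine Fintype.sum_equiv (Equiv.embeddingCongr Fin.revPerm (Equiv.refl _)) _ _ fun f => ?_
  have hf : ((Equiv.embeddingCongr Fin.revPerm (Equiv.refl _)) f : Fin μ.len → Fin N) =
      f ∘ Fin.rev := by
    ext i
    simp
  rw [hf, schurKernel, ← Function.comp_assoc, pairFactor_rev]
  have himg : univ.image (f ∘ Fin.rev) = univ.image f := by
    ext a
    simp only [mem_image, mem_univ, true_and, Function.comp_apply]
    exact ⟨fun ⟨i, hi⟩ => ⟨_, hi⟩, fun ⟨i, hi⟩ => ⟨i.rev, by rwa [Fin.rev_rev]⟩⟩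
  rw [himg, ← Equiv.prod_comp Fin.revPerm (fun i => fracX N ((f ∘ Fin.rev) i) ^ _),
    ← Equiv.prod_comp Fin.revPerm (fun i => ∏ b ∈ (univ.image f)ᶜ,
      (fracX N ((f ∘ Fin.rev) i) + fracX N b) / (fracX N ((f ∘ Fin.rev) i) - fracX N b))]
  simp only [Fin.revPerm_apply, Function.comp_apply, Fin.rev_rev]
  rw [← prod_mul_distrib, ← prod_mul_distrib]
  refine prod_congr rfl fun i _ => ?_
  congr 1
  -- The unused variables go into the first product of `schurKernel`, the later values of f into
  -- `pairFactor`.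
  have hsplit : univ.filter (fun a => ∀ i' ≤ i, a ≠ f i') =
      (univ.image f)ᶜ ∪ (Ioi i).image f := by
    ext a
    simp only [mem_filter, mem_univ, true_and, mem_union, mem_compl, mem_image, mem_Ioi]
    constructor
    · intro h
      by_cases h1 : ∃ j, f j = a
      · obtain ⟨j, rfl⟩ := h1
        exact Or.inr ⟨j, lt_of_not_ge fun h2 => h j h2 rfl, rfl⟩
      · exact Or.inl h1
    · rintro (h | ⟨j, hj, rfl⟩) i' hi' h2
      · exact h ⟨i', h2.symm⟩
      · exact absurd (f.injective h2) (lt_of_le_of_lt hi' hj).ne'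
  have hd : Disjoint (univ.image f)ᶜ ((Ioi i).image f) := by
    rw [disjoint_left]
    intro a h1 h2
    obtain ⟨j, _, rfl⟩ := mem_image.1 h2
    exact mem_compl.1 h1 (mem_image_of_mem _ (mem_univ _))
  rw [hsplit, prod_union hd, prod_image f.injective.injOn]
  rfl

theorem fracX_injective (N : ℕ) : Function.Injective (fracX N) :=
  (IsFractionRing.injective (MvPolynomial (Fin N) ℚ) _).comp MvPolynomial.X_injective

theorem fracX_add_ne_zero (N : ℕ) (a b : Fin N) : fracX N a + fracX N b ≠ 0 := by
  rw [fracX, fracX, ← map_add]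
  refine fun h => ?_
  have h1 := (map_eq_zero_iff _ (IsFractionRing.injective (MvPolynomial (Fin N) ℚ)
    (FractionRing (MvPolynomial (Fin N) ℚ)))).1 h
  have h2 := congrArg (MvPolynomial.eval fun _ => (1 : ℚ)) h1
  norm_num at h2

instance charZero_fractionRing (N : ℕ) : CharZero (FractionRing (MvPolynomial (Fin N) ℚ)) :=
  charZero_of_injective_algebraMap (IsFractionRing.injective (MvPolynomial (Fin N) ℚ) _)

/-- The alternant `∑_σ sgn(σ) ∏ᵢ X_{σ i}^{βᵢ}`. -/
def alternant {l : ℕ} (β : Fin l → ℕ) : MvPolynomial (Fin l) ℚ :=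
  ∑ σ : Equiv.Perm (Fin l), (Equiv.Perm.sign σ : ℤ) • ∏ i, MvPolynomial.X (σ i) ^ β i

/-- A rearrangement of β equal to γ has the same range, and a strictly increasing sequence is
determined by its range; so only the identity permutation can contribute. -/
theorem coeff_alternant {l : ℕ} {β γ : Fin l → ℕ} (hβ : StrictMono β) (hγ : StrictMono γ) :
    (alternant β).coeff (Finsupp.equivFunOnFinite.symm γ) = if β = γ then 1 else 0 := by
  have h1 (σ : Equiv.Perm (Fin l)) : ∏ i, (MvPolynomial.X (σ i) : MvPolynomial (Fin l) ℚ) ^ β i =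
      MvPolynomial.monomial (Finsupp.equivFunOnFinite.symm (β ∘ σ.symm)) 1 := by
    rw [MvPolynomial.monomial_eq, Finsupp.prod_fintype _ _ (fun _ => pow_zero _), map_one, one_mul,
      ← Equiv.prod_comp σ (fun i => (MvPolynomial.X i : MvPolynomial (Fin l) ℚ) ^
        (Finsupp.equivFunOnFinite.symm (β ∘ σ.symm)) i)]
    simp
  have h2 (σ : Equiv.Perm (Fin l)) (h : β ∘ σ.symm = γ) : β = γ ∧ σ = 1 := by
    have h3 : β = γ := by
      rw [← hβ.range_inj hγ, ← h, Set.range_comp, σ.symm.surjective.range_eq, Set.image_univ]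
    refine ⟨h3, Equiv.ext fun i => hβ.injective ?_⟩
    have h4 := congrFun h (σ i)
    rw [Function.comp_apply, Equiv.symm_apply_apply] at h4
    rw [Equiv.Perm.one_apply, h4, h3]
  rw [alternant, MvPolynomial.coeff_sum]
  simp only [MvPolynomial.coeff_smul, h1, MvPolynomial.coeff_monomial,
    EmbeddingLike.apply_eq_iff_eq]
  rw [sum_eq_single 1]
  · simp
    rfl
  · intro σ _ hσ
    rw [if_neg fun h => hσ (h2 σ h).2, smul_zero]
  · simp

/-- With as many variables as parts the injections are permutations and no variable is unused, so
only the sign depends on the permutation in the kernel. -/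
theorem schurPEval_fracX {l : ℕ} (β : Fin l → ℕ) : schurPEval (fracX l) β =
    pairFactor (fracX l) * algebraMap (MvPolynomial (Fin l) ℚ) _ (alternant β) := by
  rw [schurPEval, alternant, map_sum, mul_sum]
  refine Fintype.sum_equiv (Equiv.embeddingEquivOfFinite (Fin l)) _ _ fun f => ?_
  obtain ⟨σ, rfl⟩ := (Equiv.embeddingEquivOfFinite (Fin l)).symm.surjective f
  rw [Equiv.apply_symm_apply]
  have h1 : (((Equiv.embeddingEquivOfFinite (Fin l)).symm σ : Fin l ↪ Fin l) : Fin l → Fin l) = σ :=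
    rfl
  rw [h1, schurKernel, image_univ_equiv, compl_univ]
  simp only [prod_empty, prod_const_one, one_mul]
  rw [pairFactor_comp_perm, zsmul_eq_mul, map_mul, map_intCast, map_prod]
  simp only [map_pow, fracX]
  ring

/-- Linear independence of the P_λ, by induction on the number l of parts. In exactly l variables
the longer partitions vanish, the shorter ones have coefficient 0 already, and those of length l are
a common nonzero factor times alternants with distinct leading exponents. -/
theorem eq_zero_of_sum_schurPSet_eq_zero {n : ℕ} (D : Finset ℕ → ℚ)
    (h : ∀ N, ∑ S ∈ strictSets n, (D S : FractionRing (MvPolynomial (Fin N) ℚ)) *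
      schurPSet (fracX N) S = 0) {S : Finset ℕ} (hS : S ∈ strictSets n) : D S = 0 := by
  induction hl : S.card using Nat.strong_induction_on generalizing S with
  | _ l ih =>
  have h1 := h l
  have h2 : ∀ T ∈ strictSets n, (D T : FractionRing (MvPolynomial (Fin l) ℚ)) *
      schurPSet (fracX l) T = pairFactor (fracX l) * algebraMap (MvPolynomial (Fin l) ℚ) _
        (if hT : T.card = l then D T • alternant (T.orderEmbOfFin hT) else 0) := by
    intro T hT
    rcases lt_trichotomy T.card l with h3 | h3 | h3
    · rw [ih _ h3 hT rfl, dif_neg h3.ne]; simp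
    · rw [dif_pos h3, schurPSet_image (fracX l) (γ := T.orderEmbOfFin h3)
        (T.orderEmbOfFin h3).strictMono (by
          rw [← coe_inj, coe_image, coe_univ, Set.image_univ, range_orderEmbOfFin]),
        schurPEval_fracX, MvPolynomial.smul_eq_C_mul, map_mul]
      have : algebraMap (MvPolynomial (Fin l) ℚ) (FractionRing (MvPolynomial (Fin l) ℚ))
          (MvPolynomial.C (D T)) = (D T : FractionRing (MvPolynomial (Fin l) ℚ)) := by
        rw [← RingHom.comp_apply, eq_ratCast]
      rw [this]
      ring
    · have : IsEmpty (Fin T.card ↪ Fin l) := by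
        refine ⟨fun f => ?_⟩
        have := Fintype.card_le_of_embedding f
        simp at this
        omega
      rw [dif_neg h3.ne', schurPSet, schurPEval, univ_eq_empty, sum_empty]; simp
  rw [sum_congr rfl h2, ← mul_sum, ← map_sum, mul_eq_zero, or_iff_right (pairFactor_ne_zero
    (fracX_add_ne_zero l) (fracX_injective l)), map_eq_zero_iff _ (IsFractionRing.injective _ _)]
    at h1
  have h4 := congrArg (MvPolynomial.coeff (Finsupp.equivFunOnFinite.symm (S.orderEmbOfFin hl))) h1
  rw [MvPolynomial.coeff_sum, sum_eq_single S] at h4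
  · rw [dif_pos hl, MvPolynomial.coeff_smul, coeff_alternant (S.orderEmbOfFin hl).strictMono
      (S.orderEmbOfFin hl).strictMono, if_pos rfl] at h4
    simpa using h4
  · intro T _ hTS
    split_ifs with hT
    · rw [MvPolynomial.coeff_smul, coeff_alternant (T.orderEmbOfFin hT).strictMono
        (S.orderEmbOfFin hl).strictMono, if_neg, smul_zero]
      intro h5
      apply hTS
      rw [← coe_inj, ← range_orderEmbOfFin T hT, ← range_orderEmbOfFin S hl, h5]
    · simp
  · exact fun h5 => absurd hS h5

/-- Since `spinX` is defined through unique existence, any expansion found must be combined with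
linear independence before its coefficients can be read off. -/
theorem spinX_eq {n : ℕ} {ρ : n.Partition} {C : Finset ℕ → ℚ}
    (h : ∀ N, algebraMap (MvPolynomial (Fin N) ℚ) (FractionRing (MvPolynomial (Fin N) ℚ))
      (MvPolynomial.psumPart (Fin N) ℚ ρ) = ∑ S ∈ strictSets n,
        (C S : FractionRing (MvPolynomial (Fin N) ℚ)) * schurPSet (fracX N) S)
    (μ : StrictPartition n) : spinX μ ρ = C μ.partSet := by
  -- The scalar action in `IsSchurPExpansion` passes through the polynomial ring and has to be
  -- identified with multiplication by the rational number in the field.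
  have hsmul (N : ℕ) (q : ℚ) (y : FractionRing (MvPolynomial (Fin N) ℚ)) : q • y = (q : _) * y := by
    have h1 := smul_assoc q (1 : MvPolynomial (Fin N) ℚ) y
    rw [one_smul, MvPolynomial.smul_eq_C_mul, mul_one, Algebra.smul_def] at h1
    rw [← h1, ← RingHom.comp_apply, eq_ratCast]
  have hex : IsSchurPExpansion ρ fun μ => C μ.partSet := by
    intro N
    simp only [schurP_eq, hsmul]
    rw [h N, ← sum_partSet]
  have huniq : ∀ c : StrictPartition n → ℚ, IsSchurPExpansion ρ c → c = fun μ => C μ.partSet := by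
    intro c hc
    obtain ⟨E, hE⟩ : ∃ E : Finset ℕ → ℚ, ∀ μ : StrictPartition n, E μ.partSet = c μ := by
      refine ⟨Function.extend StrictPartition.partSet c 0, fun μ => Function.Injective.extend_apply ?_ _ _ _⟩
      intro μ ν h
      have h1 := congrArg Finset.val h
      simp only [StrictPartition.partSet, Multiset.toFinset_val, μ.2.dedup, ν.2.dedup] at h1
      exact Subtype.ext (Nat.Partition.ext h1)
    funext μ
    rw [← hE, ← sub_eq_zero]
    refine eq_zero_of_sum_schurPSet_eq_zero (fun S => E S - C S) (fun N => ?_) μ.partSet_mem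
    have h1 := hc N
    simp only [schurP_eq, hsmul, ← hE] at h1
    rw [sum_partSet (fun S => (E S : FractionRing (MvPolynomial (Fin N) ℚ)) *
      schurPSet (fracX N) S), h N] at h1
    simp only [Rat.cast_sub, sub_mul, sum_sub_distrib]
    rw [h1, sub_self]
  have hu : ∃! c : StrictPartition n → ℚ, IsSchurPExpansion ρ c := ⟨_, hex, huniq⟩
  rw [spinX, dif_pos hu, huniq _ hu.choose_spec.1]

end SchurP

/-! ### The number of shifted tableaux and its down-transition identities -/

section Harmonic

open Finset

/-- `g^λ / n!`, that is `∏ 1 / λᵢ! ∏_{i < j} (λᵢ - λⱼ) / (λᵢ + λⱼ)`. -/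
def schurWeight (S : Finset ℕ) : ℚ :=
  (∏ a ∈ S, (1 / (a.factorial : ℚ))) *
    ∏ a ∈ S, ∏ b ∈ S, if b < a then ((a : ℚ) - b) / (a + b) else 1

/-- The power sum `∑ λᵢᵏ`. -/
def powerSum (k : ℕ) (S : Finset ℕ) : ℚ := ∑ a ∈ S, (a : ℚ) ^ k

/-- The absolute value removes the need to know where `a` stands among the parts. -/
theorem schurWeight_insert {S : Finset ℕ} {a : ℕ} (ha : a ∉ S) :
    schurWeight (insert a S) =
      schurWeight S * ((1 / (a.factorial : ℚ)) * ∏ b ∈ S, |(a : ℚ) - b| / (a + b)) := by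
  have h1 : ∏ b ∈ S, |(a : ℚ) - b| / (a + b) = (∏ b ∈ S, if b < a then ((a : ℚ) - b) / (a + b) else 1) *
      ∏ b ∈ S, if a < b then ((b : ℚ) - a) / (b + a) else 1 := by
    rw [← prod_mul_distrib]
    refine prod_congr rfl fun b hb => ?_
    rcases lt_trichotomy a b with h | h | h
    · have h' : (a : ℚ) < b := by exact_mod_cast h
      rw [if_neg h.not_gt, if_pos h, abs_of_neg (by linarith)]
      ring
    · exact absurd (h ▸ hb) ha
    · have h' : (b : ℚ) < a := by exact_mod_cast h
      rw [if_neg h.not_gt, if_pos h, abs_of_pos (by linarith)]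
      ring
  simp only [schurWeight, prod_insert ha, lt_irrefl, if_false, one_mul, prod_mul_distrib, h1]
  ring

theorem schurWeight_pos {S : Finset ℕ} : 0 < schurWeight S := by
  refine mul_pos (prod_pos fun a _ => by positivity) (prod_pos fun a _ => prod_pos fun b _ => ?_)
  split_ifs with h
  · have h' : (b : ℚ) < a := by exact_mod_cast h
    have h2 : (0 : ℚ) ≤ b := Nat.cast_nonneg b
    exact div_pos (by linarith) (by linarith)
  · exact one_pos

/-- The quotient `g(λ - e) / g(λ)` (up to the factor `n`), where `e` lowers the part `m` by one. -/
def lowerWeight (S : Finset ℕ) (m : ℕ) : ℚ :=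
  m * ∏ b ∈ S.erase m, (((m : ℚ) - 1 - b) * (m + b)) / ((m - 1 + b) * (m - b))

theorem schurWeight_lowerPart {S : Finset ℕ} (h0 : 0 ∉ S) {m : ℕ} (hm : m ∈ S) (hm' : m - 1 ∉ S) :
    schurWeight (lowerPart S m) = schurWeight S * lowerWeight S m := by
  obtain ⟨k, rfl⟩ : ∃ k, m = k + 1 := Nat.exists_eq_succ_of_ne_zero fun h => h0 (h ▸ hm)
  rw [Nat.add_sub_cancel] at hm'
  have hk : k ∉ S.erase (k + 1) := fun h => hm' (mem_of_mem_erase h)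
  have h1 : schurWeight (lowerPart S (k + 1)) = schurWeight (insert k (S.erase (k + 1))) := by
    rw [lowerPart, Nat.add_sub_cancel]
    -- A part 0 may be kept or dropped: its factor 1/0! ∏ |0 - b|/(0 + b) is 1.
    rcases Nat.eq_zero_or_pos k with h | h
    · subst h
      rw [erase_insert hk, schurWeight_insert hk, prod_eq_one]
      · simp
      · intro b hb
        have : (b : ℚ) ≠ 0 := by
          intro h2
          exact h0 ((Nat.cast_eq_zero.1 h2) ▸ mem_of_mem_erase hb)
        simp [this]
    · rw [erase_eq_of_notMem]
      rw [mem_insert, mem_erase]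
      rintro (h2 | h2)
      · omega
      · exact h0 h2.2
  have h2 : schurWeight S = schurWeight (insert (k + 1) (S.erase (k + 1))) := by
    rw [insert_erase hm]
  rw [h1, h2, schurWeight_insert hk, schurWeight_insert (notMem_erase _ _), lowerWeight]
  have h3 : ∏ b ∈ S.erase (k + 1), |(k : ℚ) - b| / (k + b) =
      (∏ b ∈ S.erase (k + 1), |((k + 1 : ℕ) : ℚ) - b| / ((k + 1 : ℕ) + b)) *
      ∏ b ∈ S.erase (k + 1), ((((k + 1 : ℕ) : ℚ) - 1 - b) * ((k + 1 : ℕ) + b)) /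
        (((k + 1 : ℕ) - 1 + b) * ((k + 1 : ℕ) - b)) := by
    rw [← prod_mul_distrib]
    refine prod_congr rfl fun b hb => ?_
    have hbS := mem_of_mem_erase hb
    have hb1 : b ≠ k + 1 := ne_of_mem_erase hb
    have hb2 : b ≠ k := fun h => hm' (h ▸ hbS)
    have hb0 : b ≠ 0 := fun h => h0 (h ▸ hbS)
    have q0 : (0 : ℚ) < b := by exact_mod_cast Nat.pos_of_ne_zero hb0
    have qk : (0 : ℚ) ≤ k := Nat.cast_nonneg k
    have n1 : (k : ℚ) + b ≠ 0 := by linarith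
    have n2 : (k : ℚ) + 1 + b ≠ 0 := by linarith
    push_cast
    rw [add_sub_cancel_right]
    rcases lt_or_gt_of_ne hb2 with h | h
    · have q1 : (b : ℚ) + 1 ≤ k := by exact_mod_cast h
      rw [abs_of_pos (by linarith), abs_of_pos (by linarith)]
      have n3 : (k : ℚ) + 1 - b ≠ 0 := by linarith
      field_simp
    · have q1 : (k : ℚ) + 2 ≤ b := by exact_mod_cast (by omega : k + 2 ≤ b)
      rw [abs_of_neg (by linarith), abs_of_neg (by linarith)]
      have n3 : (k : ℚ) + 1 - b ≠ 0 := by linarith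
      field_simp
  rw [h3, Nat.factorial_succ]
  have n4 : ((k.factorial : ℕ) : ℚ) ≠ 0 := by positivity
  push_cast
  field_simp

/-- Boxes that cannot be removed get weight 0, so sums over removable boxes extend to all parts. -/
theorem lowerWeight_eq_zero {S : Finset ℕ} {m : ℕ} (hm : m ≠ 0) (hm' : m - 1 ∈ S) :
    lowerWeight S m = 0 := by
  rw [lowerWeight, prod_eq_zero (i := m - 1), mul_zero]
  · exact mem_erase.2 ⟨by omega, hm'⟩
  · rw [Nat.cast_sub (Nat.one_le_iff_ne_zero.2 hm)]
    simp

/-- The series `∏ (1 - λᵢ (λᵢ + 1) t) / (1 - λᵢ (λᵢ - 1) t)`. -/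
def lowerSeries (S : Finset ℕ) : PowerSeries ℚ :=
  ∏ b ∈ S, (((1 - Polynomial.C ((b : ℚ) * (b + 1)) * Polynomial.X : Polynomial ℚ) :
    PowerSeries ℚ) * PowerSeries.mk (fun k => ((b : ℚ) * (b - 1)) ^ k))

/-- Since m(m-1) - b(b+1) = (m-1-b)(m+b) and m(m-1) - b(b-1) = (m-1+b)(m-b), the weight is a residue
up to the numerator factor b = m, which is -2m instead of m. -/
theorem sum_lowerWeight_mul_pow {S : Finset ℕ} (h0 : 0 ∉ S) (k : ℕ) :
    ∑ m ∈ S, lowerWeight S m * ((m : ℚ) * (m - 1)) ^ k =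
      -(1 / 2) * PowerSeries.coeff (k + 1) (lowerSeries S) := by
  have hpos : ∀ b ∈ S, (1 : ℚ) ≤ b := fun b hb => by
    exact_mod_cast Nat.one_le_iff_ne_zero.2 fun h => h0 (h ▸ hb)
  -- The values b(b - 1) collide only at 0 and 1, and 0 is not a part.
  have hinj : Set.InjOn (fun b : ℕ => (b : ℚ) * (b - 1)) S := by
    intro a ha b hb h
    have h1 := hpos a ha
    have h2 := hpos b hb
    have h3 : ((a : ℚ) - b) * (a + b - 1) = 0 := by simp only at h; linear_combination h
    rcases mul_eq_zero.1 h3 with h4 | h4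
    · exact_mod_cast sub_eq_zero.1 h4
    · linarith
  rw [lowerSeries, coeff_succ_prod_one_sub_mul_mk hinj, mul_sum]
  refine sum_congr rfl fun m hm => ?_
  rw [← mul_prod_erase S _ hm, lowerWeight, prod_div_distrib]
  have h1 : ∀ b : ℕ, (m : ℚ) * (m - 1) - b * (b + 1) = (m - 1 - b) * (m + b) := fun b => by ring
  have h2 : ∀ b : ℕ, (m : ℚ) * (m - 1) - b * (b - 1) = (m - 1 + b) * (m - b) := fun b => by ring
  simp only [h1, h2]
  ring

theorem coeff_lowerSeries_zero (S : Finset ℕ) : PowerSeries.coeff 0 (lowerSeries S) = 1 :=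
  coeff_zero_prod_one_sub_mul_mk S _ _

theorem coeff_lowerSeries_succ (S : Finset ℕ) (k : ℕ) :
    ((k + 1 : ℕ) : ℚ) * PowerSeries.coeff (k + 1) (lowerSeries S) =
      ∑ j ∈ range (k + 1), PowerSeries.coeff j (lowerSeries S) *
        ∑ b ∈ S, (((b : ℚ) * (b - 1)) ^ (k + 1 - j) - ((b : ℚ) * (b + 1)) ^ (k + 1 - j)) := by
  rw [lowerSeries, (hasLogDeriv_prod_one_sub_mul_mk S (fun b : ℕ => (b : ℚ) * (b - 1))
    (fun b : ℕ => (b : ℚ) * (b + 1))).natCast_mul_coeff, Nat.sum_antidiagonal_eq_sum_range_succ_mk,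
    sum_range_succ]
  simp only [Nat.sub_self, if_true, add_zero, sum_const_zero, mul_zero]
  refine sum_congr rfl fun j hj => ?_
  have : k + 1 - j ≠ 0 := by have := mem_range.1 hj; omega
  simp only [this, if_false]
  congr 1
  exact sum_congr rfl fun b _ => by ring

/-- The values of `∑ lowerWeight · (m (m - 1))ᵏ`, for `k ≤ 4`, in terms of power sums. -/
def lowerMoment (p1 p3 p5 p7 p9 : ℚ) : Fin 5 → ℚ :=
  ![p1,
    p3 - p1 ^ 2,
    p5 - 2 * p1 * p3 + 2 / 3 * p1 ^ 3 + 1 / 3 * p3,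
    p7 - p3 ^ 2 - 2 * p1 * p5 + 2 * p1 ^ 2 * p3 - 1 / 3 * p1 ^ 4 + p5 - 2 / 3 * p1 * p3,
    p9 - 2 * p3 * p5 - 2 * p1 * p7 + 2 * p1 * p3 ^ 2 + 2 * p1 ^ 2 * p5 - 4 / 3 * p1 ^ 3 * p3 +
      2 / 15 * p1 ^ 5 + 2 * p7 - 2 / 3 * p3 ^ 2 - 2 * p1 * p5 + 2 / 3 * p1 ^ 2 * p3 + 1 /
      5 * p5]

theorem sum_lowerWeight_eq {S : Finset ℕ} (h0 : 0 ∉ S) (k : Fin 5) :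
    ∑ m ∈ S, lowerWeight S m * ((m : ℚ) * (m - 1)) ^ (k : ℕ) =
      lowerMoment (powerSum 1 S) (powerSum 3 S) (powerSum 5 S) (powerSum 7 S) (powerSum 9 S) k := by
  rw [sum_lowerWeight_mul_pow h0]
  have e0 := coeff_lowerSeries_zero S
  -- The substitution b ↦ -b exchanges b(b-1) and b(b+1), so these differences are odd in b and only
  -- odd power sums occur.
  have s1 : ∑ b ∈ S, (((b : ℚ) * (b - 1)) ^ 1 - ((b : ℚ) * (b + 1)) ^ 1) = -2 * powerSum 1 S := by
    rw [powerSum, mul_sum]; exact sum_congr rfl fun b _ => by ring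
  have s2 : ∑ b ∈ S, (((b : ℚ) * (b - 1)) ^ 2 - ((b : ℚ) * (b + 1)) ^ 2) = -4 * powerSum 3 S := by
    rw [powerSum, mul_sum]; exact sum_congr rfl fun b _ => by ring
  have s3 : ∑ b ∈ S, (((b : ℚ) * (b - 1)) ^ 3 - ((b : ℚ) * (b + 1)) ^ 3) =
      -6 * powerSum 5 S + -2 * powerSum 3 S := by
    simp only [powerSum, mul_sum, ← sum_add_distrib]; exact sum_congr rfl fun b _ => by ring
  have s4 : ∑ b ∈ S, (((b : ℚ) * (b - 1)) ^ 4 - ((b : ℚ) * (b + 1)) ^ 4) =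
      -8 * powerSum 7 S + -8 * powerSum 5 S := by
    simp only [powerSum, mul_sum, ← sum_add_distrib]; exact sum_congr rfl fun b _ => by ring
  have s5 : ∑ b ∈ S, (((b : ℚ) * (b - 1)) ^ 5 - ((b : ℚ) * (b + 1)) ^ 5) =
      -10 * powerSum 9 S + -20 * powerSum 7 S + -2 * powerSum 5 S := by
    simp only [powerSum, mul_sum, ← sum_add_distrib]; exact sum_congr rfl fun b _ => by ring
  have e1 := coeff_lowerSeries_succ S 0
  have e2 := coeff_lowerSeries_succ S 1
  have e3 := coeff_lowerSeries_succ S 2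
  have e4 := coeff_lowerSeries_succ S 3
  have e5 := coeff_lowerSeries_succ S 4
  simp only [sum_range_succ, range_zero, sum_empty, zero_add, Nat.sub_zero, Nat.reduceAdd,
    Nat.reduceSub, e0, s1, s2, s3, s4, s5] at e1 e2 e3 e4 e5
  push_cast at e1 e2 e3 e4 e5
  have hdiv {a b c : ℚ} (hc : c ≠ 0) (h : c * a = b) : a = b / c := by
    rw [← h, mul_div_cancel_left₀ _ hc]
  have f1 : PowerSeries.coeff 1 (lowerSeries S) = -2 * powerSum 1 S := by linear_combination e1
  rw [f1] at e2 e3 e4 e5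
  have f2 := hdiv (by norm_num : (2 : ℚ) ≠ 0) e2
  rw [f2] at e3 e4 e5
  have f3 := hdiv (by norm_num : (3 : ℚ) ≠ 0) e3
  rw [f3] at e4 e5
  have f4 := hdiv (by norm_num : (4 : ℚ) ≠ 0) e4
  rw [f4] at e5
  have f5 := hdiv (by norm_num : (5 : ℚ) ≠ 0) e5
  fin_cases k
  · simp [f1, lowerMoment]; try ring
  · simp [f2, lowerMoment]; ring
  · simp [f3, lowerMoment]; ring
  · simp [f4, lowerMoment]; ring
  · simp [f5, lowerMoment]; ring

/-- The value of a function of `p₁, p₃, p₅, p₇, p₉` at a strict partition. -/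
def evalPowerSums (f : ℚ → ℚ → ℚ → ℚ → ℚ → ℚ) (S : Finset ℕ) : ℚ :=
  f (powerSum 1 S) (powerSum 3 S) (powerSum 5 S) (powerSum 7 S) (powerSum 9 S)

theorem powerSum_lowerPart {S : Finset ℕ} (h0 : 0 ∉ S) {m : ℕ} (hm : m ∈ S) (hm' : m - 1 ∉ S)
    {k : ℕ} (hk : k ≠ 0) :
    powerSum k (lowerPart S m) = powerSum k S + (((m : ℚ) - 1) ^ k - (m : ℚ) ^ k) := by
  have h := sum_lowerPart hm hm' (F := fun a => (a : ℚ) ^ k) (by simp [hk])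
  rw [Nat.cast_sub (Nat.one_le_iff_ne_zero.2 fun h => h0 (h ▸ hm)), Nat.cast_one] at h
  rw [powerSum, powerSum]
  linear_combination h

/-- With u = m(m - 1), the differences mᵏ - (m-1)ᵏ for odd k are polynomials in u, for example 3u +
1 for k = 3. So `hc` expands f at the lowered partition in powers of u, and `hf` is what remains
after averaging by `sum_lowerWeight_eq`. -/
theorem sum_lowerPart_eq {S : Finset ℕ} (h0 : 0 ∉ S) {r : ℚ} {f : ℚ → ℚ → ℚ → ℚ → ℚ → ℚ}
    (c : ℚ → ℚ → ℚ → ℚ → ℚ → Fin 5 → ℚ)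
    (hc : ∀ p1 p3 p5 p7 p9 u, f (p1 - 1) (p3 - (3 * u + 1)) (p5 - (5 * u ^ 2 + 5 * u + 1))
      (p7 - (7 * u ^ 3 + 14 * u ^ 2 + 7 * u + 1))
      (p9 - (9 * u ^ 4 + 30 * u ^ 3 + 27 * u ^ 2 + 9 * u + 1)) =
        ∑ k : Fin 5, c p1 p3 p5 p7 p9 k * u ^ (k : ℕ))
    (hf : ∀ p1 p3 p5 p7 p9, ∑ k : Fin 5, c p1 p3 p5 p7 p9 k * lowerMoment p1 p3 p5 p7 p9 k =
      (p1 - r) * f p1 p3 p5 p7 p9) :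
    ∑ m ∈ S.filter (fun m => m - 1 ∉ S), schurWeight (lowerPart S m) * evalPowerSums f (lowerPart S m) =
      (powerSum 1 S - r) * (schurWeight S * evalPowerSums f S) := by
  have h1 : ∑ m ∈ S.filter (fun m => m - 1 ∉ S),
      schurWeight (lowerPart S m) * evalPowerSums f (lowerPart S m) =
      ∑ m ∈ S, schurWeight S * (lowerWeight S m * ∑ k : Fin 5, c (powerSum 1 S) (powerSum 3 S)
        (powerSum 5 S) (powerSum 7 S) (powerSum 9 S) k * ((m : ℚ) * (m - 1)) ^ (k : ℕ)) := by
    rw [sum_filter]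
    refine sum_congr rfl fun m hm => ?_
    split_ifs with hm'
    swap
    · rw [schurWeight_lowerPart h0 hm hm', mul_assoc, evalPowerSums, ← hc,
        powerSum_lowerPart h0 hm hm' (by norm_num), powerSum_lowerPart h0 hm hm' (by norm_num),
        powerSum_lowerPart h0 hm hm' (by norm_num), powerSum_lowerPart h0 hm hm' (by norm_num),
        powerSum_lowerPart h0 hm hm' (by norm_num)]
      congr 3 <;> ring
    · rw [lowerWeight_eq_zero (fun h => h0 (h ▸ hm)) hm', zero_mul, mul_zero]
  rw [h1, ← mul_sum, mul_left_comm, evalPowerSums, ← hf]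
  congr 1
  simp only [mul_sum]
  rw [sum_comm]
  refine sum_congr rfl fun k _ => ?_
  rw [← sum_lowerWeight_eq h0, mul_sum]
  exact sum_congr rfl fun m _ => by ring

/-- The normalized spin character `𝔭_1` as a polynomial in the power sums `p₁, p₃, …, p₉` of the parts. -/
def spinPoly1 {K : Type*} [Field K] (p1 _p3 _p5 _p7 _p9 : K) : K :=
  p1

/-- The normalized spin character `𝔭_3` as a polynomial in the power sums `p₁, p₃, …, p₉` of the parts. -/
def spinPoly3 {K : Type*} [Field K] (p1 p3 _p5 _p7 _p9 : K) : K :=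
  p3 - 3 * p1 ^ 2 + 2 * p1

/-- The normalized spin character `𝔭_5` as a polynomial in the power sums `p₁, p₃, …, p₉` of the parts. -/
def spinPoly5 {K : Type*} [Field K] (p1 p3 p5 _p7 _p9 : K) : K :=
  p5 - 10 * p1 * p3 + 50 / 3 * p1 ^ 3 + 55 / 3 * p3 - 50 * p1 ^ 2 + 24 * p1

/-- The normalized spin character `𝔭_7` as a polynomial in the power sums `p₁, p₃, …, p₉` of the parts. -/
def spinPoly7 {K : Type*} [Field K] (p1 p3 p5 p7 _p9 : K) : K :=
  p7 - 7 * p3 ^ 2 - 14 * p1 * p5 + 98 * p1 ^ 2 * p3 - 343 / 3 * p1 ^ 4 + 77 * p5 - 1862 / 3 * p1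
  * p3 + 2744 / 3 * p1 ^ 3 + 2128 / 3 * p3 - 1764 * p1 ^ 2 + 720 * p1

/-- The normalized spin character `𝔭_9` as a polynomial in the power sums `p₁, p₃, …, p₉` of the parts. -/
def spinPoly9 {K : Type*} [Field K] (p1 p3 p5 p7 p9 : K) : K :=
  p9 - 18 * p3 * p5 - 18 * p1 * p7 + 162 * p1 * p3 ^ 2 + 162 * p1 ^ 2 * p5 - 972 * p1 ^ 3 * p3 +
  4374 / 5 * p1 ^ 5 + 222 * p7 - 1026 * p3 ^ 2 - 2538 * p1 * p5 + 14094 * p1 ^ 2 * p3 - 14580 *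
  p1 ^ 4 + 37401 / 5 * p5 - 52704 * p1 * p3 + 70632 * p1 ^ 3 + 47492 * p3 - 109584 * p1 ^ 2 +
  40320 * p1

/-! ### Lowering identities for the character polynomials. -/

theorem sum_lowerPart_spinPoly1 {S : Finset ℕ} (h0 : 0 ∉ S) :
    ∑ m ∈ S.filter (fun m => m - 1 ∉ S), schurWeight (lowerPart S m) * evalPowerSums spinPoly1 (lowerPart S m) =
      (powerSum 1 S - 1) * (schurWeight S * evalPowerSums spinPoly1 S) := by
  refine sum_lowerPart_eq h0 (fun p1 p3 p5 p7 p9 =>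
    ![p1 - 1, 0, 0, 0, 0]) ?_ ?_
  · intro p1 p3 p5 p7 p9 u
    simp [spinPoly1, Fin.sum_univ_five]
  · intro p1 p3 p5 p7 p9
    simp [spinPoly1, Fin.sum_univ_five, lowerMoment]

theorem sum_lowerPart_spinPoly3 {S : Finset ℕ} (h0 : 0 ∉ S) :
    ∑ m ∈ S.filter (fun m => m - 1 ∉ S), schurWeight (lowerPart S m) * evalPowerSums spinPoly3 (lowerPart S m) =
      (powerSum 1 S - 3) * (schurWeight S * evalPowerSums spinPoly3 S) := by
  -- The entries are the coefficients of 1, u, u², u³, u⁴ in `spinPoly3` at the lowered power sums;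
  -- likewise for the other four polynomials.
  refine sum_lowerPart_eq h0 (fun p1 p3 p5 p7 p9 =>
    ![p3 - 3 * p1 ^ 2 + 8 * p1 - 6, -3, 0, 0, 0]) ?_ ?_
  · intro p1 p3 p5 p7 p9 u
    simp [spinPoly3, Fin.sum_univ_five]
    ring
  · intro p1 p3 p5 p7 p9
    simp [spinPoly3, Fin.sum_univ_five, lowerMoment]
    ring

theorem sum_lowerPart_spinPoly5 {S : Finset ℕ} (h0 : 0 ∉ S) :
    ∑ m ∈ S.filter (fun m => m - 1 ∉ S), schurWeight (lowerPart S m) * evalPowerSums spinPoly5 (lowerPart S m) =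
      (powerSum 1 S - 5) * (schurWeight S * evalPowerSums spinPoly5 S) := by
  refine sum_lowerPart_eq h0 (fun p1 p3 p5 p7 p9 =>
    ![p5 - 10 * p1 * p3 + 50 / 3 * p1 ^ 3 + 85 / 3 * p3 - 100 * p1 ^ 2 + 184 * p1 - 120, 30 * p1
      - 90, -5, 0, 0]) ?_ ?_
  · intro p1 p3 p5 p7 p9 u
    simp [spinPoly5, Fin.sum_univ_five]
    ring
  · intro p1 p3 p5 p7 p9
    simp [spinPoly5, Fin.sum_univ_five, lowerMoment]
    ring

theorem sum_lowerPart_spinPoly7 {S : Finset ℕ} (h0 : 0 ∉ S) :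
    ∑ m ∈ S.filter (fun m => m - 1 ∉ S), schurWeight (lowerPart S m) * evalPowerSums spinPoly7 (lowerPart S m) =
      (powerSum 1 S - 7) * (schurWeight S * evalPowerSums spinPoly7 S) := by
  refine sum_lowerPart_eq h0 (fun p1 p3 p5 p7 p9 =>
    ![p7 - 7 * p3 ^ 2 - 14 * p1 * p5 + 98 * p1 ^ 2 * p3 - 343 / 3 * p1 ^ 4 + 91 * p5 - 2450 / 3
      * p1 * p3 + 1372 * p1 ^ 3 + 1442 * p3 - 5292 * p1 ^ 2 + 8280 * p1 - 5040, 42 * p3 -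
      294 * p1 ^ 2 + 2520 * p1 - 4788, 70 * p1 - 532, -7, 0]) ?_ ?_
  · intro p1 p3 p5 p7 p9 u
    simp [spinPoly7, Fin.sum_univ_five]
    ring
  · intro p1 p3 p5 p7 p9
    simp [spinPoly7, Fin.sum_univ_five, lowerMoment]
    ring

theorem sum_lowerPart_spinPoly9 {S : Finset ℕ} (h0 : 0 ∉ S) :
    ∑ m ∈ S.filter (fun m => m - 1 ∉ S), schurWeight (lowerPart S m) * evalPowerSums spinPoly9 (lowerPart S m) =
      (powerSum 1 S - 9) * (schurWeight S * evalPowerSums spinPoly9 S) := by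
  refine sum_lowerPart_eq h0 (fun p1 p3 p5 p7 p9 =>
    ![p9 - 18 * p3 * p5 - 18 * p1 * p7 + 162 * p1 * p3 ^ 2 + 162 * p1 ^ 2 * p5 - 972 * p1 ^ 3 *
      p3 + 4374 / 5 * p1 ^ 5 + 240 * p7 - 1188 * p3 ^ 2 - 2862 * p1 * p5 + 17010 * p1 ^ 2
      * p3 - 18954 * p1 ^ 4 + 50991 / 5 * p5 - 84132 * p1 * p3 + 138672 * p1 ^ 3 + 117656
      * p3 - 434880 * p1 ^ 2 + 620928 * p1 - 362880, 54 * p5 - 972 * p1 * p3 + 2916 * p1 ^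
      3 + 7218 * p3 - 51840 * p1 ^ 2 + 266832 * p1 - 405648, 90 * p3 - 810 * p1 ^ 2 +
      16020 * p1 - 65340, 126 * p1 - 1980, -9]) ?_ ?_
  · intro p1 p3 p5 p7 p9 u
    simp [spinPoly9, Fin.sum_univ_five]
    ring
  · intro p1 p3 p5 p7 p9
    simp [spinPoly9, Fin.sum_univ_five, lowerMoment]
    ring

theorem sum_lowerPart_one {S : Finset ℕ} (h0 : 0 ∉ S) :
    ∑ m ∈ S.filter (fun m => m - 1 ∉ S), schurWeight (lowerPart S m) *
      evalPowerSums (fun _ _ _ _ _ => 1) (lowerPart S m) =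
      (powerSum 1 S - 0) * (schurWeight S * evalPowerSums (fun _ _ _ _ _ => 1) S) := by
  refine sum_lowerPart_eq h0 (fun _ _ _ _ _ => ![1, 0, 0, 0, 0]) ?_ ?_
  · intro p1 p3 p5 p7 p9 u
    simp [Fin.sum_univ_five]
  · intro p1 p3 p5 p7 p9
    simp [Fin.sum_univ_five, lowerMoment]

end Harmonic

/-! ### Spin characters as polynomials in power sums -/

section Characters

open Finset

theorem powerSum_one_of_mem {n : ℕ} {S : Finset ℕ} (hS : S ∈ strictSets n) :
    powerSum 1 S = n := by
  rw [← (mem_strictSets.1 hS).2, powerSum, Nat.cast_sum]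
  simp

theorem lowerPart_mem {n m : ℕ} {S : Finset ℕ} (hS : S ∈ strictSets (n + 1)) (hm : m ∈ S)
    (hm' : m - 1 ∉ S) : lowerPart S m ∈ strictSets n := by
  obtain ⟨h0, h1⟩ := mem_strictSets.1 hS
  have h2 : m ≠ 0 := fun h => h0 (h ▸ hm)
  have h3 := sum_lowerPart hm hm' (F := fun a => a) rfl
  refine mem_strictSets.2 ⟨by simp [lowerPart], ?_⟩
  omega

/-- The identity satisfied by a normalized character `𝔭_r` under averaging over the diagrams
obtained by removing a box. -/
def IsLowering (r : ℕ) (f : ℚ → ℚ → ℚ → ℚ → ℚ → ℚ) : Prop :=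
  ∀ S : Finset ℕ, 0 ∉ S → ∑ m ∈ S.filter (fun m => m - 1 ∉ S),
    schurWeight (lowerPart S m) * evalPowerSums f (lowerPart S m) =
      (powerSum 1 S - r) * (schurWeight S * evalPowerSums f S)

/-- Induction on n: the left side of the lowering identity vanishes, and n - r and the weight are
nonzero. This matches the convention that 𝔭_r is 0 for r > n. -/
theorem IsLowering.eq_zero {r : ℕ} {f : ℚ → ℚ → ℚ → ℚ → ℚ → ℚ} (hf : IsLowering r f)
    (h0 : f 0 0 0 0 0 = 0) {n : ℕ} (hn : n < r) {S : Finset ℕ} (hS : S ∈ strictSets n) :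
    evalPowerSums f S = 0 := by
  induction n generalizing S with
  | zero =>
    obtain ⟨h1, h2⟩ := mem_strictSets.1 hS
    have h3 : S = ∅ := by
      refine eq_empty_of_forall_notMem fun a ha => h1 ?_
      rwa [← (sum_eq_zero_iff.1 h2) a ha]
    simpa [h3, evalPowerSums, powerSum] using h0
  | succ n ih =>
    have h1 := hf S (mem_strictSets.1 hS).1
    rw [sum_eq_zero, powerSum_one_of_mem hS] at h1
    · have h2 : (((n + 1 : ℕ) : ℚ) - r) ≠ 0 := sub_ne_zero.2 (by exact_mod_cast hn.ne)
      have h3 := (mul_eq_zero.1 h1.symm).resolve_left h2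
      exact (mul_eq_zero.1 h3).resolve_left schurWeight_pos.ne'
    · intro m hm
      obtain ⟨hm1, hm2⟩ := mem_filter.1 hm
      rw [ih (by omega) (lowerPart_mem hS hm1 hm2), mul_zero]

/-- Each multiplication by p₁ sums the coefficients over removable boxes; in degree r + d + 1 the
lowering identity turns this into the factor d + 1, and these factors accumulate to d!. -/
theorem IsLowering.expansion {r : ℕ} {f : ℚ → ℚ → ℚ → ℚ → ℚ → ℚ} (hf : IsLowering r f)
    {K ι : Type*} [Field K] [CharZero K] [Fintype ι] [DecidableEq ι] {x : ι → K}
    (hx : Function.Injective x) {y : K}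
    (hy : y = ∑ S ∈ strictSets r, ((schurWeight S * evalPowerSums f S : ℚ) : K) * schurPSet x S)
    (d : ℕ) :
    y * (∑ a, x a) ^ d = ∑ S ∈ strictSets (r + d),
      ((d.factorial * (schurWeight S * evalPowerSums f S) : ℚ) : K) * schurPSet x S := by
  induction d with
  | zero => simpa using hy
  | succ d ih =>
    rw [pow_succ', mul_left_comm, ih, sum_mul_sum_schurPSet hx]
    refine sum_congr rfl fun S hS => ?_
    congr 1
    rw [← Rat.cast_sum, ← mul_sum, hf S (mem_strictSets.1 hS).1, powerSum_one_of_mem hS,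
      Nat.factorial_succ]
    congr 1
    push_cast
    ring

theorem strictMono_pair {b c : ℕ} (h : b < c) : StrictMono ![b, c] := by
  intro i j hij
  fin_cases i <;> fin_cases j <;> simp_all

/-! ### Expansions of p₁, p₃, p₅, p₇, p₉ in P-functions. -/

section Base

variable {K ι : Type*} [Field K] [Fintype ι] [DecidableEq ι] (x : ι → K)

theorem schurPSet_singleton (r : ℕ) : schurPSet x {r} = schurPEval x ![r] :=
  schurPSet_image x (fun i j hij => absurd hij (by rw [Subsingleton.elim i j]; exact lt_irrefl _))
    (by ext; simp)

theorem schurPSet_pair {b c : ℕ} (h : b < c) : schurPSet x {b, c} = schurPEval x ![b, c] :=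
  schurPSet_image x (strictMono_pair h) (by ext; simp [Fin.exists_fin_two, eq_comm])

theorem strictSets_one : strictSets 1 = {{1}} := by decide +kernel

theorem strictSets_three : strictSets 3 = {{3}, {1, 2}} := by decide +kernel

theorem strictSets_five : strictSets 5 = {{5}, {1, 4}, {2, 3}} := by decide +kernel

theorem strictSets_seven : strictSets 7 = {{7}, {1, 6}, {2, 5}, {3, 4}, {1, 2, 4}} := by
  decide +kernel

theorem strictSets_nine : strictSets 9 =
    {{9}, {1, 8}, {2, 7}, {3, 6}, {4, 5}, {1, 2, 6}, {1, 3, 5}, {2, 3, 4}} := by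
  decide +kernel

variable {x} [CharZero K]

theorem psum_one_expansion (hx : Function.Injective x) (hs : ∀ a b, x a + x b ≠ 0) :
    ∑ i, x i ^ 1 = ∑ S ∈ strictSets 1,
    ((schurWeight S * evalPowerSums spinPoly1 S : ℚ) : K) * schurPSet x S := by
  rw [strictSets_one, sum_singleton, schurPSet_singleton]
  have h := odd_psum_eq hx hs 0
  have c1 : schurWeight {1} * evalPowerSums spinPoly1 {1} = 1 := by
    norm_num [schurWeight, evalPowerSums, spinPoly1, powerSum]
  rw [c1]
  simpa using h

theorem psum_three_expansion (hx : Function.Injective x) (hs : ∀ a b, x a + x b ≠ 0) :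
    ∑ i, x i ^ 3 = ∑ S ∈ strictSets 3,
      ((schurWeight S * evalPowerSums spinPoly3 S : ℚ) : K) * schurPSet x S := by
  have c1 : schurWeight {3} * evalPowerSums spinPoly3 {3} = 1 := by
    norm_num [schurWeight, evalPowerSums, spinPoly3, powerSum, Nat.factorial]
  have c2 : schurWeight {1, 2} * evalPowerSums spinPoly3 {1, 2} = -2 := by
    norm_num [schurWeight, evalPowerSums, spinPoly3, powerSum, Nat.factorial]
  have h := odd_psum_eq hx hs 1
  simp only [sum_range_succ, sum_range_zero] at h
  rw [strictSets_three]
  iterate 1 rw [sum_insert (by decide)]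
  rw [sum_singleton, c1, c2, schurPSet_singleton,
    schurPSet_pair x (by norm_num)]
  norm_num at h ⊢
  rw [h]

theorem psum_five_expansion (hx : Function.Injective x) (hs : ∀ a b, x a + x b ≠ 0) :
    ∑ i, x i ^ 5 = ∑ S ∈ strictSets 5,
      ((schurWeight S * evalPowerSums spinPoly5 S : ℚ) : K) * schurPSet x S := by
  have c1 : schurWeight {5} * evalPowerSums spinPoly5 {5} = 1 := by
    norm_num [schurWeight, evalPowerSums, spinPoly5, powerSum, Nat.factorial]
  have c2 : schurWeight {1, 4} * evalPowerSums spinPoly5 {1, 4} = -2 := by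
    norm_num [schurWeight, evalPowerSums, spinPoly5, powerSum, Nat.factorial]
  have c3 : schurWeight {2, 3} * evalPowerSums spinPoly5 {2, 3} = 2 := by
    norm_num [schurWeight, evalPowerSums, spinPoly5, powerSum, Nat.factorial]
  have h := odd_psum_eq hx hs 2
  simp only [sum_range_succ, sum_range_zero] at h
  rw [strictSets_five]
  iterate 2 rw [sum_insert (by decide)]
  rw [sum_singleton, c1, c2, c3, schurPSet_singleton,
    schurPSet_pair x (by norm_num),
    schurPSet_pair x (by norm_num)]
  norm_num at h ⊢
  rw [h]

theorem psum_seven_expansion (hx : Function.Injective x) (hs : ∀ a b, x a + x b ≠ 0) :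
    ∑ i, x i ^ 7 = ∑ S ∈ strictSets 7,
      ((schurWeight S * evalPowerSums spinPoly7 S : ℚ) : K) * schurPSet x S := by
  have c1 : schurWeight {7} * evalPowerSums spinPoly7 {7} = 1 := by
    norm_num [schurWeight, evalPowerSums, spinPoly7, powerSum, Nat.factorial]
  have c2 : schurWeight {1, 6} * evalPowerSums spinPoly7 {1, 6} = -2 := by
    norm_num [schurWeight, evalPowerSums, spinPoly7, powerSum, Nat.factorial]
  have c3 : schurWeight {2, 5} * evalPowerSums spinPoly7 {2, 5} = 2 := by
    norm_num [schurWeight, evalPowerSums, spinPoly7, powerSum, Nat.factorial]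
  have c4 : schurWeight {3, 4} * evalPowerSums spinPoly7 {3, 4} = -2 := by
    norm_num [schurWeight, evalPowerSums, spinPoly7, powerSum, Nat.factorial]
  -- A partition with three parts does not occur in `odd_psum_eq`, so `spinPoly7` has to vanish on
  -- it.
  have c5 : schurWeight {1, 2, 4} * evalPowerSums spinPoly7 {1, 2, 4} = 0 := by
    norm_num [schurWeight, evalPowerSums, spinPoly7, powerSum, Nat.factorial]
  have h := odd_psum_eq hx hs 3
  simp only [sum_range_succ, sum_range_zero] at h
  rw [strictSets_seven]
  iterate 4 rw [sum_insert (by decide)]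
  rw [sum_singleton, c1, c2, c3, c4, c5, schurPSet_singleton,
    schurPSet_pair x (by norm_num),
    schurPSet_pair x (by norm_num),
    schurPSet_pair x (by norm_num)]
  norm_num at h ⊢
  rw [h]
  ring

theorem psum_nine_expansion (hx : Function.Injective x) (hs : ∀ a b, x a + x b ≠ 0) :
    ∑ i, x i ^ 9 = ∑ S ∈ strictSets 9,
      ((schurWeight S * evalPowerSums spinPoly9 S : ℚ) : K) * schurPSet x S := by
  have c1 : schurWeight {9} * evalPowerSums spinPoly9 {9} = 1 := by
    norm_num [schurWeight, evalPowerSums, spinPoly9, powerSum, Nat.factorial]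
  have c2 : schurWeight {1, 8} * evalPowerSums spinPoly9 {1, 8} = -2 := by
    norm_num [schurWeight, evalPowerSums, spinPoly9, powerSum, Nat.factorial]
  have c3 : schurWeight {2, 7} * evalPowerSums spinPoly9 {2, 7} = 2 := by
    norm_num [schurWeight, evalPowerSums, spinPoly9, powerSum, Nat.factorial]
  have c4 : schurWeight {3, 6} * evalPowerSums spinPoly9 {3, 6} = -2 := by
    norm_num [schurWeight, evalPowerSums, spinPoly9, powerSum, Nat.factorial]
  have c5 : schurWeight {4, 5} * evalPowerSums spinPoly9 {4, 5} = 2 := by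
    norm_num [schurWeight, evalPowerSums, spinPoly9, powerSum, Nat.factorial]
  have c6 : schurWeight {1, 2, 6} * evalPowerSums spinPoly9 {1, 2, 6} = 0 := by
    norm_num [schurWeight, evalPowerSums, spinPoly9, powerSum, Nat.factorial]
  have c7 : schurWeight {1, 3, 5} * evalPowerSums spinPoly9 {1, 3, 5} = 0 := by
    norm_num [schurWeight, evalPowerSums, spinPoly9, powerSum, Nat.factorial]
  have c8 : schurWeight {2, 3, 4} * evalPowerSums spinPoly9 {2, 3, 4} = 0 := by
    norm_num [schurWeight, evalPowerSums, spinPoly9, powerSum, Nat.factorial]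
  have h := odd_psum_eq hx hs 4
  simp only [sum_range_succ, sum_range_zero] at h
  rw [strictSets_nine]
  iterate 7 rw [sum_insert (by decide)]
  rw [sum_singleton, c1, c2, c3, c4, c5, c6, c7, c8, schurPSet_singleton,
    schurPSet_pair x (by norm_num),
    schurPSet_pair x (by norm_num),
    schurPSet_pair x (by norm_num),
    schurPSet_pair x (by norm_num)]
  norm_num at h ⊢
  rw [h]
  ring

end Base

theorem psumPart_addOnes {k n N : ℕ} (ρ : k.Partition) (h : k ≤ n) :
    MvPolynomial.psumPart (Fin N) ℚ (addOnes ρ h) =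
      MvPolynomial.psumPart (Fin N) ℚ ρ * MvPolynomial.psum (Fin N) ℚ 1 ^ (n - k) := by
  simp [MvPolynomial.psumPart, addOnes]

theorem algebraMap_psum (N k : ℕ) : algebraMap (MvPolynomial (Fin N) ℚ)
    (FractionRing (MvPolynomial (Fin N) ℚ)) (MvPolynomial.psum (Fin N) ℚ k) =
      ∑ a, fracX N a ^ k := by
  simp [MvPolynomial.psum, fracX]

theorem spinX_indiscrete {r : ℕ} (hr : r ≠ 0) {f : ℚ → ℚ → ℚ → ℚ → ℚ → ℚ} (hf : IsLowering r f)
    (hb : ∀ N, ∑ a, fracX N a ^ r = ∑ S ∈ strictSets r,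
      ((schurWeight S * evalPowerSums f S : ℚ) : FractionRing (MvPolynomial (Fin N) ℚ)) *
        schurPSet (fracX N) S) {n : ℕ} (μ : StrictPartition n) (h : r ≤ n) :
    spinX μ (addOnes (Nat.Partition.indiscrete r) h) =
      (n - r).factorial * (schurWeight μ.partSet * evalPowerSums f μ.partSet) := by
  refine spinX_eq (C := fun S => (n - r).factorial * (schurWeight S * evalPowerSums f S))
    (fun N => ?_) μ
  have h1 := hf.expansion (fracX_injective N) (hb N) (n - r)
  rw [Nat.add_sub_cancel' h] at h1
  have h2 : MvPolynomial.psumPart (Fin N) ℚ (Nat.Partition.indiscrete r) =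
      MvPolynomial.psum (Fin N) ℚ r := by
    simp [MvPolynomial.psumPart, hr]
  rw [psumPart_addOnes, map_mul, map_pow, h2, algebraMap_psum, algebraMap_psum, ← h1]
  simp

/-- The product formula for g^λ: the expansion argument with r = 0 and f = 1, starting from P_∅ = 1.
-/
theorem spinX_one {n : ℕ} (μ : StrictPartition n) :
    spinX μ (addOnes (Nat.Partition.indiscrete 0) (Nat.zero_le n)) =
      n.factorial * schurWeight μ.partSet := by
  refine spinX_eq (C := fun S => n.factorial * schurWeight S) (fun N => ?_) μ
  have h0 : strictSets 0 = {∅} := by decide +kernel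
  have h1 : IsLowering 0 fun _ _ _ _ _ => 1 := fun S hS => by
    rw [sum_lowerPart_one hS, Nat.cast_zero]
  have h2 := h1.expansion (fracX_injective N) (y := 1) (by
    rw [h0, sum_singleton, ← image_empty (Fin.elim0 : Fin 0 → ℕ), ← univ_eq_empty,
      schurPSet_image (fracX N) (γ := Fin.elim0) (fun i => i.elim0) rfl]
    simp [schurWeight, evalPowerSums, schurPEval, schurKernel, pairFactor]) n
  rw [psumPart_addOnes, map_mul, map_pow, algebraMap_psum]
  simpa [evalPowerSums, MvPolynomial.psumPart] using h2

theorem spinCharacter_eq {r : ℕ} (hr : r ≠ 0) {f : ℚ → ℚ → ℚ → ℚ → ℚ → ℚ} (hf : IsLowering r f)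
    (h0 : f 0 0 0 0 0 = 0) (hb : ∀ N, ∑ a, fracX N a ^ r = ∑ S ∈ strictSets r,
      ((schurWeight S * evalPowerSums f S : ℚ) : FractionRing (MvPolynomial (Fin N) ℚ)) *
        schurPSet (fracX N) S) {n : ℕ} (μ : StrictPartition n) :
    spinCharacter (Nat.Partition.indiscrete r) μ = evalPowerSums f μ.partSet := by
  rw [spinCharacter]
  split_ifs with h
  · rw [spinX_indiscrete hr hf hb, spinX_one, ← Nat.factorial_mul_descFactorial h]
    have h1 : ((n - r).factorial : ℚ) ≠ 0 := by positivity
    have h2 : (n.descFactorial r : ℚ) ≠ 0 := by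
      exact_mod_cast (Nat.descFactorial_pos.2 h).ne'
    have h3 := (schurWeight_pos (S := μ.partSet)).ne'
    push_cast
    field_simp
  · exact (hf.eq_zero h0 (not_le.1 h) μ.partSet_mem).symm

theorem spinCharacter_one {n : ℕ} (μ : StrictPartition n) :
    spinCharacter (Nat.Partition.indiscrete 1) μ = evalPowerSums spinPoly1 μ.partSet :=
  spinCharacter_eq (by norm_num) (fun _ hS => by simpa using sum_lowerPart_spinPoly1 hS)
    (by simp [spinPoly1])
    (fun N => psum_one_expansion (fracX_injective N) (fracX_add_ne_zero N)) μ

theorem spinCharacter_three {n : ℕ} (μ : StrictPartition n) :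
    spinCharacter (Nat.Partition.indiscrete 3) μ = evalPowerSums spinPoly3 μ.partSet :=
  spinCharacter_eq (by norm_num) (fun _ hS => by simpa using sum_lowerPart_spinPoly3 hS)
    (by simp [spinPoly3])
    (fun N => psum_three_expansion (fracX_injective N) (fracX_add_ne_zero N)) μ

theorem spinCharacter_five {n : ℕ} (μ : StrictPartition n) :
    spinCharacter (Nat.Partition.indiscrete 5) μ = evalPowerSums spinPoly5 μ.partSet :=
  spinCharacter_eq (by norm_num) (fun _ hS => by simpa using sum_lowerPart_spinPoly5 hS)
    (by simp [spinPoly5])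
    (fun N => psum_five_expansion (fracX_injective N) (fracX_add_ne_zero N)) μ

theorem spinCharacter_seven {n : ℕ} (μ : StrictPartition n) :
    spinCharacter (Nat.Partition.indiscrete 7) μ = evalPowerSums spinPoly7 μ.partSet :=
  spinCharacter_eq (by norm_num) (fun _ hS => by simpa using sum_lowerPart_spinPoly7 hS)
    (by simp [spinPoly7])
    (fun N => psum_seven_expansion (fracX_injective N) (fracX_add_ne_zero N)) μ

theorem spinCharacter_nine {n : ℕ} (μ : StrictPartition n) :
    spinCharacter (Nat.Partition.indiscrete 9) μ = evalPowerSums spinPoly9 μ.partSet :=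
  spinCharacter_eq (by norm_num) (fun _ hS => by simpa using sum_lowerPart_spinPoly9 hS)
    (by simp [spinPoly9])
    (fun N => psum_nine_expansion (fracX_injective N) (fracX_add_ne_zero N)) μ

end Characters

/-! ### The profile of the double diagram -/

section Profile

open Finset

theorem sum_range_len {M : Type*} [AddCommMonoid M] {n : ℕ} (μ : StrictPartition n) (F : ℕ → M) :
    ∑ i ∈ range μ.len, F (μ.part i) = ∑ b ∈ μ.partSet, F b := by
  rw [← μ.image_part, sum_image μ.part_strictMono.injective.injOn, ← Equiv.sum_comp Fin.revPerm,
    ← Fin.sum_univ_eq_sum_range (fun i => F (μ.part i))]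
  simp

/-- The diagonal hook of a part b has exactly one cell of each content from -(b - 1) to b, so the
cells of content k correspond to the hooks that reach it. -/
theorem card_content {n : ℕ} (μ : StrictPartition n) (k : ℤ) :
    (μ.double.cells.filter fun c => (c.2 : ℤ) - (c.1 : ℤ) = k).card =
      (μ.partSet.filter fun b : ℕ => k ≤ b ∧ -k < b).card := by
  have hpos : ∀ i < μ.len, 0 < μ.part i := by
    intro i hi
    have h1 : μ.part i ∈ μ.partSet := by
      rw [← μ.image_part]
      exact mem_image.2 ⟨Fin.rev ⟨i, hi⟩, mem_univ _, by rw [Fin.rev_rev]⟩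
    exact μ.1.parts_pos (Multiset.mem_toFinset.1 h1)
  have h1 : (μ.partSet.filter fun b : ℕ => k ≤ b ∧ -k < b).card =
      ((range μ.len).filter fun i => k ≤ μ.part i ∧ -k < μ.part i).card := by
    rw [card_filter, card_filter, sum_range_len μ fun b => if k ≤ (b : ℤ) ∧ -k < b then 1 else 0]
  rw [h1]
  -- The smaller coordinate of a cell is the index of its diagonal hook.
  refine card_bij (fun c _ => min c.1 c.2) ?_ ?_ ?_
  · rintro ⟨i, j⟩ h
    obtain ⟨h2, h3⟩ := mem_filter.1 h
    have h4 := (μ.mem_doubleCells i j).1 h2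
    simp only at h3 ⊢
    rw [mem_filter, mem_range]
    rcases h4 with ⟨h5, h6, h7⟩ | ⟨h5, h6, h7⟩
    · rw [min_eq_left h5]
      have := hpos i h6
      omega
    · rw [min_eq_right h5]
      omega
  · rintro ⟨i, j⟩ h ⟨i', j'⟩ h' heq
    have h2 := (mem_filter.1 h).2
    have h3 := (mem_filter.1 h').2
    simp only at h2 h3 heq
    rw [Prod.mk.injEq]
    omega
  · intro i hi
    obtain ⟨h2, h3, h4⟩ := mem_filter.1 hi
    rw [mem_range] at h2
    rcases le_total 0 k with hk | hk
    · obtain ⟨m, rfl⟩ := Int.eq_ofNat_of_zero_le hk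
      refine ⟨(i, i + m), mem_filter.2 ⟨(μ.mem_doubleCells _ _).2 (Or.inl ⟨?_, h2, ?_⟩), ?_⟩, ?_⟩
      · omega
      · omega
      · simp
      · simp
    · obtain ⟨m, hm⟩ := Int.eq_ofNat_of_zero_le (neg_nonneg.2 hk)
      refine ⟨(i + m, i), mem_filter.2 ⟨(μ.mem_doubleCells _ _).2 (Or.inr ⟨?_, h2, ?_⟩), ?_⟩, ?_⟩
      · omega
      · omega
      · simp; omega
      · simp

theorem profile_double {n : ℕ} (μ : StrictPartition n) (k : ℤ) :
    profile μ.double k = |k| + 2 * ∑ b ∈ μ.partSet, if k ≤ (b : ℤ) ∧ -k < b then 1 else 0 := by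
  rw [profile, card_content, card_filter]
  push_cast
  rfl

/-- Passing from content k to k + 1 loses exactly the hook with part k, if there is one; each cell
has height 2, against the slope 1 of |u|. -/
theorem profile_double_succ_sub {n : ℕ} (μ : StrictPartition n) (k : ℕ) :
    profile μ.double (k + 1) - profile μ.double k = if k ∈ μ.partSet then -1 else 1 := by
  have h0 := (mem_strictSets.1 μ.partSet_mem).1
  rw [profile_double, profile_double]
  have h1 : ∑ b ∈ μ.partSet, (if (k : ℤ) ≤ (b : ℤ) ∧ -(k : ℤ) < b then (1 : ℤ) else 0) =
      ∑ b ∈ μ.partSet, (if (k + 1 : ℤ) ≤ (b : ℤ) ∧ -(k + 1 : ℤ) < b then (1 : ℤ) else 0) +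
        ∑ b ∈ μ.partSet, if k = b then 1 else 0 := by
    rw [← sum_add_distrib]
    refine sum_congr rfl fun b hb => ?_
    have : b ≠ 0 := fun h => h0 (h ▸ hb)
    split_ifs <;> omega
  rw [h1, sum_ite_eq, abs_of_nonneg (by positivity), abs_of_nonneg (by positivity)]
  split_ifs <;> ring

theorem profile_double_neg_sub {n : ℕ} (μ : StrictPartition n) (k : ℕ) :
    profile μ.double (-(k : ℤ) - 1) - profile μ.double (-(k : ℤ)) =
      if k + 1 ∈ μ.partSet then -1 else 1 := by
  have h0 := (mem_strictSets.1 μ.partSet_mem).1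
  rw [profile_double, profile_double]
  have h1 : ∑ b ∈ μ.partSet, (if -(k : ℤ) ≤ (b : ℤ) ∧ -(-(k : ℤ)) < b then (1 : ℤ) else 0) =
      ∑ b ∈ μ.partSet, (if -(k : ℤ) - 1 ≤ (b : ℤ) ∧ -(-(k : ℤ) - 1) < b then (1 : ℤ) else 0) +
        ∑ b ∈ μ.partSet, if k + 1 = b then 1 else 0 := by
    rw [← sum_add_distrib]
    refine sum_congr rfl fun b hb => ?_
    have : b ≠ 0 := fun h => h0 (h ▸ hb)
    split_ifs <;> omega
  rw [h1, sum_ite_eq, abs_of_nonpos (by omega), abs_of_nonpos (by omega)]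
  split_ifs <;> ring

/-- Together with its diagonal cell the arm of the hook has b + 1 cells. This keeps the extrema
inside the search interval of `minima` and `maxima`. -/
theorem card_double {n : ℕ} (μ : StrictPartition n) {b : ℕ} (hb : b ∈ μ.partSet) :
    b + 1 ≤ μ.double.card := by
  rw [← μ.image_part] at hb
  obtain ⟨i, -, hi⟩ := mem_image.1 hb
  have h : (range (b + 1)).image (fun s => ((i.rev : ℕ), (i.rev : ℕ) + s)) ⊆
      μ.double.cells := by
    intro c hc
    obtain ⟨s, hs, rfl⟩ := mem_image.1 hc
    refine (μ.mem_doubleCells _ _).2 (Or.inl ⟨by omega, (i.rev : Fin μ.len).2, ?_⟩)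
    have := mem_range.1 hs
    omega
  have h2 := card_le_card h
  rwa [card_image_of_injective _ (fun s t h => by simpa using h), card_range] at h2

/-- The slopes on the two sides of k decide. Positive k form the first family; the others are -b,
where b = 0 needs no part because the profile always rises from 0 to 1. -/
theorem mem_minima_double {n : ℕ} (μ : StrictPartition n) (k : ℤ) :
    k ∈ minima μ.double ↔ (∃ b ∈ μ.partSet, b + 1 ∉ μ.partSet ∧ (b : ℤ) + 1 = k) ∨
      ∃ b ∈ insert 0 μ.partSet, b + 1 ∉ μ.partSet ∧ -(b : ℤ) = k := by
  have h0 := (mem_strictSets.1 μ.partSet_mem).1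
  have hprof : (profile μ.double k < profile μ.double (k - 1) ∧
      profile μ.double k < profile μ.double (k + 1)) ↔
      (∃ b ∈ μ.partSet, b + 1 ∉ μ.partSet ∧ (b : ℤ) + 1 = k) ∨
      ∃ b ∈ insert 0 μ.partSet, b + 1 ∉ μ.partSet ∧ -(b : ℤ) = k := by
    rcases lt_or_ge 0 k with hk | hk
    · obtain ⟨m, rfl⟩ : ∃ m : ℕ, k = m + 1 := ⟨(k - 1).toNat, by omega⟩
      have e1 := profile_double_succ_sub μ m
      have e2 := profile_double_succ_sub μ (m + 1)
      push_cast at e2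
      rw [add_sub_cancel_right]
      constructor
      · rintro ⟨h1, h2⟩
        refine Or.inl ⟨m, ?_, ?_, rfl⟩
        · by_contra h; rw [if_neg h] at e1; omega
        · intro h; rw [if_pos h] at e2; omega
      · rintro (⟨b, hb, hb', h⟩ | ⟨b, hb, hb', h⟩)
        · obtain rfl : b = m := by omega
          rw [if_pos hb] at e1
          rw [if_neg hb'] at e2
          omega
        · omega
    · obtain ⟨m, rfl⟩ : ∃ m : ℕ, k = -m := ⟨(-k).toNat, by omega⟩
      have e1 := profile_double_neg_sub μ m
      constructor
      · rintro ⟨h1, h2⟩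
        refine Or.inr ⟨m, ?_, ?_, rfl⟩
        · rcases m with _ | m
          · simp
          · have e2 := profile_double_neg_sub μ m
            rw [mem_insert]
            right
            by_contra h; rw [if_neg h] at e2
            push_cast at *
            rw [show -((m : ℤ) + 1) + 1 = -m by ring] at h2
            rw [show -(m : ℤ) - 1 = -(m + 1) by ring] at e2
            omega
        · intro h; rw [if_pos h] at e1; omega
      · rintro (⟨b, hb, hb', h⟩ | ⟨b, hb, hb', h⟩)
        · omega
        · obtain rfl : b = m := by omega
          rw [if_neg hb'] at e1
          refine ⟨by omega, ?_⟩
          -- At 0 the right neighbour is positive, so its slope comes from the formula for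
          -- nonnegative contents.
          rcases b with _ | m
          · have e2 := profile_double_succ_sub μ 0
            rw [if_neg h0] at e2
            simp at e2 ⊢
            omega
          · have e2 := profile_double_neg_sub μ m
            rw [if_pos ((mem_insert.1 hb).resolve_left (Nat.succ_ne_zero m))] at e2
            push_cast at *
            rw [show -((m : ℤ) + 1) + 1 = -m by ring]
            rw [show -(m : ℤ) - 1 = -(m + 1) by ring] at e2
            omega
  rw [minima, mem_filter, hprof, and_iff_right_iff_imp, mem_Icc]
  rintro (⟨b, hb, -, rfl⟩ | ⟨b, hb, -, rfl⟩)
  · have := card_double μ hb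
    omega
  · rcases mem_insert.1 hb with rfl | hb
    · simp
    · have := card_double μ hb
      omega

/-- As for the minima; `insert 0` excludes b = 1 from the second family, since the profile rises to
the right of 0. -/
theorem mem_maxima_double {n : ℕ} (μ : StrictPartition n) (k : ℤ) :
    k ∈ maxima μ.double ↔ (∃ b ∈ μ.partSet, b - 1 ∉ μ.partSet ∧ (b : ℤ) = k) ∨
      ∃ b ∈ μ.partSet, b - 1 ∉ insert 0 μ.partSet ∧ 1 - (b : ℤ) = k := by
  have h0 := (mem_strictSets.1 μ.partSet_mem).1
  have hprof : (profile μ.double (k - 1) < profile μ.double k ∧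
      profile μ.double (k + 1) < profile μ.double k) ↔
      (∃ b ∈ μ.partSet, b - 1 ∉ μ.partSet ∧ (b : ℤ) = k) ∨
      ∃ b ∈ μ.partSet, b - 1 ∉ insert 0 μ.partSet ∧ 1 - (b : ℤ) = k := by
    rcases lt_or_ge 0 k with hk | hk
    · obtain ⟨m, rfl⟩ : ∃ m : ℕ, k = m + 1 := ⟨(k - 1).toNat, by omega⟩
      have e1 := profile_double_succ_sub μ m
      have e2 := profile_double_succ_sub μ (m + 1)
      push_cast at e2
      rw [add_sub_cancel_right]
      constructor
      · rintro ⟨h1, h2⟩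
        refine Or.inl ⟨m + 1, ?_, ?_, by simp⟩
        · by_contra h; rw [if_neg h] at e2; omega
        · intro h; rw [Nat.add_sub_cancel] at h; rw [if_pos h] at e1; omega
      · rintro (⟨b, hb, hb', h⟩ | ⟨b, hb, hb', h⟩)
        · obtain rfl : b = m + 1 := by omega
          rw [if_pos hb] at e2
          rw [Nat.add_sub_cancel] at hb'
          rw [if_neg hb'] at e1
          omega
        · have : b ≠ 0 := fun h => h0 (h ▸ hb)
          omega
    · obtain ⟨m, rfl⟩ : ∃ m : ℕ, k = -m := ⟨(-k).toNat, by omega⟩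
      have e1 := profile_double_neg_sub μ m
      constructor
      · rintro ⟨h1, h2⟩
        refine Or.inr ⟨m + 1, ?_, ?_, by push_cast; ring⟩
        · by_contra h; rw [if_neg h] at e1; omega
        · rw [Nat.add_sub_cancel, mem_insert]
          rcases m with _ | m
          · have e2 := profile_double_succ_sub μ 0
            rw [if_neg h0] at e2
            simp at e2 h2
            omega
          · have e2 := profile_double_neg_sub μ m
            rintro (h | h)
            · omega
            · rw [if_pos h] at e2
              push_cast at *
              rw [show -((m : ℤ) + 1) + 1 = -m by ring] at h2
              rw [show -(m : ℤ) - 1 = -(m + 1) by ring] at e2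
              omega
      · rintro (⟨b, hb, hb', h⟩ | ⟨b, hb, hb', h⟩)
        · have : b ≠ 0 := fun h => h0 (h ▸ hb)
          omega
        · obtain rfl : b = m + 1 := by omega
          rw [if_pos hb] at e1
          refine ⟨by omega, ?_⟩
          rw [Nat.add_sub_cancel, mem_insert, not_or] at hb'
          rcases m with _ | m
          · exact absurd rfl hb'.1
          · have e2 := profile_double_neg_sub μ m
            rw [if_neg hb'.2] at e2
            push_cast at *
            rw [show -((m : ℤ) + 1) + 1 = -m by ring]
            rw [show -(m : ℤ) - 1 = -(m + 1) by ring] at e2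
            omega
  rw [maxima, mem_filter, hprof, and_iff_right_iff_imp, mem_Icc]
  rintro (⟨b, hb, -, rfl⟩ | ⟨b, hb, -, rfl⟩)
  · have := card_double μ hb
    omega
  · have := card_double μ hb
    omega

/-- The local extrema of the profile of the double, as a product formula: the Cauchy transform of
the transition measure is `z⁻¹ ∏ (z - b) (z - (1 - b)) / ((z - (b + 1)) (z + b))`. -/
theorem prod_minima_mul {M : Type*} [CommMonoid M] {n : ℕ} (μ : StrictPartition n) (h : ℤ → M) :
    (∏ x ∈ minima μ.double, h x) * ∏ b ∈ μ.partSet, (h b * h (1 - b)) =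
      h 0 * (∏ y ∈ maxima μ.double, h y) * ∏ b ∈ μ.partSet, (h (b + 1) * h (-b)) := by
  have h0 := (mem_strictSets.1 μ.partSet_mem).1
  set S := μ.partSet
  have hmin : minima μ.double = (S.filter fun b => b + 1 ∉ S).image (fun b : ℕ => (b : ℤ) + 1) ∪
      ((insert 0 S).filter fun b => b + 1 ∉ S).image (fun b : ℕ => -(b : ℤ)) := by
    ext k
    rw [mem_minima_double, mem_union, mem_image, mem_image]
    simp only [mem_filter, and_assoc]
    rfl
  have hmax : maxima μ.double = (S.filter fun b => b - 1 ∉ S).image (fun b : ℕ => (b : ℤ)) ∪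
      (S.filter fun b => b - 1 ∉ insert 0 S).image (fun b : ℕ => 1 - (b : ℤ)) := by
    ext k
    rw [mem_maxima_double, mem_union, mem_image, mem_image]
    simp only [mem_filter, and_assoc]
    rfl
  have hpos : ∀ b ∈ S, b ≠ 0 := fun b hb h => h0 (h ▸ hb)
  have d1 : Disjoint ((S.filter fun b => b + 1 ∉ S).image (fun b : ℕ => (b : ℤ) + 1))
      (((insert 0 S).filter fun b => b + 1 ∉ S).image (fun b : ℕ => -(b : ℤ))) := by
    rw [disjoint_left]
    intro k h1 h2
    obtain ⟨a, -, rfl⟩ := mem_image.1 h1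
    obtain ⟨b, -, h3⟩ := mem_image.1 h2
    omega
  have d2 : Disjoint ((S.filter fun b => b - 1 ∉ S).image (fun b : ℕ => (b : ℤ)))
      ((S.filter fun b => b - 1 ∉ insert 0 S).image (fun b : ℕ => 1 - (b : ℤ))) := by
    rw [disjoint_left]
    intro k h1 h2
    obtain ⟨a, ha, rfl⟩ := mem_image.1 h1
    obtain ⟨b, hb, h3⟩ := mem_image.1 h2
    have := hpos a (mem_filter.1 ha).1
    have := hpos b (mem_filter.1 hb).1
    omega
  rw [hmin, hmax, prod_union d1, prod_union d2, prod_image (fun a _ b _ h => by simpa using h),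
    prod_image (fun a _ b _ h => by simpa using h), prod_image (fun a _ b _ h => by simpa using h),
    prod_image (fun a _ b _ h => by simpa using h), prod_mul_distrib, prod_mul_distrib]
  -- Within a run of consecutive parts, candidate minima and candidate maxima coincide and cancel;
  -- this shift matches them.
  have shift (T : Finset ℕ) (F : ℕ → M) : ∏ b ∈ T.filter (fun b => b + 1 ∈ S), F (b + 1) =
      ∏ b ∈ S.filter (fun b => b - 1 ∈ T), F b := by
    refine prod_bij' (fun b _ => b + 1) (fun b _ => b - 1) ?_ ?_ ?_ ?_ ?_
    · intro b hb
      obtain ⟨h1, h2⟩ := mem_filter.1 hb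
      exact mem_filter.2 ⟨h2, by simpa using h1⟩
    · intro b hb
      obtain ⟨h1, h2⟩ := mem_filter.1 hb
      have := hpos b h1
      exact mem_filter.2 ⟨h2, by rwa [Nat.sub_add_cancel (by omega)]⟩
    · intro b hb; simp
    · intro b hb
      have := hpos b (mem_filter.1 hb).1
      omega
    · intro b hb; rfl
  have e1 := prod_filter_mul_prod_filter_not S (fun b => b + 1 ∈ S) (fun b : ℕ => h ((b : ℤ) + 1))
  have e2 := prod_filter_mul_prod_filter_not S (fun b => b - 1 ∈ S) (fun b : ℕ => h (b : ℤ))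
  have e3 := prod_filter_mul_prod_filter_not (insert 0 S) (fun b => b + 1 ∈ S)
    (fun b : ℕ => h (-(b : ℤ)))
  have e4 := prod_filter_mul_prod_filter_not S (fun b => b - 1 ∈ insert 0 S)
    (fun b : ℕ => h (1 - (b : ℤ)))
  have f1 := shift S (fun b => h b)
  have f2 := shift (insert 0 S) (fun b => h (1 - b))
  have f3 : ∏ b ∈ insert 0 S with b + 1 ∈ S, h (1 - ((b + 1 : ℕ) : ℤ)) =
      ∏ b ∈ insert 0 S with b + 1 ∈ S, h (-(b : ℤ)) :=
    prod_congr rfl fun b _ => by congr 1; push_cast; ring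
  rw [f3] at f2
  push_cast at f1
  rw [prod_insert h0] at e3
  simp only [Nat.cast_zero, neg_zero] at e3
  rw [f1] at e1
  rw [f2] at e3
  rw [← e1, ← e2, ← e4]
  set A := ∏ b ∈ S with b + 1 ∉ S, h ((b : ℤ) + 1)
  set B := ∏ b ∈ insert 0 S with b + 1 ∉ S, h (-(b : ℤ))
  set C := ∏ b ∈ S with b - 1 ∈ S, h (b : ℤ)
  set D := ∏ b ∈ S with b - 1 ∉ S, h (b : ℤ)
  set E := ∏ b ∈ S with b - 1 ∈ insert 0 S, h (1 - (b : ℤ))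
  set F := ∏ b ∈ S with b - 1 ∉ insert 0 S, h (1 - (b : ℤ))
  calc A * B * (C * D * (E * F)) = (C * A) * D * F * (E * B) := by ac_rfl
    _ = (C * A) * D * F * (h 0 * ∏ b ∈ S, h (-(b : ℤ))) := by rw [e3]
    _ = _ := by ac_rfl

end Profile

/-! ### The moments of the transition measure of the double -/

section Moments

open Finset

/-- The mass of the transition measure at the local minimum `x`. -/
def transitionMass (Y : YoungDiagram) (x : ℤ) : ℝ :=
  (∏ y ∈ maxima Y, ((x : ℝ) - (y : ℝ))) / ∏ x' ∈ (minima Y).erase x, ((x : ℝ) - (x' : ℝ))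

/-- To the right of a minimum there are as many minima as maxima modulo 2. It follows from
`prod_minima_mul` with signs as values, without ordering the extrema. -/
theorem prod_sign_minima {n : ℕ} (μ : StrictPartition n) {x : ℤ} (hx : x ∈ minima μ.double) :
    ∏ k ∈ minima μ.double, (if x < k then (-1 : ℝ) else 1) =
      ∏ k ∈ maxima μ.double, if x < k then (-1 : ℝ) else 1 := by
  have h0 := (mem_strictSets.1 μ.partSet_mem).1
  have h := prod_minima_mul μ (fun k => if x < k then (-1 : ℝ) else 1)
  have hP : ∏ b ∈ μ.partSet, ((if x < (b : ℤ) + 1 then (-1 : ℝ) else 1) *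
      if x < -(b : ℤ) then (-1 : ℝ) else 1) ≠ 0 := by
    refine prod_ne_zero_iff.2 fun b _ => ?_
    split_ifs <;> norm_num
  have h1 : ∏ b ∈ μ.partSet, ((if x < (b : ℤ) then (-1 : ℝ) else 1) *
      if x < 1 - (b : ℤ) then (-1 : ℝ) else 1) = (if x < 0 then (-1 : ℝ) else 1) *
      ∏ b ∈ μ.partSet, ((if x < (b : ℤ) + 1 then (-1 : ℝ) else 1) *
        if x < -(b : ℤ) then (-1 : ℝ) else 1) := by
    rcases (mem_minima_double μ x).1 hx with ⟨a, ha, ha', rfl⟩ | ⟨a, ha, ha', rfl⟩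
    · rw [if_neg (by omega), one_mul]
      refine prod_congr rfl fun b hb => ?_
      have : b ≠ a + 1 := fun h => ha' (h ▸ hb)
      congr 1
      · congr 1
        rw [eq_iff_iff]
        omega
      · rw [if_neg (by omega), if_neg (by omega)]
    · rcases mem_insert.1 ha with rfl | ha
      · rw [if_neg (by simp), one_mul]
        refine prod_congr rfl fun b hb => ?_
        have : b ≠ 0 := fun h => h0 (h ▸ hb)
        congr 1
        · congr 1
          rw [eq_iff_iff]
          omega
        · rw [if_neg (by omega), if_neg (by omega)]
      · have ha0 : a ≠ 0 := fun h => h0 (h ▸ ha)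
        rw [if_pos (by omega)]
        -- At x = -a only the pair of signs of the part b = a changes, which accounts for the sign
        -- at 0.
        have h2 (P : ℝ) : -1 * P = (∏ b ∈ μ.partSet, if a = b then -1 else 1) * P := by
          rw [prod_ite_eq, if_pos ha]
        rw [h2, ← prod_mul_distrib]
        refine prod_congr rfl fun b hb => ?_
        have hb0 : b ≠ 0 := fun h => h0 (h ▸ hb)
        split_ifs <;> first | omega | norm_num
  rw [h1] at h
  have h3 : (if x < 0 then (-1 : ℝ) else 1) ≠ 0 := by split_ifs <;> norm_num
  rw [mul_left_comm, mul_assoc] at h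
  exact mul_right_cancel₀ hP (mul_left_cancel₀ h3 h)

/-- Nonnegativity is needed because `ENNReal.ofReal` would truncate a negative mass to 0. -/
theorem transitionMass_nonneg {n : ℕ} (μ : StrictPartition n) {x : ℤ}
    (hx : x ∈ minima μ.double) : 0 ≤ transitionMass μ.double x := by
  have h1 (k : ℤ) : (x : ℝ) - k = (if x < k then (-1 : ℝ) else 1) * |(x : ℝ) - k| := by
    split_ifs with h
    · have : (x : ℝ) < k := by exact_mod_cast h
      rw [abs_of_neg (by linarith)]; ring
    · have : (k : ℝ) ≤ x := by exact_mod_cast not_lt.1 h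
      rw [abs_of_nonneg (by linarith)]; ring
  have h2 : ∏ k ∈ (minima μ.double).erase x, (if x < k then (-1 : ℝ) else 1) =
      ∏ k ∈ maxima μ.double, if x < k then (-1 : ℝ) else 1 := by
    rw [← prod_sign_minima μ hx, ← mul_prod_erase _ _ hx, if_neg (lt_irrefl x), one_mul]
  have h3 : ∏ k ∈ maxima μ.double, (if x < k then (-1 : ℝ) else 1) ≠ 0 :=
    prod_ne_zero_iff.2 fun b _ => by split_ifs <;> norm_num
  rw [transitionMass, prod_congr rfl fun k _ => h1 k,
    prod_congr (s₁ := (minima μ.double).erase x) rfl fun k _ => h1 k, prod_mul_distrib,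
    prod_mul_distrib, h2, mul_div_mul_left _ _ h3]
  exact div_nonneg (prod_nonneg fun _ _ => abs_nonneg _) (prod_nonneg fun _ _ => abs_nonneg _)

theorem integral_pow_transitionMeasure {n : ℕ} (μ : StrictPartition n) (k : ℕ) :
    ∫ x, x ^ k ∂(transitionMeasure μ.double) =
      ∑ x ∈ minima μ.double, transitionMass μ.double x * (x : ℝ) ^ k := by
  rw [transitionMeasure, integral_finsetSum_measure]
  · refine sum_congr rfl fun x hx => ?_
    rw [integral_smul_measure, integral_dirac]
    change (ENNReal.ofReal (transitionMass μ.double x)).toReal • (x : ℝ) ^ k = _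
    rw [ENNReal.toReal_ofReal (transitionMass_nonneg μ hx), smul_eq_mul]
  · intro x hx
    exact Integrable.smul_measure (integrable_dirac (by simp)) ENNReal.ofReal_ne_top

/-- The product formula with constant value 2 compares the cardinalities as exponents. -/
theorem card_maxima_add_one {n : ℕ} (μ : StrictPartition n) :
    (maxima μ.double).card + 1 = (minima μ.double).card := by
  have h := prod_minima_mul μ (fun _ => 2)
  simp only [prod_const] at h
  have h2 : 2 ^ (minima μ.double).card = 2 ^ ((maxima μ.double).card + 1) := by
    rw [pow_succ', Nat.eq_of_mul_eq_mul_right (by positivity) h]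
  exact (Nat.pow_right_injective le_rfl h2).symm

theorem momentSeries_transitionMeasure {n : ℕ} (μ : StrictPartition n) :
    momentSeries (transitionMeasure μ.double) = ∏ b ∈ μ.partSet,
      ((((1 - Polynomial.C (b : ℝ) * Polynomial.X : Polynomial ℝ) : PowerSeries ℝ) *
        ((1 - Polynomial.C (1 - b : ℝ) * Polynomial.X : Polynomial ℝ) : PowerSeries ℝ)) *
        (PowerSeries.mk (fun k => (b + 1 : ℝ) ^ k) * PowerSeries.mk (fun k => (-b : ℝ) ^ k))) := by
  set h : ℤ → PowerSeries ℝ := fun k =>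
    ((1 - Polynomial.C (k : ℝ) * Polynomial.X : Polynomial ℝ) : PowerSeries ℝ) with hh
  set g : ℤ → PowerSeries ℝ := fun k => PowerSeries.mk (fun j => (k : ℝ) ^ j) with hg
  have hgh (k : ℤ) : h k * g k = 1 := coe_one_sub_mul_mk (k : ℝ)
  have h1 : momentSeries (transitionMeasure μ.double) =
      (∏ y ∈ maxima μ.double, h y) * ∏ x ∈ minima μ.double, g x := by
    ext k
    have h2 := prod_one_sub_mul_prod_mk_of_card (s := minima μ.double) (u := fun x : ℤ => (x : ℝ))
      (fun a _ b _ h => by simpa using h) (fun y : ℤ => (y : ℝ)) (maxima μ.double)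
      (card_maxima_add_one μ) k
    rw [← Polynomial.coeToPowerSeries.ringHom_apply, map_prod] at h2
    simp only [Polynomial.coeToPowerSeries.ringHom_apply] at h2
    rw [h2, momentSeries, PowerSeries.coeff_mk, integral_pow_transitionMeasure]
    rfl
  have h3 := prod_minima_mul μ h
  -- The pole of the Cauchy transform at z = 0 contributes the trivial factor 1 - 0·t.
  have h4 : h 0 = 1 := by simp [hh]
  rw [h4, one_mul] at h3
  have h5 : (∏ x ∈ minima μ.double, h x) * ∏ x ∈ minima μ.double, g x = 1 := by
    rw [← prod_mul_distrib, prod_eq_one fun x _ => hgh x]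
  have h6 : (∏ b ∈ μ.partSet, (h (b + 1) * h (-b))) * ∏ b ∈ μ.partSet, (g (b + 1) * g (-b)) = 1 := by
    rw [← prod_mul_distrib]
    refine prod_eq_one fun b _ => ?_
    rw [mul_mul_mul_comm, hgh, hgh, one_mul]
  have h7 : momentSeries (transitionMeasure μ.double) = (∏ b ∈ μ.partSet, (h b * h (1 - b))) *
      ∏ b ∈ μ.partSet, (g (b + 1) * g (-b)) := by
    rw [h1]
    set A := ∏ y ∈ maxima μ.double, h y
    set B := ∏ x ∈ minima μ.double, g x
    set D := ∏ b ∈ μ.partSet, (h b * h (1 - b))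
    set E := ∏ b ∈ μ.partSet, (g (b + 1) * g (-b))
    linear_combination (-A * B) * h6 + D * E * h5 - B * E * h3
  rw [h7, ← prod_mul_distrib]
  simp [hh, hg]

/-- The power sums that govern the logarithmic derivative of the moment series. -/
def momentLogDeriv (S : Finset ℕ) (k : ℕ) : ℝ :=
  ∑ b ∈ S, (((b : ℝ) + 1) ^ k + (-b) ^ k - b ^ k - (1 - b) ^ k)

theorem hasLogDeriv_momentSeries {n : ℕ} (μ : StrictPartition n) :
    HasLogDeriv (momentSeries (transitionMeasure μ.double)) (momentLogDeriv μ.partSet) := by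
  rw [momentSeries_transitionMeasure]
  have h := HasLogDeriv.prod μ.partSet fun b : ℕ => ((hasLogDeriv_one_sub (b : ℝ)).mul
    (hasLogDeriv_one_sub (1 - b : ℝ))).mul ((hasLogDeriv_mk_pow (b + 1 : ℝ)).mul
      (hasLogDeriv_mk_pow (-b : ℝ)))
  convert h using 1
  funext k
  refine sum_congr rfl fun b _ => ?_
  split_ifs with hk
  · simp [hk]
  · ring

theorem coeff_zero_momentSeries {n : ℕ} (μ : StrictPartition n) :
    PowerSeries.coeff 0 (momentSeries (transitionMeasure μ.double)) = 1 := by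
  rw [momentSeries_transitionMeasure, PowerSeries.coeff_zero_eq_constantCoeff_apply, map_prod]
  refine prod_eq_one fun b _ => ?_
  simp only [map_mul, ← PowerSeries.coeff_zero_eq_constantCoeff_apply]
  simp

theorem HasLogDeriv.pow {K : Type*} [Field K] {E : PowerSeries K} {s : ℕ → K}
    (h : HasLogDeriv E s) (d : ℕ) : HasLogDeriv (E ^ d) fun k => d * s k := by
  have h1 := HasLogDeriv.prod (range d) fun _ => h
  simpa using h1

theorem freeCumulant_eq (m : Measure ℝ) (n : ℕ) :
    freeCumulant m n = PowerSeries.coeff n (momentSeries m) -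
      ∑ s ∈ Ico 1 n, freeCumulant m s * PowerSeries.coeff (n - s) (momentSeries m ^ s) := by
  rw [freeCumulant, momentSeries, PowerSeries.coeff_mk]
  congr 1
  exact sum_attach (Ico 1 n) fun s =>
    freeCumulant m s * PowerSeries.coeff (n - s) (momentSeries m ^ s)

end Moments

/-! ### Free cumulants in terms of power sums -/

section Cumulants

open Finset

/-- The coefficients, up to degree `10`, of the power series with constant coefficient `1` and
logarithmic derivative `∑ tₖ Xᵏ`, where `t₁ = 0`. -/
def coeffOfLogDeriv (t : ℕ → ℝ) : ℕ → ℝ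
  | 0 => 1
  | 2 => t 2 / 2
  | 3 => t 3 / 3
  | 4 => t 4 / 4 + t 2 ^ 2 / 8
  | 5 => t 5 / 5 + t 2 * t 3 / 6
  | 6 => t 6 / 6 + t 2 * t 4 / 8 + t 3 ^ 2 / 18 + t 2 ^ 3 / 48
  | 7 => t 7 / 7 + t 2 * t 5 / 10 + t 3 * t 4 / 12 + t 2 ^ 2 * t 3 / 24
  | 8 => t 8 / 8 + t 2 * t 6 / 12 + t 3 * t 5 / 15 + t 4 ^ 2 / 32 + t 2 ^ 2 * t 4 / 32 + t 2 * t 3 ^ 2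
    / 36 + t 2 ^ 4 / 384
  | 9 => t 9 / 9 + t 2 * t 7 / 14 + t 3 * t 6 / 18 + t 4 * t 5 / 20 + t 2 ^ 2 * t 5 / 40 + t 2 * t 3 *
    t 4 / 24 + t 3 ^ 3 / 162 + t 2 ^ 3 * t 3 / 144
  | 10 => t 10 / 10 + t 2 * t 8 / 16 + t 3 * t 7 / 21 + t 4 * t 6 / 24 + t 2 ^ 2 * t 6 / 48 + t 5 ^ 2 /
    50 + t 2 * t 3 * t 5 / 30 + t 2 * t 4 ^ 2 / 64 + t 3 ^ 2 * t 4 / 72 + t 2 ^ 3 * t 4 / 192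
    + t 2 ^ 2 * t 3 ^ 2 / 144 + t 2 ^ 5 / 3840
  -- This covers index 1, where the true coefficient is t₁ = 0; the value above 10 is arbitrary.
  | _ => 0

theorem HasLogDeriv.coeff_eq {E : PowerSeries ℝ} {t : ℕ → ℝ} (h : HasLogDeriv E t)
    (h0 : PowerSeries.coeff 0 E = 1) (ht0 : t 0 = 0) (ht1 : t 1 = 0) {n : ℕ} (hn : n ≤ 10) :
    PowerSeries.coeff n E = coeffOfLogDeriv t n := by
  have hrec (k : ℕ) : ((k + 1 : ℕ) : ℝ) * PowerSeries.coeff (k + 1) E =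
      ∑ j ∈ range (k + 1), PowerSeries.coeff j E * t (k + 1 - j) := by
    rw [h.natCast_mul_coeff, Nat.sum_antidiagonal_eq_sum_range_succ_mk, sum_range_succ]
    simp [ht0]
  have hdiv {a b c : ℝ} (hc : c ≠ 0) (h : c * a = b) : a = b / c := by
    rw [← h, mul_div_cancel_left₀ _ hc]
  have e0 : PowerSeries.coeff 0 E = coeffOfLogDeriv t 0 := h0
  have e1 : PowerSeries.coeff 1 E = coeffOfLogDeriv t 1 := by
    rw [hdiv (by norm_num) (hrec 0)]
    simp only [sum_range_succ, range_zero, sum_empty, e0, Nat.reduceAdd, Nat.reduceSub, ht1,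
      coeffOfLogDeriv]
    push_cast
    ring
  have e2 : PowerSeries.coeff 2 E = coeffOfLogDeriv t 2 := by
    rw [hdiv (by norm_num) (hrec 1)]
    simp only [sum_range_succ, range_zero, sum_empty, e0, e1, Nat.reduceAdd, Nat.reduceSub, ht1,
      coeffOfLogDeriv]
    push_cast
    ring
  have e3 : PowerSeries.coeff 3 E = coeffOfLogDeriv t 3 := by
    rw [hdiv (by norm_num) (hrec 2)]
    simp only [sum_range_succ, range_zero, sum_empty, e0, e1, e2, Nat.reduceAdd, Nat.reduceSub, ht1,
      coeffOfLogDeriv]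
    push_cast
    ring
  have e4 : PowerSeries.coeff 4 E = coeffOfLogDeriv t 4 := by
    rw [hdiv (by norm_num) (hrec 3)]
    simp only [sum_range_succ, range_zero, sum_empty, e0, e1, e2, e3, Nat.reduceAdd,
      Nat.reduceSub, ht1,
      coeffOfLogDeriv]
    push_cast
    ring
  have e5 : PowerSeries.coeff 5 E = coeffOfLogDeriv t 5 := by
    rw [hdiv (by norm_num) (hrec 4)]
    simp only [sum_range_succ, range_zero, sum_empty, e0, e1, e2, e3, e4, Nat.reduceAdd,
      Nat.reduceSub, ht1,
      coeffOfLogDeriv]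
    push_cast
    ring
  have e6 : PowerSeries.coeff 6 E = coeffOfLogDeriv t 6 := by
    rw [hdiv (by norm_num) (hrec 5)]
    simp only [sum_range_succ, range_zero, sum_empty, e0, e1, e2, e3, e4, e5, Nat.reduceAdd,
      Nat.reduceSub, ht1,
      coeffOfLogDeriv]
    push_cast
    ring
  have e7 : PowerSeries.coeff 7 E = coeffOfLogDeriv t 7 := by
    rw [hdiv (by norm_num) (hrec 6)]
    simp only [sum_range_succ, range_zero, sum_empty, e0, e1, e2, e3, e4, e5, e6, Nat.reduceAdd,
      Nat.reduceSub, ht1,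
      coeffOfLogDeriv]
    push_cast
    ring
  have e8 : PowerSeries.coeff 8 E = coeffOfLogDeriv t 8 := by
    rw [hdiv (by norm_num) (hrec 7)]
    simp only [sum_range_succ, range_zero, sum_empty, e0, e1, e2, e3, e4, e5, e6, e7,
      Nat.reduceAdd, Nat.reduceSub, ht1,
      coeffOfLogDeriv]
    push_cast
    ring
  have e9 : PowerSeries.coeff 9 E = coeffOfLogDeriv t 9 := by
    rw [hdiv (by norm_num) (hrec 8)]
    simp only [sum_range_succ, range_zero, sum_empty, e0, e1, e2, e3, e4, e5, e6, e7, e8,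
      Nat.reduceAdd, Nat.reduceSub, ht1,
      coeffOfLogDeriv]
    push_cast
    ring
  have e10 : PowerSeries.coeff 10 E = coeffOfLogDeriv t 10 := by
    rw [hdiv (by norm_num) (hrec 9)]
    simp only [sum_range_succ, range_zero, sum_empty, e0, e1, e2, e3, e4, e5, e6, e7, e8, e9,
      Nat.reduceAdd, Nat.reduceSub, ht1,
      coeffOfLogDeriv]
    push_cast
    ring
  interval_cases n <;> assumption

theorem momentLogDeriv_zero (S : Finset ℕ) : momentLogDeriv S 0 = 0 := by
  simp [momentLogDeriv]

theorem momentLogDeriv_one (S : Finset ℕ) : momentLogDeriv S 1 = 0 :=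
  sum_eq_zero fun b _ => by ring

theorem coeff_momentSeries_pow {n : ℕ} (μ : StrictPartition n) (d : ℕ) {j : ℕ} (hj : j ≤ 10) :
    PowerSeries.coeff j (momentSeries (transitionMeasure μ.double) ^ d) =
      coeffOfLogDeriv (fun k => d * momentLogDeriv μ.partSet k) j := by
  refine ((hasLogDeriv_momentSeries μ).pow d).coeff_eq ?_ ?_ ?_ hj
  · rw [PowerSeries.coeff_zero_eq_constantCoeff_apply, map_pow,
      ← PowerSeries.coeff_zero_eq_constantCoeff_apply, coeff_zero_momentSeries, one_pow]
  · rw [momentLogDeriv_zero, mul_zero]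
  · rw [momentLogDeriv_one, mul_zero]

theorem freeCumulant_double_rec {n : ℕ} (μ : StrictPartition n) {j : ℕ} (hj : j ≤ 10) :
    freeCumulant (transitionMeasure μ.double) j = coeffOfLogDeriv (momentLogDeriv μ.partSet) j -
      ∑ s ∈ Ico 1 j, freeCumulant (transitionMeasure μ.double) s *
        coeffOfLogDeriv (fun k => s * momentLogDeriv μ.partSet k) (j - s) := by
  rw [freeCumulant_eq]
  congr 1
  · have := coeff_momentSeries_pow μ 1 hj
    simpa using this
  · exact sum_congr rfl fun s _ => by rw [coeff_momentSeries_pow μ s (by omega)]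

/-- Lagrange inversion: the free cumulant `R_j` is `-1 / (j - 1)` times the coefficient of `tʲ` in
the power `1 - j` of the moment series. -/
theorem freeCumulant_double {n : ℕ} (μ : StrictPartition n) {j : ℕ} (hj2 : 2 ≤ j) (hj : j ≤ 10) :
    freeCumulant (transitionMeasure μ.double) j =
      -coeffOfLogDeriv (fun k => (1 - j : ℝ) * momentLogDeriv μ.partSet k) j / (j - 1) := by
  set t := momentLogDeriv μ.partSet
  have r1 : freeCumulant (transitionMeasure μ.double) 1 = 0 := by
    rw [freeCumulant_double_rec μ (by norm_num)]
    simp [coeffOfLogDeriv]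
  have r2 : freeCumulant (transitionMeasure μ.double) 2 =
      -coeffOfLogDeriv (fun k => (1 - (2 : ℕ) : ℝ) * t k) 2 / ((2 : ℕ) - 1) := by
    rw [freeCumulant_double_rec μ (by norm_num)]
    simp only [sum_Ico_eq_sum_range, sum_range_succ, range_zero, sum_empty,
      Nat.reduceSub, add_zero, r1, coeffOfLogDeriv]
    push_cast
    ring
  -- The odd cumulants are needed too: t₃ is in general nonzero, and they enter the recursion for
  -- the even ones.
  have r3 : freeCumulant (transitionMeasure μ.double) 3 =
      -coeffOfLogDeriv (fun k => (1 - (3 : ℕ) : ℝ) * t k) 3 / ((3 : ℕ) - 1) := by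
    rw [freeCumulant_double_rec μ (by norm_num)]
    simp only [sum_Ico_eq_sum_range, sum_range_succ, range_zero, sum_empty, Nat.reduceAdd,
      Nat.reduceSub, add_zero, r1, r2, coeffOfLogDeriv]
    push_cast
    ring
  have r4 : freeCumulant (transitionMeasure μ.double) 4 =
      -coeffOfLogDeriv (fun k => (1 - (4 : ℕ) : ℝ) * t k) 4 / ((4 : ℕ) - 1) := by
    rw [freeCumulant_double_rec μ (by norm_num)]
    simp only [sum_Ico_eq_sum_range, sum_range_succ, range_zero, sum_empty, Nat.reduceAdd,
      Nat.reduceSub, add_zero, r1, r2, r3, coeffOfLogDeriv]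
    push_cast
    ring
  have r5 : freeCumulant (transitionMeasure μ.double) 5 =
      -coeffOfLogDeriv (fun k => (1 - (5 : ℕ) : ℝ) * t k) 5 / ((5 : ℕ) - 1) := by
    rw [freeCumulant_double_rec μ (by norm_num)]
    simp only [sum_Ico_eq_sum_range, sum_range_succ, range_zero, sum_empty, Nat.reduceAdd,
      Nat.reduceSub, add_zero, r1, r2, r3, r4, coeffOfLogDeriv]
    push_cast
    ring
  have r6 : freeCumulant (transitionMeasure μ.double) 6 =
      -coeffOfLogDeriv (fun k => (1 - (6 : ℕ) : ℝ) * t k) 6 / ((6 : ℕ) - 1) := by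
    rw [freeCumulant_double_rec μ (by norm_num)]
    simp only [sum_Ico_eq_sum_range, sum_range_succ, range_zero, sum_empty, Nat.reduceAdd,
      Nat.reduceSub, add_zero, r1, r2, r3, r4, r5, coeffOfLogDeriv]
    push_cast
    ring
  have r7 : freeCumulant (transitionMeasure μ.double) 7 =
      -coeffOfLogDeriv (fun k => (1 - (7 : ℕ) : ℝ) * t k) 7 / ((7 : ℕ) - 1) := by
    rw [freeCumulant_double_rec μ (by norm_num)]
    simp only [sum_Ico_eq_sum_range, sum_range_succ, range_zero, sum_empty, Nat.reduceAdd,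
      Nat.reduceSub, add_zero, r1, r2, r3, r4, r5, r6, coeffOfLogDeriv]
    push_cast
    ring
  have r8 : freeCumulant (transitionMeasure μ.double) 8 =
      -coeffOfLogDeriv (fun k => (1 - (8 : ℕ) : ℝ) * t k) 8 / ((8 : ℕ) - 1) := by
    rw [freeCumulant_double_rec μ (by norm_num)]
    simp only [sum_Ico_eq_sum_range, sum_range_succ, range_zero, sum_empty, Nat.reduceAdd,
      Nat.reduceSub, add_zero, r1, r2, r3, r4, r5, r6, r7, coeffOfLogDeriv]
    push_cast
    ring
  have r9 : freeCumulant (transitionMeasure μ.double) 9 =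
      -coeffOfLogDeriv (fun k => (1 - (9 : ℕ) : ℝ) * t k) 9 / ((9 : ℕ) - 1) := by
    rw [freeCumulant_double_rec μ (by norm_num)]
    simp only [sum_Ico_eq_sum_range, sum_range_succ, range_zero, sum_empty, Nat.reduceAdd,
      Nat.reduceSub, add_zero, r1, r2, r3, r4, r5, r6, r7, r8, coeffOfLogDeriv]
    push_cast
    ring
  have r10 : freeCumulant (transitionMeasure μ.double) 10 =
      -coeffOfLogDeriv (fun k => (1 - (10 : ℕ) : ℝ) * t k) 10 / ((10 : ℕ) - 1) := by
    rw [freeCumulant_double_rec μ (by norm_num)]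
    simp only [sum_Ico_eq_sum_range, sum_range_succ, range_zero, sum_empty, Nat.reduceAdd,
      Nat.reduceSub, add_zero, r1, r2, r3, r4, r5, r6, r7, r8, r9, coeffOfLogDeriv]
    push_cast
    ring
  interval_cases j <;> assumption

/-- The summand changes sign under b ↦ -b, so only odd power sums appear, here and in the higher
indices. -/
theorem momentLogDeriv_2 (S : Finset ℕ) : momentLogDeriv S 2 =
    ((4 * powerSum 1 S : ℚ) : ℝ) := by
  simp only [momentLogDeriv, powerSum]
  push_cast
  simp only [mul_sum]
  exact sum_congr rfl fun b _ => by ring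

theorem momentLogDeriv_3 (S : Finset ℕ) : momentLogDeriv S 3 =
    ((6 * powerSum 1 S : ℚ) : ℝ) := by
  simp only [momentLogDeriv, powerSum]
  push_cast
  simp only [mul_sum]
  exact sum_congr rfl fun b _ => by ring

theorem momentLogDeriv_4 (S : Finset ℕ) : momentLogDeriv S 4 =
    ((8 * powerSum 3 S + 8 * powerSum 1 S : ℚ) : ℝ) := by
  simp only [momentLogDeriv, powerSum]
  push_cast
  simp only [mul_sum, ← sum_add_distrib]
  exact sum_congr rfl fun b _ => by ring

theorem momentLogDeriv_5 (S : Finset ℕ) : momentLogDeriv S 5 =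
    ((20 * powerSum 3 S + 10 * powerSum 1 S : ℚ) : ℝ) := by
  simp only [momentLogDeriv, powerSum]
  push_cast
  simp only [mul_sum, ← sum_add_distrib]
  exact sum_congr rfl fun b _ => by ring

theorem momentLogDeriv_6 (S : Finset ℕ) : momentLogDeriv S 6 =
    ((12 * powerSum 5 S + 40 * powerSum 3 S + 12 * powerSum 1 S : ℚ) : ℝ) := by
  simp only [momentLogDeriv, powerSum]
  push_cast
  simp only [mul_sum, ← sum_add_distrib]
  exact sum_congr rfl fun b _ => by ring

theorem momentLogDeriv_7 (S : Finset ℕ) : momentLogDeriv S 7 =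
    ((42 * powerSum 5 S + 70 * powerSum 3 S + 14 * powerSum 1 S : ℚ) : ℝ) := by
  simp only [momentLogDeriv, powerSum]
  push_cast
  simp only [mul_sum, ← sum_add_distrib]
  exact sum_congr rfl fun b _ => by ring

theorem momentLogDeriv_8 (S : Finset ℕ) : momentLogDeriv S 8 =
    ((16 * powerSum 7 S + 112 * powerSum 5 S + 112 * powerSum 3 S + 16 * powerSum 1 S : ℚ) : ℝ) := by
  simp only [momentLogDeriv, powerSum]
  push_cast
  simp only [mul_sum, ← sum_add_distrib]
  exact sum_congr rfl fun b _ => by ring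

/-- Index 9 can be skipped: in degree 10 it would occur only multiplied by t₁ = 0. -/
theorem momentLogDeriv_10 (S : Finset ℕ) : momentLogDeriv S 10 =
    ((20 * powerSum 9 S + 240 * powerSum 7 S + 504 * powerSum 5 S + 240 * powerSum 3 S + 20 * powerSum 1 S : ℚ) : ℝ) := by
  simp only [momentLogDeriv, powerSum]
  push_cast
  simp only [mul_sum, ← sum_add_distrib]
  exact sum_congr rfl fun b _ => by ring

/-- The spin free cumulant `ℜ_2` as a polynomial in the power sums of the parts. -/
def cumulantPoly2 {K : Type*} [Field K] (p1 _p3 _p5 _p7 _p9 : K) : K :=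
  p1

theorem spinFreeCumulant_2 {n : ℕ} (μ : StrictPartition n) :
    spinFreeCumulant 2 μ = (evalPowerSums cumulantPoly2 μ.partSet : ℚ) := by
  rw [spinFreeCumulant, freeCumulant_double μ (by norm_num) (by norm_num)]
  simp only [coeffOfLogDeriv, evalPowerSums, cumulantPoly2, momentLogDeriv_2]
  push_cast
  ring

/-- The spin free cumulant `ℜ_4` as a polynomial in the power sums of the parts. -/
def cumulantPoly4 {K : Type*} [Field K] (p1 p3 _p5 _p7 _p9 : K) : K :=
  p3 - 3 * p1 ^ 2 + p1

theorem spinFreeCumulant_4 {n : ℕ} (μ : StrictPartition n) :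
    spinFreeCumulant 4 μ = (evalPowerSums cumulantPoly4 μ.partSet : ℚ) := by
  rw [spinFreeCumulant, freeCumulant_double μ (by norm_num) (by norm_num)]
  simp only [coeffOfLogDeriv, evalPowerSums, cumulantPoly4, momentLogDeriv_2, momentLogDeriv_4]
  push_cast
  ring

/-- The spin free cumulant `ℜ_6` as a polynomial in the power sums of the parts. -/
def cumulantPoly6 {K : Type*} [Field K] (p1 p3 p5 _p7 _p9 : K) : K :=
  p5 - 10 * p1 * p3 + 50 / 3 * p1 ^ 3 + 10 / 3 * p3 - 15 * p1 ^ 2 + p1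

theorem spinFreeCumulant_6 {n : ℕ} (μ : StrictPartition n) :
    spinFreeCumulant 6 μ = (evalPowerSums cumulantPoly6 μ.partSet : ℚ) := by
  rw [spinFreeCumulant, freeCumulant_double μ (by norm_num) (by norm_num)]
  simp only [coeffOfLogDeriv, evalPowerSums, cumulantPoly6, momentLogDeriv_2, momentLogDeriv_3,
    momentLogDeriv_4, momentLogDeriv_6]
  push_cast
  ring

/-- The spin free cumulant `ℜ_8` as a polynomial in the power sums of the parts. -/
def cumulantPoly8 {K : Type*} [Field K] (p1 p3 p5 p7 _p9 : K) : K :=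
  p7 - 7 * p3 ^ 2 - 14 * p1 * p5 + 98 * p1 ^ 2 * p3 - 343 / 3 * p1 ^ 4 + 7 * p5 - 266 / 3 * p1 *
    p3 + 196 * p1 ^ 3 + 7 * p3 - 35 * p1 ^ 2 + p1

theorem spinFreeCumulant_8 {n : ℕ} (μ : StrictPartition n) :
    spinFreeCumulant 8 μ = (evalPowerSums cumulantPoly8 μ.partSet : ℚ) := by
  rw [spinFreeCumulant, freeCumulant_double μ (by norm_num) (by norm_num)]
  simp only [coeffOfLogDeriv, evalPowerSums, cumulantPoly8, momentLogDeriv_2, momentLogDeriv_3,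
    momentLogDeriv_4, momentLogDeriv_5, momentLogDeriv_6, momentLogDeriv_8]
  push_cast
  ring

/-- The spin free cumulant `ℜ_10` as a polynomial in the power sums of the parts. -/
def cumulantPoly10 {K : Type*} [Field K] (p1 p3 p5 p7 p9 : K) : K :=
  p9 - 18 * p3 * p5 - 18 * p1 * p7 + 162 * p1 * p3 ^ 2 + 162 * p1 ^ 2 * p5 - 972 * p1 ^ 3 * p3 +
    4374 / 5 * p1 ^ 5 + 12 * p7 - 96 * p3 ^ 2 - 198 * p1 * p5 + 1674 * p1 ^ 2 * p3 - 2430 * p1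
    ^ 4 + 126 / 5 * p5 - 330 * p1 * p3 + 810 * p1 ^ 3 + 12 * p3 - 63 * p1 ^ 2 + p1

theorem spinFreeCumulant_10 {n : ℕ} (μ : StrictPartition n) :
    spinFreeCumulant 10 μ = (evalPowerSums cumulantPoly10 μ.partSet : ℚ) := by
  rw [spinFreeCumulant, freeCumulant_double μ (by norm_num) (by norm_num)]
  simp only [coeffOfLogDeriv, evalPowerSums, cumulantPoly10, momentLogDeriv_2, momentLogDeriv_3,
    momentLogDeriv_4, momentLogDeriv_5, momentLogDeriv_6, momentLogDeriv_7, momentLogDeriv_8,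
    momentLogDeriv_10]
  push_cast
  ring

end Cumulants

/-! ### Algebraic independence of the spin free cumulants -/

section Density

open Finset MvPolynomial

/-- The vector `(m, m³, …, m⁹)`. -/
def oddPowers (m : ℚ) : Fin 5 → ℚ := fun i => m ^ (2 * (i : ℕ) + 1)

/-- The vector `(p₁, p₃, …, p₉)` of power sums. -/
def oddPowerSums (S : Finset ℕ) : Fin 5 → ℚ := fun i => powerSum (2 * (i : ℕ) + 1) S

theorem aeval_eq_eval_rat {σ : Type*} (w : σ → ℚ) (P : MvPolynomial σ ℚ) :
    aeval w P = eval w P := by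
  rw [← coe_aeval_eq_eval, RingHom.coe_coe]

/-- Adding a new part m to S shifts the power sums by `oddPowers m`. The value of P is a polynomial
in m with infinitely many roots, hence zero for every rational x, whether or not x could be a part.
-/
theorem eval_add_oddPowers {P : MvPolynomial (Fin 5) ℚ} {w : Fin 5 → ℚ}
    (h : ∀ S : Finset ℕ, 0 ∉ S → eval (oddPowerSums S + w) P = 0) (x : ℚ) {S : Finset ℕ}
    (hS : 0 ∉ S) : eval (oddPowerSums S + (w + oddPowers x)) P = 0 := by
  set T : Polynomial ℚ := aeval (fun i : Fin 5 =>
    Polynomial.C (oddPowerSums S i + w i) + Polynomial.X ^ (2 * (i : ℕ) + 1)) P with hT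
  have hev (m : ℚ) : T.eval m = eval (oddPowerSums S + (w + oddPowers m)) P := by
    have h1 : (Polynomial.aeval m) T = aeval (fun i : Fin 5 => Polynomial.aeval m
        (Polynomial.C (oddPowerSums S i + w i) + Polynomial.X ^ (2 * (i : ℕ) + 1))) P := by
      rw [hT, ← AlgHom.comp_apply, comp_aeval]
    rw [Polynomial.coe_aeval_eq_eval] at h1
    rw [h1, aeval_eq_eval_rat]
    refine congrArg (fun w => eval w P) (_root_.funext fun i => ?_)
    simp [oddPowers, add_assoc]
  have hinf : ((fun m : ℕ => (m : ℚ)) '' ((insert 0 S : Finset ℕ) : Set ℕ)ᶜ).Infinite :=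
    ((insert 0 S).finite_toSet.infinite_compl).image (Nat.cast_injective.injOn)
  have h0 : T = 0 := by
    refine Polynomial.eq_zero_of_infinite_isRoot T (hinf.mono ?_)
    rintro _ ⟨m, hm, rfl⟩
    have hm' : m ∉ insert 0 S := hm
    rw [mem_insert, not_or] at hm'
    have h1 := h (insert m S) (by
      rw [mem_insert, not_or]
      exact ⟨fun h => hm'.1 h.symm, hS⟩)
    change T.eval (m : ℚ) = 0
    rw [hev, ← h1]
    congr 2
    funext i
    simp only [Pi.add_apply, oddPowerSums, powerSum, sum_insert hm'.2, oddPowers]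
    ring
  rw [← hev, h0, Polynomial.eval_zero]

/-- Iterating `eval_add_oddPowers` from the empty set allows repeated parts, here the part j + 1
with multiplicity a j. -/
theorem eval_sum_oddPowers {P : MvPolynomial (Fin 5) ℚ}
    (h : ∀ S : Finset ℕ, 0 ∉ S → eval (oddPowerSums S) P = 0) (a : Fin 5 → ℕ) :
    eval (∑ j : Fin 5, (a j : ℚ) • oddPowers ((j : ℕ) + 1)) P = 0 := by
  have h1 (d : ℕ) (x : ℚ) (w : Fin 5 → ℚ)
      (hw : ∀ S : Finset ℕ, 0 ∉ S → eval (oddPowerSums S + w) P = 0) :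
      ∀ S : Finset ℕ, 0 ∉ S → eval (oddPowerSums S + (w + (d : ℚ) • oddPowers x)) P = 0 := by
    induction d with
    | zero => simpa using hw
    | succ d ih =>
      intro S hS
      have := eval_add_oddPowers ih x hS
      rw [Nat.cast_succ, add_smul, one_smul, ← add_assoc w]
      exact this
  have h2 (t : Finset (Fin 5)) : ∀ S : Finset ℕ, 0 ∉ S →
      eval (oddPowerSums S + ∑ j ∈ t, (a j : ℚ) • oddPowers ((j : ℕ) + 1)) P = 0 := by
    induction t using Finset.induction_on with
    | empty => simpa using h
    | insert j t hj ih =>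
      intro S hS
      rw [sum_insert hj, add_comm ((a j : ℚ) • _)]
      exact h1 _ _ _ ih S hS
  have h3 := h2 univ ∅ (notMem_empty 0)
  have h4 : oddPowerSums ∅ = 0 := by
    funext i
    simp [oddPowerSums, powerSum]
  rwa [h4, zero_add] at h3

/-- The matrix of odd powers of 1, …, 5 is a Vandermonde matrix in the squares with columns scaled
by nonzero numbers. -/
theorem exists_sum_oddPowers (w : Fin 5 → ℚ) :
    ∃ a : Fin 5 → ℚ, ∑ j : Fin 5, a j • oddPowers ((j : ℕ) + 1) = w := by
  set y : Fin 5 → ℚ := fun j => (j : ℕ) + 1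
  set A : Matrix (Fin 5) (Fin 5) ℚ := Matrix.of fun i j => y j * (Matrix.vandermonde fun j => y j ^ 2).transpose i j
  have hA : IsUnit A.det := by
    rw [Matrix.det_mul_row, Matrix.det_transpose, isUnit_iff_ne_zero]
    refine mul_ne_zero (prod_ne_zero_iff.2 fun j _ => by positivity)
      (Matrix.det_vandermonde_ne_zero_iff.2 fun i j h => ?_)
    have h1 : y i = y j := (sq_eq_sq₀ (by positivity) (by positivity)).1 h
    have h2 : ((i : ℕ) : ℚ) = (j : ℕ) := add_right_cancel h1
    exact Fin.ext (by exact_mod_cast h2)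
  refine ⟨A⁻¹.mulVec w, ?_⟩
  have h1 : A.mulVec (A⁻¹.mulVec w) = w := by
    rw [Matrix.mulVec_mulVec, Matrix.mul_nonsing_inv A hA, Matrix.one_mulVec]
  funext i
  conv_rhs => rw [← h1]
  simp only [Finset.sum_apply, Pi.smul_apply, smul_eq_mul, Matrix.mulVec, dotProduct, oddPowers]
  refine sum_congr rfl fun j _ => ?_
  have hAij : A i j = y j ^ (2 * (i : ℕ) + 1) := by
    simp only [A, Matrix.of_apply, Matrix.transpose_apply, Matrix.vandermonde_apply]
    rw [← pow_mul, pow_succ, mul_comm]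
  rw [hAij, mul_comm]

/-- In the coordinates a of `eval_sum_oddPowers`, P vanishes on all of ℕ⁵ and so everywhere; these
coordinates reach every point by `exists_sum_oddPowers`. -/
theorem eq_zero_of_eval_oddPowerSums {P : MvPolynomial (Fin 5) ℚ}
    (h : ∀ S : Finset ℕ, 0 ∉ S → eval (oddPowerSums S) P = 0) : P = 0 := by
  set L : Fin 5 → MvPolynomial (Fin 5) ℚ := fun i =>
    ∑ j : Fin 5, X j * C (oddPowers ((j : ℕ) + 1) i) with hL
  have hev (a : Fin 5 → ℚ) : eval a (bind₁ L P) =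
      eval (∑ j : Fin 5, a j • oddPowers ((j : ℕ) + 1)) P := by
    rw [← aeval_eq_eval_rat, ← aeval_eq_eval_rat, aeval_bind₁]
    refine congrArg (fun w => aeval w P) (_root_.funext fun i => ?_)
    simp [hL]
  have h0 : bind₁ L P = 0 := by
    refine funext_set (fun _ => Set.range (Nat.cast : ℕ → ℚ))
      (fun _ => Set.infinite_range_of_injective Nat.cast_injective) fun a ha => ?_
    choose b hb using fun i => ha i (Set.mem_univ i)
    rw [hev, map_zero, ← eval_sum_oddPowers h b]
    simp only [hb]
  refine MvPolynomial.funext fun w => ?_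
  obtain ⟨a, rfl⟩ := exists_sum_oddPowers w
  rw [← hev, h0, map_zero, map_zero]

/-- The spin free cumulants as polynomials in the power sums. -/
def cumulantMvPoly : Fin 5 → MvPolynomial (Fin 5) ℚ :=
  ![X 0,
    X 1 - 3 * X 0 ^ 2 + X 0,
    X 2 - 10 * X 0 * X 1 + C (50 / 3) * X 0 ^ 3 + C (10 / 3) * X 1 - 15 * X 0 ^ 2 + X 0,
    X 3 - 7 * X 1 ^ 2 - 14 * X 0 * X 2 + 98 * X 0 ^ 2 * X 1 - C (343 / 3) * X 0 ^ 4 + 7 * X 2 - C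
      (266 / 3) * X 0 * X 1 + 196 * X 0 ^ 3 + 7 * X 1 - 35 * X 0 ^ 2 + X 0,
    X 4 - 18 * X 1 * X 2 - 18 * X 0 * X 3 + 162 * X 0 * X 1 ^ 2 + 162 * X 0 ^ 2 * X 2 - 972 * X 0
      ^ 3 * X 1 + C (4374 / 5) * X 0 ^ 5 + 12 * X 3 - 96 * X 1 ^ 2 - 198 * X 0 * X 2 + 1674 *
      X 0 ^ 2 * X 1 - 2430 * X 0 ^ 4 + C (126 / 5) * X 2 - 330 * X 0 * X 1 + 810 * X 0 ^ 3 +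
      12 * X 1 - 63 * X 0 ^ 2 + X 0]

theorem spinFreeCumulant_eq {n : ℕ} (μ : StrictPartition n) (i : Fin 5) :
    spinFreeCumulant (2 * ((i : ℕ) + 1)) μ =
      (eval (oddPowerSums μ.partSet) (cumulantMvPoly i) : ℚ) := by
  fin_cases i
  · refine (spinFreeCumulant_2 μ).trans ?_
    simp [cumulantMvPoly, evalPowerSums, cumulantPoly2, oddPowerSums]
  · refine (spinFreeCumulant_4 μ).trans ?_
    simp [cumulantMvPoly, evalPowerSums, cumulantPoly4, oddPowerSums]
  · refine (spinFreeCumulant_6 μ).trans ?_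
    simp [cumulantMvPoly, evalPowerSums, cumulantPoly6, oddPowerSums]
  · refine (spinFreeCumulant_8 μ).trans ?_
    simp [cumulantMvPoly, evalPowerSums, cumulantPoly8, oddPowerSums]
  · refine (spinFreeCumulant_10 μ).trans ?_
    simp [cumulantMvPoly, evalPowerSums, cumulantPoly10, oddPowerSums]

/-- Triangularity: each ℜ_{2k} is p_{2k-1} plus a polynomial in the earlier power sums, so the
equations are solved one after another. -/
theorem exists_eval_cumulantMvPoly (r : Fin 5 → ℚ) :
    ∃ p : Fin 5 → ℚ, ∀ i, eval p (cumulantMvPoly i) = r i := by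
  obtain ⟨p0, h0⟩ : ∃ p, cumulantPoly2 p 0 0 0 0 = r 0 := ⟨r 0, rfl⟩
  obtain ⟨p1, h1⟩ : ∃ p, cumulantPoly4 p0 p 0 0 0 = r 1 :=
    ⟨r 1 - cumulantPoly4 p0 0 0 0 0, by simp only [cumulantPoly4]; ring⟩
  obtain ⟨p2, h2⟩ : ∃ p, cumulantPoly6 p0 p1 p 0 0 = r 2 :=
    ⟨r 2 - cumulantPoly6 p0 p1 0 0 0, by simp only [cumulantPoly6]; ring⟩
  obtain ⟨p3, h3⟩ : ∃ p, cumulantPoly8 p0 p1 p2 p 0 = r 3 :=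
    ⟨r 3 - cumulantPoly8 p0 p1 p2 0 0, by simp only [cumulantPoly8]; ring⟩
  obtain ⟨p4, h4⟩ : ∃ p, cumulantPoly10 p0 p1 p2 p3 p = r 4 :=
    ⟨r 4 - cumulantPoly10 p0 p1 p2 p3 0, by simp only [cumulantPoly10]; ring⟩
  refine ⟨![p0, p1, p2, p3, p4], fun i => ?_⟩
  fin_cases i
  · simpa [cumulantMvPoly, cumulantPoly2] using h0
  · simpa [cumulantMvPoly, cumulantPoly4] using h1
  · simpa [cumulantMvPoly, cumulantPoly6] using h2
  · simpa [cumulantMvPoly, cumulantPoly8] using h3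
  · simpa [cumulantMvPoly, cumulantPoly10] using h4

/-- After substitution Q becomes a polynomial in power sums that vanishes on all strict partitions,
hence is zero; the substitution is onto on rational points, so Q vanishes everywhere. -/
theorem eq_zero_of_aeval_spinFreeCumulant {k : ℕ} (hk : k ≤ 5) {Q : MvPolynomial (Fin k) ℚ}
    (h : ∀ (n : ℕ) (μ : StrictPartition n),
      aeval (fun i : Fin k => spinFreeCumulant (2 * ((i : ℕ) + 1)) μ) Q = 0) : Q = 0 := by
  set F : Fin k → MvPolynomial (Fin 5) ℚ := fun i => cumulantMvPoly (Fin.castLE hk i)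
  have h1 : bind₁ F Q = 0 := by
    refine eq_zero_of_eval_oddPowerSums fun S hS => ?_
    obtain ⟨μ, hμ⟩ : ∃ μ : StrictPartition (∑ m ∈ S, m), μ.partSet = S := by
      refine ⟨⟨⟨S.val, fun {i} hi => Nat.pos_of_ne_zero fun h => hS (h ▸ hi), ?_⟩, S.nodup⟩, ?_⟩
      · rw [Finset.sum_eq_multiset_sum, Multiset.map_id']
      · simp [StrictPartition.partSet]
    have h2 := h _ μ
    have h3 (i : Fin k) : spinFreeCumulant (2 * ((i : ℕ) + 1)) μ =
        algebraMap ℚ ℝ (eval (oddPowerSums S) (F i)) := by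
      have h4 := spinFreeCumulant_eq μ (Fin.castLE hk i)
      rwa [hμ] at h4
    simp only [h3] at h2
    have h4 := aeval_algebraMap_apply ℝ (fun i => eval (oddPowerSums S) (F i)) Q
    rw [Function.comp_def, h2] at h4
    rw [← aeval_eq_eval_rat, aeval_bind₁]
    simp only [aeval_eq_eval_rat] at h4 ⊢
    exact (map_eq_zero_iff _ (algebraMap ℚ ℝ).injective).1 h4.symm
  refine MvPolynomial.funext fun r => ?_
  -- The cumulants beyond the first k do not enter Q; the value 0 for them is arbitrary.
  obtain ⟨p, hp⟩ := exists_eval_cumulantMvPoly fun i => if h : (i : ℕ) < k then r ⟨i, h⟩ else 0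
  have h2 := congrArg (eval p) h1
  rw [map_zero, ← aeval_eq_eval_rat, aeval_bind₁] at h2
  rw [map_zero, ← h2, ← aeval_eq_eval_rat]
  refine congrArg (fun w => aeval w Q) (_root_.funext fun i => ?_)
  rw [aeval_eq_eval_rat, hp]
  simp

theorem isSpinKerovPolynomial_iff {k : ℕ} (hk : k ≤ 5) {K₀ : MvPolynomial (Fin k) ℚ}
    (h₀ : IsSpinKerovPolynomial k K₀) (K : MvPolynomial (Fin k) ℚ) :
    IsSpinKerovPolynomial k K ↔ K = K₀ := by
  refine ⟨fun h => ?_, fun h => h ▸ h₀⟩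
  rw [← sub_eq_zero]
  refine eq_zero_of_aeval_spinFreeCumulant hk fun n μ => ?_
  rw [map_sub, ← h n μ, ← h₀ n μ, sub_self]

end Density

end SpinKerov

end

/-! ### The five spin Kerov polynomials. -/

theorem mainTheorem2 :
    (∀ K : MvPolynomial (Fin 1) ℚ, SpinKerov.IsSpinKerovPolynomial 1 K ↔
      K = MvPolynomial.X 0) ∧
    (∀ K : MvPolynomial (Fin 2) ℚ, SpinKerov.IsSpinKerovPolynomial 2 K ↔
      K = MvPolynomial.X 1 + MvPolynomial.X 0) ∧
    (∀ K : MvPolynomial (Fin 3) ℚ, SpinKerov.IsSpinKerovPolynomial 3 K ↔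
      K = MvPolynomial.X 2 + 15 * MvPolynomial.X 1 + 10 * MvPolynomial.X 0 ^ 2
        + 8 * MvPolynomial.X 0) ∧
    (∀ K : MvPolynomial (Fin 4) ℚ, SpinKerov.IsSpinKerovPolynomial 4 K ↔
      K = MvPolynomial.X 3 + 70 * MvPolynomial.X 2
        + 168 * MvPolynomial.X 1 * MvPolynomial.X 0 + 56 * MvPolynomial.X 0 ^ 3
        + 469 * MvPolynomial.X 1 + 560 * MvPolynomial.X 0 ^ 2 + 180 * MvPolynomial.X 0) ∧
    (∀ K : MvPolynomial (Fin 5) ℚ, SpinKerov.IsSpinKerovPolynomial 5 K ↔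
      K = MvPolynomial.X 4 + 210 * MvPolynomial.X 3
        + 600 * MvPolynomial.X 2 * MvPolynomial.X 0 + 540 * MvPolynomial.X 1 ^ 2
        + 1080 * MvPolynomial.X 1 * MvPolynomial.X 0 ^ 2 + 240 * MvPolynomial.X 0 ^ 4
        + 5985 * MvPolynomial.X 2 + 23016 * MvPolynomial.X 1 * MvPolynomial.X 0
        + 9120 * MvPolynomial.X 0 ^ 3 + 26060 * MvPolynomial.X 1
        + 41628 * MvPolynomial.X 0 ^ 2 + 8064 * MvPolynomial.X 0) := by
  refine ⟨SpinKerov.isSpinKerovPolynomial_iff (by norm_num) fun n μ => ?_,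
    SpinKerov.isSpinKerovPolynomial_iff (by norm_num) fun n μ => ?_,
    SpinKerov.isSpinKerovPolynomial_iff (by norm_num) fun n μ => ?_,
    SpinKerov.isSpinKerovPolynomial_iff (by norm_num) fun n μ => ?_,
    SpinKerov.isSpinKerovPolynomial_iff (by norm_num) fun n μ => ?_⟩
  · refine (congrArg (Rat.cast : ℚ → ℝ) (SpinKerov.spinCharacter_one μ)).trans ?_
    -- The index 2(0 + 1) reduces to 2 by definition; stating it unreduced lets the simplifier match
    -- the values of the variables.
    have e0 : SpinKerov.spinFreeCumulant (2 * (((0 : Fin 1) : ℕ) + 1)) μ = _ :=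
      SpinKerov.spinFreeCumulant_2 μ
    simp only [MvPolynomial.aeval_X, e0,
      SpinKerov.evalPowerSums, SpinKerov.spinPoly1, SpinKerov.cumulantPoly2]
  · refine (congrArg (Rat.cast : ℚ → ℝ) (SpinKerov.spinCharacter_three μ)).trans ?_
    have e0 : SpinKerov.spinFreeCumulant (2 * (((0 : Fin 2) : ℕ) + 1)) μ = _ :=
      SpinKerov.spinFreeCumulant_2 μ
    have e1 : SpinKerov.spinFreeCumulant (2 * (((1 : Fin 2) : ℕ) + 1)) μ = _ :=
      SpinKerov.spinFreeCumulant_4 μ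
    simp only [map_add, MvPolynomial.aeval_X, e0, e1,
      SpinKerov.evalPowerSums, SpinKerov.spinPoly3, SpinKerov.cumulantPoly2,
        SpinKerov.cumulantPoly4]
    push_cast
    ring
  · refine (congrArg (Rat.cast : ℚ → ℝ) (SpinKerov.spinCharacter_five μ)).trans ?_
    have e0 : SpinKerov.spinFreeCumulant (2 * (((0 : Fin 3) : ℕ) + 1)) μ = _ :=
      SpinKerov.spinFreeCumulant_2 μ
    have e1 : SpinKerov.spinFreeCumulant (2 * (((1 : Fin 3) : ℕ) + 1)) μ = _ :=
      SpinKerov.spinFreeCumulant_4 μ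
    have e2 : SpinKerov.spinFreeCumulant (2 * (((2 : Fin 3) : ℕ) + 1)) μ = _ :=
      SpinKerov.spinFreeCumulant_6 μ
    simp only [map_add, map_mul, map_pow, map_ofNat, MvPolynomial.aeval_X, e0, e1, e2,
      SpinKerov.evalPowerSums, SpinKerov.spinPoly5, SpinKerov.cumulantPoly2,
        SpinKerov.cumulantPoly4, SpinKerov.cumulantPoly6]
    push_cast
    ring
  · refine (congrArg (Rat.cast : ℚ → ℝ) (SpinKerov.spinCharacter_seven μ)).trans ?_
    have e0 : SpinKerov.spinFreeCumulant (2 * (((0 : Fin 4) : ℕ) + 1)) μ = _ :=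
      SpinKerov.spinFreeCumulant_2 μ
    have e1 : SpinKerov.spinFreeCumulant (2 * (((1 : Fin 4) : ℕ) + 1)) μ = _ :=
      SpinKerov.spinFreeCumulant_4 μ
    have e2 : SpinKerov.spinFreeCumulant (2 * (((2 : Fin 4) : ℕ) + 1)) μ = _ :=
      SpinKerov.spinFreeCumulant_6 μ
    have e3 : SpinKerov.spinFreeCumulant (2 * (((3 : Fin 4) : ℕ) + 1)) μ = _ :=
      SpinKerov.spinFreeCumulant_8 μ
    simp only [map_add, map_mul, map_pow, map_ofNat, MvPolynomial.aeval_X, e0, e1, e2, e3,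
      SpinKerov.evalPowerSums, SpinKerov.spinPoly7, SpinKerov.cumulantPoly2,
        SpinKerov.cumulantPoly4, SpinKerov.cumulantPoly6, SpinKerov.cumulantPoly8]
    push_cast
    ring
  · refine (congrArg (Rat.cast : ℚ → ℝ) (SpinKerov.spinCharacter_nine μ)).trans ?_
    have e0 : SpinKerov.spinFreeCumulant (2 * (((0 : Fin 5) : ℕ) + 1)) μ = _ :=
      SpinKerov.spinFreeCumulant_2 μ
    have e1 : SpinKerov.spinFreeCumulant (2 * (((1 : Fin 5) : ℕ) + 1)) μ = _ :=
      SpinKerov.spinFreeCumulant_4 μ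
    have e2 : SpinKerov.spinFreeCumulant (2 * (((2 : Fin 5) : ℕ) + 1)) μ = _ :=
      SpinKerov.spinFreeCumulant_6 μ
    have e3 : SpinKerov.spinFreeCumulant (2 * (((3 : Fin 5) : ℕ) + 1)) μ = _ :=
      SpinKerov.spinFreeCumulant_8 μ
    have e4 : SpinKerov.spinFreeCumulant (2 * (((4 : Fin 5) : ℕ) + 1)) μ = _ :=
      SpinKerov.spinFreeCumulant_10 μ
    simp only [map_add, map_mul, map_pow, map_ofNat, MvPolynomial.aeval_X, e0, e1, e2, e3, e4,
      SpinKerov.evalPowerSums, SpinKerov.spinPoly9, SpinKerov.cumulantPoly2,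
        SpinKerov.cumulantPoly4, SpinKerov.cumulantPoly6, SpinKerov.cumulantPoly8,
        SpinKerov.cumulantPoly10]
    push_cast
    ring
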